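/- Let $K$ be a complete discrete valuation field of characteristic $0$ with valuation ring $\mathcal O_K$, maximal ideal $\mathfrak m_K$, normalized valuation $v_K$ and perfect residue field of characteristic $p>0$, and let $\bar K$ be an algebraic closure of $K$. For a commutative one-dimensional formal group $F$ over $\mathcal O_K$ let $F(K)$ and $F(\bar K)$ be the groups with underlying sets $\mathfrak m_K$ and $\mathfrak m_{\bar K}$ and operation $x+y:=F(x,y)$, and let $F^m(K)\subset F(K)$ be the subgroup $\mathfrak m_K^m$. A homomorphism of formal groups $\phi(T)\in\mathcal O_K[[T]]$ is an isogeny of height $h\ge 1$ if $\phi(T)\equiv\psi(T^{p^h})\pmod{\mathfrak m_K}$ for some $\psi\in\mathcal O_K[[T]]$ whose coefficient of $T$ is a unit. Let $n\ge 1$ and let $\phi:F\to G$ be an isogeny over $\mathcal O_K$ of height $n$ between commutative one-dimensional formal groups whose kernel $F[\phi]\subset F(\bar K)$ is cyclic and contained in $F(K)$. Let $\phi=\phi_1\circ\cdots\circ\phi_n$ be its factorization into isogenies $\phi_i:G_i\to G_{i-1}$ of height $1$ over $\mathcal O_K$, where $G_i=F/p^iF[\phi]$ (that is, $p^iF[\phi]$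 is the kernel of $\phi_{i+1}\circ\cdots\circ\phi_n:F\to G_i$), $G_n=F$ and $G_0=G$. Let $t_i$ be the valuation $v_K$ of the coefficient of $T$ in $\phi_i(T)$, and put $c_i(\phi)=t_1+\cdots+t_i+\frac{t_i}{p-1}$ for $1\le i\le n$. Let $G^m(\phi)$ be the image of $G^m(K)$ in $G(\phi):=G(K)/\phi(F(K))$. **Proposition 2.9.** Let $m$ be an integer with $1\le m<c_1(\phi)$ and $p\nmid m$, let $y\in G^m(\phi)\setminus G^{m+1}(\phi)$, and let $x\in F(\bar K)$ be such that $\phi(x)$ lies in $G(K)$ and has class $y$ in $G(\phi)$. Then $L=K(x)$ is a totally ramified Galois extension of $K$ of degree $p^n$. The jumps of the ramification filtration in the upper numbering of $H=\mathrm{Gal}(L/K)$, i.e. the real numbers $v\ge -1$ with $H^v\ne H^{v+\varepsilon}$ for all $\varepsilon>0$, are exactly $c_1(\phi)-m,\dots,c_n(\phi)-m$. In particular, $H^{c_n(\phi)-m}\ne 1$. -/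

import Mathlib

open Filter IsLocalRing

noncomputable section

namespace FormalIsogeny

/-! ### Power series over a discrete valuation ring `R`, evaluated in an `R`-algebra `A`

`R` is the valuation ring of a discretely valued field `K`. The algebra `A` is `R` itself or the
integral closure of `R` in an algebraic extension of `K`, which is the valuation ring of the unique
extension of the valuation when `R` is complete. -/

section Evaluation

variable {R : Type*} [CommRing R] {A : Type*} [CommRing A] [Algebra R A]

variable (R) in
/-- The sequence `s` in `A` converges to `y` in the valuation topology, i.e. the topology whose
basic neighbourhoods of `0` are the ideals `r A` with `r` a nonzero element of `R`. -/
def ConvergesTo (s : ℕ → A) (y : A) : Prop :=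
  ∀ r : R, r ≠ 0 → ∀ᶠ N in atTop, algebraMap R A r ∣ s N - y

/-- `f(x) = y`: the series `∑ aᵢ xⁱ` converges to `y`. -/
def HasValue (f : PowerSeries R) (x y : A) : Prop :=
  ConvergesTo R (fun N => ∑ i ∈ Finset.range N, algebraMap R A (PowerSeries.coeff i f) * x ^ i) y

/-- `F(x, y) = z`, i.e. `x + y = z` in the group of points of the formal group `F`: the series
`∑ aᵢⱼ xⁱ yʲ` converges to `z`. -/
def HasFormalSum (F : FormalGroup R) (x y z : A) : Prop :=
  ConvergesTo R (fun N => ∑ i ∈ Finset.range N, ∑ j ∈ Finset.range N,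
    algebraMap R A (MvPowerSeries.coeff (Finsupp.single 0 i + Finsupp.single 1 j) F.toPowerSeries)
      * x ^ i * y ^ j) z

/-- `[k] x = z` in the group of points of the formal group `F`, for a natural number `k`. -/
def HasMultiple (F : FormalGroup R) (x : A) : ℕ → A → Prop
  | 0, z => z = 0
  | k + 1, z => ∃ w, HasMultiple F x k w ∧ HasFormalSum F w x z

variable (A) in
/-- The kernel of `f` on points with values in the maximal ideal of the local ring `A`
(for a local ring the Jacobson radical is the maximal ideal). -/
def kernel (f : PowerSeries R) : Set A :=
  {z | z ∈ Ring.jacobson A ∧ HasValue f z 0}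

/-- The subset `q S = {[q] w | w ∈ S}` of the group of points of `F`. -/
def multiples (F : FormalGroup R) (q : ℕ) (S : Set A) : Set A :=
  {z | ∃ w ∈ S, HasMultiple F w q z}

end Evaluation

/-! ### Isogenies of formal groups -/

section Isogeny

variable {R : Type*} [CommRing R]

/-- `φ : F → G` is a homomorphism of formal groups: `φ(0) = 0` and `φ(F(X, Y)) = G(φ(X), φ(Y))`. -/
structure IsHom (F G : FormalGroup R) (φ : PowerSeries R) : Prop where
  constantCoeff_eq_zero : PowerSeries.constantCoeff φ = 0
  map_add : PowerSeries.subst F.toPowerSeries φ =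
    MvPowerSeries.subst
      ![PowerSeries.subst (MvPowerSeries.X 0 : MvPowerSeries (Fin 2) R) φ,
        PowerSeries.subst (MvPowerSeries.X 1 : MvPowerSeries (Fin 2) R) φ]
      G.toPowerSeries

/-- `φ` has height `h`: `φ(T) ≡ ψ(T ^ (p ^ h))` modulo the maximal ideal for some power series `ψ`
whose coefficient of `T` is a unit. -/
def HasHeight [IsLocalRing R] (p h : ℕ) (φ : PowerSeries R) : Prop :=
  ∃ ψ : PowerSeries R, IsUnit (PowerSeries.coeff 1 ψ) ∧
    ∀ i, PowerSeries.coeff i φ -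
      PowerSeries.coeff i (PowerSeries.subst (PowerSeries.X ^ (p ^ h) : PowerSeries R) ψ)
        ∈ maximalIdeal R

/-- `φ : F → G` is an isogeny of height `h`. -/
structure IsIsogeny [IsLocalRing R] (p h : ℕ) (F G : FormalGroup R) (φ : PowerSeries R) :
    Prop where
  isHom : IsHom F G φ
  hasHeight : HasHeight p h φ

/-- The composite `φ_{i+1} ∘ φ_{i+2} ∘ ⋯ ∘ φ_{i+k}`. -/
def comp (φ : ℕ → PowerSeries R) (i : ℕ) : ℕ → PowerSeries R
  | 0 => PowerSeries.X
  | k + 1 => PowerSeries.subst (φ (i + k + 1)) (comp φ i k)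

/-- The kernel of `φ` on the points of the formal group `F` over `O`, the valuation ring of the
algebraic closure of `K`, is a cyclic group (a finite one, so that natural multiples of a generator
exhaust it), and all its elements are points over `R`. -/
structure HasRationalCyclicKernel (O : Type*) [CommRing O] [Algebra R O]
    (F : FormalGroup R) (φ : PowerSeries R) : Prop where
  rational : ∀ z ∈ kernel O φ, ∃ a : R, algebraMap R O a = z
  cyclic : ∃ x₀ ∈ kernel O φ, ∀ z ∈ kernel O φ, ∃ k : ℕ, HasMultiple F x₀ k z

/-- The factorization `φ = φ₁ ∘ ⋯ ∘ φₙ` of an isogeny `φ : F → G` of height `n` with cyclic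
kernel `F[φ]` into isogenies `φᵢ : Gᵢ → Gᵢ₋₁` of height `1`, where `Gₙ = F`, `G₀ = G` and
`Gᵢ = F / pⁱ F[φ]`, the quotient map `F → Gᵢ` being `φ_{i+1} ∘ ⋯ ∘ φₙ`. -/
structure IsFactorization [IsLocalRing R] (O : Type*) [CommRing O] [Algebra R O] (p n : ℕ)
    (F G : FormalGroup R) (φ : PowerSeries R)
    (Gs : ℕ → FormalGroup R) (φs : ℕ → PowerSeries R) : Prop where
  source : Gs n = F
  target : Gs 0 = G
  isComm : ∀ i ≤ n, (Gs i).IsComm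
  isIsogeny : ∀ i, 1 ≤ i → i ≤ n → IsIsogeny p 1 (Gs i) (Gs (i - 1)) (φs i)
  comp_eq : comp φs 0 n = φ
  kernel_comp : ∀ i ≤ n, kernel O (comp φs i (n - i)) = multiples F (p ^ i) (kernel O φ)

/-- The set of `y ∈ G(K)` whose class in `G(φ) = G(K) / φ F(K)` lies in `Gᵐ(φ)`, the image of
`Gᵐ(K) = 𝔪ᵐ`: those of the form `u + φ(z)` in `G(K)`, with `u ∈ 𝔪ᵐ` and `z ∈ F(K) = 𝔪`. -/
def cokernelFiltration [IsLocalRing R] (G : FormalGroup R) (φ : PowerSeries R) (m : ℕ) : Set R :=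
  {y | y ∈ maximalIdeal R ∧ ∃ u ∈ maximalIdeal R ^ m, ∃ z ∈ maximalIdeal R, ∃ w,
    HasValue φ z w ∧ HasFormalSum G u w y}

variable [IsDomain R] [IsDiscreteValuationRing R]

/-- `tᵢ`, the valuation of the coefficient of `T` in `φᵢ` (which is nonzero in characteristic zero),
for `1 ≤ i`. -/
def t (φ : ℕ → PowerSeries R) (i : ℕ) : ℕ :=
  (IsDiscreteValuationRing.addVal R (PowerSeries.coeff 1 (φ i))).toNat

/-- `cᵢ = t₁ + ⋯ + tᵢ + tᵢ / (p - 1)`, for `1 ≤ i`. -/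
def c (p : ℕ) (φ : ℕ → PowerSeries R) (i : ℕ) : ℝ :=
  ∑ j ∈ Finset.Icc 1 i, (t φ j : ℝ) + (t φ i : ℝ) / ((p : ℝ) - 1)

end Isogeny

/-! ### Ramification -/

section Ramification

variable (R K L : Type*) [CommRing R] [Field K] [Algebra R K] [Field L] [Algebra K L] [Algebra R L]
  [IsScalarTower R K L]

/-- `L / K` is totally ramified: in the integral closure of `R` in `L`, the maximal ideal of `R`
generates the power of a maximal ideal with exponent the degree `[L : K]`. -/
def IsTotallyRamified [IsLocalRing R] : Prop :=
  ∃ P : Ideal (integralClosure R L), P.IsMaximal ∧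
    (maximalIdeal R).map (algebraMap R (integralClosure R L)) = P ^ Module.finrank K L

instance smulCommClass_gal : SMulCommClass (L ≃ₐ[K] L) R L where
  smul_comm σ r x := by
    rw [← algebraMap_smul K r x, ← algebraMap_smul K r (σ • x)]
    exact map_smul σ _ _

/-- The ramification group `H_u` in the lower numbering, for real `u ≥ -1`: the `σ` with
`σ a - a ∈ 𝔪_L ^ (⌈u⌉ + 1)` for all `a` in the valuation ring of `L`. -/
def lowerRamificationGroup (u : ℝ) : Subgroup (L ≃ₐ[K] L) :=
  (Ring.jacobson (integralClosure R L) ^ (⌈u⌉ + 1).toNat).inertia (L ≃ₐ[K] L)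

/-- The Herbrand function `u ↦ ∫₀ᵘ dt / (H₀ : H_t)`, for `u ≥ -1`. -/
def herbrand (u : ℝ) : ℝ :=
  ∫ s in (0 : ℝ)..u, (((lowerRamificationGroup R K L s).relIndex
    (lowerRamificationGroup R K L 0) : ℕ) : ℝ)⁻¹

/-- The ramification group `H^v` in the upper numbering, for real `v ≥ -1`: it is `H_u`, where
`u ≥ -1` has Herbrand function equal to `v`. -/
def upperRamificationGroup (v : ℝ) : Subgroup (L ≃ₐ[K] L) :=
  lowerRamificationGroup R K L (Function.invFunOn (herbrand R K L) (Set.Ici (-1)) v)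

/-- The jumps of the filtration `(H^v)_{v ≥ -1}`. -/
def upperJumps : Set ℝ :=
  {v | -1 ≤ v ∧ ∀ ε > 0, upperRamificationGroup R K L v ≠ upperRamificationGroup R K L (v + ε)}

end Ramification

end FormalIsogeny

end

/-! Everything is read off from distances between points and kernels. The kernel of each `φ_{j+1}`
consists of the `p` rational points `[k] z`, so by Weierstrass preparation `φ_{j+1}(T)` is a unit
times the product of the `T - [k] z` (`IsIsogeny.exists_eq_prod`), where all nonzero `[k] z` have
the same valuation `S_j`. Hence `t_{j+1} = (p - 1) S_j`, so that `c₁ = p S₀` and `c_{j+2} - c_{j+1}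
= p S_{j+1} - S_j`. Moreover, over an extension of ramification index `e`, a point of valuation
below `e S_j` has its valuation multiplied by exactly `p`.

Modulo the image of `F(K)` the point `y` becomes some `u` of valuation exactly `m`; this translates
`x` by a rational point and does not change the field `L`. Since `m < p S₀` and `S_j < p S_{j+1}`
(`level_lt`), pulling `u` back through `φ₁, …, φₙ` divides the valuation by `p` each time
(`addVal_chain`), so `pⁿ v_L(x) = e m`. As `p ∤ m`, `pⁿ` divides `e`; as `x` is a root of a
polynomial of degree `pⁿ`, `[L : K] ≤ pⁿ`. So `L / K` is totally ramified of degree `pⁿ` and `v_L(x)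
= m` (`ramification_of_chain`).

The conjugates of `x` are its translates by the rational kernel, so `L / K` is Galois and `σ x = x +
[κ σ] x₀` for a generator `x₀`. If `pʲ` exactly divides `κ σ`, then `v_L(σ x - x) = v_L([pʲ] x₀) =
p^{j+1} S_j`. Because `m` is prime to `p`, a quotient of powers of `x` and of a uniformizer of `K`
is a uniformizer of `L`, which gives the lower jumps `l_j = p^{j+1} S_j - m`
(`exists_hasLowerJumps`). The Herbrand function fixes `l₀ = c₁ - m` and has slope `p^{-(j+1)}`
between `l_j` and `l_{j+1}`, so consecutive upper jumps differ by `p S_{j+1} - S_j = c_{j+2} -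
c_{j+1}` (`primitive_lowerJump`).

The existence of `x₀` with the required behaviour at every level of the chain is a separate matter,
settled in `IsFactorization.exists_isKernelGenerator`. -/

set_option linter.unusedSectionVars false

noncomputable section

namespace FormalIsogeny

/-! ### Evaluation of power series in complete local rings -/

section Eval

variable {R : Type*} [CommRing R] {A : Type*} [CommRing A] [IsLocalRing A] [Algebra R A]
  {σ τ : Type*}

/-- Evaluation of a multivariate power series at a point of a local ring with its adic topology. -/
def evalMv (a : σ → A) (f : MvPowerSeries σ R) : A :=
  letI : UniformSpace R := ⊥
  letI : WithIdeal A := ⟨maximalIdeal A⟩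
  MvPowerSeries.eval₂ (algebraMap R A) a f

lemma hasEval_of_mem [Finite σ] {a : σ → A} (ha : ∀ s, a s ∈ maximalIdeal A) :
    letI : WithIdeal A := ⟨maximalIdeal A⟩
    MvPowerSeries.HasEval a := by
  let : WithIdeal A := ⟨maximalIdeal A⟩
  refine ⟨fun s => ?_, by simp [Filter.cofinite_eq_bot]⟩
  have h := (maximalIdeal A).hasBasis_nhds_zero_adic
  refine h.tendsto_right_iff.2 fun k _ => ?_
  filter_upwards [eventually_ge_atTop k] with n hn
  exact Ideal.pow_le_pow_right hn (Ideal.pow_mem_pow (ha s) n)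

variable [IsAdicComplete (maximalIdeal A) A]

lemma completeSpace_adic :
    letI : WithIdeal A := ⟨maximalIdeal A⟩
    CompleteSpace A ∧ T2Space A := by
  let : WithIdeal A := ⟨maximalIdeal A⟩
  exact (IsAdic.isAdicComplete_iff (I := maximalIdeal A) rfl).1 inferInstance

/-- Evaluation at a tuple in the maximal ideal, as an algebra homomorphism. -/
def evalMvHom [Finite σ] (a : σ → A) (ha : ∀ s, a s ∈ maximalIdeal A) :
    MvPowerSeries σ R →ₐ[R] A :=
  letI : UniformSpace R := ⊥
  letI : WithIdeal A := ⟨maximalIdeal A⟩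
  haveI := (completeSpace_adic (A := A)).1
  haveI := (completeSpace_adic (A := A)).2
  haveI : ContinuousSMul R A := DiscreteTopology.instContinuousSMul R A
  MvPowerSeries.aeval (R := R) (hasEval_of_mem ha)

lemma coe_evalMvHom [Finite σ] (a : σ → A) (ha : ∀ s, a s ∈ maximalIdeal A) :
    ⇑(evalMvHom (R := R) a ha) = evalMv a := by
  let : UniformSpace R := ⊥
  let : WithIdeal A := ⟨maximalIdeal A⟩
  have := (completeSpace_adic (A := A)).1
  have := (completeSpace_adic (A := A)).2
  have : ContinuousSMul R A := DiscreteTopology.instContinuousSMul R A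
  exact MvPowerSeries.coe_aeval (R := R) (hasEval_of_mem ha)

lemma evalMv_X (a : σ → A) (s : σ) : evalMv a (MvPowerSeries.X s : MvPowerSeries σ R) = a s := by
  let : UniformSpace R := ⊥
  let : WithIdeal A := ⟨maximalIdeal A⟩
  exact MvPowerSeries.eval₂_X _ _ s

lemma evalMv_subst [Finite σ] [Finite τ] {a : τ → A} (ha : ∀ s, a s ∈ maximalIdeal A)
    {b : σ → MvPowerSeries τ R} (hb : MvPowerSeries.HasSubst b) (f : MvPowerSeries σ R) :
    evalMv a (MvPowerSeries.subst b f) = evalMv (fun s => evalMv a (b s)) f := by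
  let : UniformSpace R := ⊥
  let : WithIdeal A := ⟨maximalIdeal A⟩
  have := (completeSpace_adic (A := A)).1
  have := (completeSpace_adic (A := A)).2
  exact MvPowerSeries.eval₂_subst (S := R) (R := R) hb (hasEval_of_mem ha) f

/-- Trades the topological sum for congruences modulo powers of the maximal ideal, the form in which
values of series are estimated below. -/
lemma evalMv_approx [Finite σ] {a : σ → A} (ha : ∀ s, a s ∈ maximalIdeal A)
    (f : MvPowerSeries σ R) (k : ℕ) : ∃ s₀ : Finset (σ →₀ ℕ), ∀ s, s₀ ⊆ s →
      ∑ d ∈ s, algebraMap R A (MvPowerSeries.coeff d f) * d.prod (fun i e => a i ^ e)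
        - evalMv a f ∈ maximalIdeal A ^ k := by
  let : UniformSpace R := ⊥
  let : WithIdeal A := ⟨maximalIdeal A⟩
  have := (completeSpace_adic (A := A)).1
  have := (completeSpace_adic (A := A)).2
  have h := MvPowerSeries.hasSum_eval₂ (φ := algebraMap R A) continuous_of_discreteTopology
    (hasEval_of_mem ha) f
  have h' := ((maximalIdeal A).hasBasis_nhds_adic _).tendsto_right_iff.1 h k trivial
  obtain ⟨s₀, hs₀⟩ := h'.exists_forall_of_atTop
  refine ⟨s₀, fun s hs => ?_⟩
  obtain ⟨z, hz, hz'⟩ := hs₀ s hs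
  have : ∑ d ∈ s, algebraMap R A (MvPowerSeries.coeff d f) * d.prod (fun i e => a i ^ e)
    = evalMv a f + z := hz'.symm
  rw [this, add_sub_cancel_left]
  exact hz

lemma eq_of_forall_sub_mem {x y : A} (h : ∀ k, x - y ∈ maximalIdeal A ^ k) : x = y := by
  rw [← sub_eq_zero]
  refine IsHausdorff.haus (I := maximalIdeal A) inferInstance _ fun k => ?_
  simpa [SModEq.zero] using h k

/-- A finite partial sum that is good for both sides commutes with `θ`, and `θ` respects powers of
the maximal ideals, so the two values agree to every order. -/
lemma evalMv_comp_algHom [Finite σ] {B : Type*} [CommRing B] [IsLocalRing B] [Algebra R B]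
    [IsAdicComplete (maximalIdeal B) B] (θ : A →ₐ[R] B)
    (hθ : ∀ x ∈ maximalIdeal A, θ x ∈ maximalIdeal B)
    {a : σ → A} (ha : ∀ s, a s ∈ maximalIdeal A) (f : MvPowerSeries σ R) :
    θ (evalMv a f) = evalMv (fun s => θ (a s)) f := by
  refine eq_of_forall_sub_mem fun k => ?_
  obtain ⟨s₁, h₁⟩ := evalMv_approx ha f k
  obtain ⟨s₂, h₂⟩ := evalMv_approx (fun s => hθ _ (ha s)) f k
  classical
  have h₁' := h₁ (s₁ ∪ s₂) Finset.subset_union_left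
  have h₂' := h₂ (s₁ ∪ s₂) Finset.subset_union_right
  have hk : ∀ x ∈ maximalIdeal A ^ k, θ x ∈ maximalIdeal B ^ k := by
    intro x hx
    have : (maximalIdeal A ^ k).map θ ≤ maximalIdeal B ^ k := by
      rw [Ideal.map_pow]
      exact Ideal.pow_right_mono (Ideal.map_le_iff_le_comap.2 hθ) k
    exact this (Ideal.mem_map_of_mem _ hx)
  have h₃ := hk _ h₁'
  simp only [map_sub, map_sum, map_mul, AlgHom.commutes, Finsupp.prod, map_prod, map_pow] at h₃
  simp only [Finsupp.prod] at h₂'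
  have := sub_mem h₂' h₃
  rwa [sub_sub_sub_cancel_left] at this

/-- Evaluation of a univariate power series. -/
def ev (f : PowerSeries R) (a : A) : A := evalMv (fun _ : Unit => a) f

/-- Evaluation of univariate power series as an algebra homomorphism. -/
def evHom (a : A) (ha : a ∈ maximalIdeal A) : PowerSeries R →ₐ[R] A :=
  evalMvHom (fun _ : Unit => a) fun _ => ha

lemma evHom_apply (a : A) (ha : a ∈ maximalIdeal A) (f : PowerSeries R) :
    evHom a ha f = ev f a := congrFun (coe_evalMvHom (R := R) (fun _ : Unit => a) fun _ => ha) f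

lemma ev_X (a : A) : ev (PowerSeries.X : PowerSeries R) a = a := evalMv_X _ _

section

variable {a : A} (ha : a ∈ maximalIdeal A)
include ha

lemma ev_add (f g : PowerSeries R) : ev (f + g) a = ev f a + ev g a := by
  simp only [← evHom_apply a ha, map_add]

lemma ev_sub (f g : PowerSeries R) : ev (f - g) a = ev f a - ev g a := by
  simp only [← evHom_apply a ha, map_sub]

lemma ev_mul (f g : PowerSeries R) : ev (f * g) a = ev f a * ev g a := by
  simp only [← evHom_apply a ha, map_mul]

lemma ev_pow (f : PowerSeries R) (n : ℕ) : ev (f ^ n) a = ev f a ^ n := by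
  simp only [← evHom_apply a ha, map_pow]

lemma ev_C (r : R) : ev (PowerSeries.C r) a = algebraMap R A r := by
  rw [← evHom_apply a ha, ← PowerSeries.algebraMap_eq, AlgHom.commutes]

lemma ev_coe (f : Polynomial R) : ev (f : PowerSeries R) a = Polynomial.aeval a f := by
  have h : (evHom (R := R) a ha).comp (Polynomial.coeToPowerSeries.algHom R) =
      Polynomial.aeval a := by
    ext
    simp [evHom_apply a ha, ev_X]
  have := congrArg (fun g => g f) h
  simpa [evHom_apply a ha] using this

lemma ev_subst {g : PowerSeries R} (hg : PowerSeries.constantCoeff g = 0) (f : PowerSeries R) :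
    ev (PowerSeries.subst g f) a = ev f (ev g a) :=
  evalMv_subst (fun _ => ha) (PowerSeries.HasSubst.of_constantCoeff_zero' hg).const f

lemma isUnit_ev {f : PowerSeries R} (hf : IsUnit f) : IsUnit (ev f a) := by
  rw [← evHom_apply a ha]
  exact hf.map _

lemma ev_eq_add_mul (f : PowerSeries R) :
    ∃ b, ev f a = algebraMap R A (PowerSeries.constantCoeff f) + a * b := by
  obtain ⟨g, hg⟩ : PowerSeries.X ∣ f - PowerSeries.C (PowerSeries.constantCoeff f) := by
    rw [PowerSeries.X_dvd_iff]; simp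
  refine ⟨ev g a, ?_⟩
  have h := congrArg (fun q => ev q a) (sub_eq_iff_eq_add'.1 hg)
  simpa only [ev_add ha, ev_C ha, ev_mul ha, ev_X] using h

lemma ev_mem {f : PowerSeries R} (hf : PowerSeries.constantCoeff f = 0) :
    ev f a ∈ maximalIdeal A := by
  obtain ⟨b, hb⟩ := ev_eq_add_mul ha f
  rw [hb, hf, map_zero, zero_add]
  exact Ideal.mul_mem_right _ _ ha

lemma ev_approx (f : PowerSeries R) (k : ℕ) : ∃ N₀, ∀ N ≥ N₀,
    ∑ i ∈ Finset.range N, algebraMap R A (PowerSeries.coeff i f) * a ^ i - ev f a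
      ∈ maximalIdeal A ^ k := by
  obtain ⟨s₀, hs₀⟩ := evalMv_approx (a := fun _ : Unit => a) (fun _ => ha) f k
  refine ⟨s₀.sup (fun d => d ()) + 1, fun N hN => ?_⟩
  have h := hs₀ ((Finset.range N).map ⟨fun i => Finsupp.single () i,
    Finsupp.single_injective ()⟩) fun d hd => by
      rw [Finset.mem_map]
      refine ⟨d (), ?_, ?_⟩
      · have := Finset.le_sup (f := fun d : Unit →₀ ℕ => d ()) hd
        simp only [Finset.mem_range] at *
        omega
      · ext
        exact Finsupp.single_eq_same
  rw [Finset.sum_map] at h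
  have h' : ∀ i, (Finsupp.single () i).prod (fun (_ : Unit) e => a ^ e) = a ^ i := fun i => by
    simp
  simp only [Function.Embedding.coeFn_mk, h'] at h
  exact h

end

lemma ev_comp_algHom {B : Type*} [CommRing B] [IsLocalRing B] [Algebra R B]
    [IsAdicComplete (maximalIdeal B) B] (θ : A →ₐ[R] B)
    (hθ : ∀ x ∈ maximalIdeal A, θ x ∈ maximalIdeal B)
    {a : A} (ha : a ∈ maximalIdeal A) (f : PowerSeries R) :
    θ (ev f a) = ev f (θ a) :=
  evalMv_comp_algHom θ hθ (fun _ => ha) f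

/-- The sum `F(x, y)` of points of a formal group. -/
def fadd (F : FormalGroup R) (x y : A) : A := evalMv ![x, y] F.toPowerSeries

lemma cons_mem {x y : A} (hx : x ∈ maximalIdeal A) (hy : y ∈ maximalIdeal A) :
    ∀ s, (![x, y] : Fin 2 → A) s ∈ maximalIdeal A := by
  intro s; fin_cases s <;> simpa

/-- A large enough square of exponents contains any finite set of monomials; square truncations are
those appearing in `HasFormalSum`. -/
lemma fadd_approx (F : FormalGroup R) {x y : A} (hx : x ∈ maximalIdeal A)
    (hy : y ∈ maximalIdeal A) (k : ℕ) : ∃ N₀, ∀ N ≥ N₀,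
    ∑ i ∈ Finset.range N, ∑ j ∈ Finset.range N,
    algebraMap R A (MvPowerSeries.coeff (Finsupp.single 0 i + Finsupp.single 1 j) F.toPowerSeries)
      * x ^ i * y ^ j - fadd F x y ∈ maximalIdeal A ^ k := by
  obtain ⟨s₀, hs₀⟩ := evalMv_approx (cons_mem hx hy) F.toPowerSeries k
  have hinj : Function.Injective fun q : ℕ × ℕ =>
      (Finsupp.single (0 : Fin 2) q.1 + Finsupp.single 1 q.2 : Fin 2 →₀ ℕ) := by
    intro q q' h
    have h0 := DFunLike.congr_fun h 0
    have h1 := DFunLike.congr_fun h 1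
    simp at h0 h1
    exact Prod.ext h0 h1
  obtain ⟨M, hM⟩ : ∃ M, ∀ d ∈ s₀, d 0 ≤ M := ⟨_, fun d hd => Finset.le_sup (f := fun d => d 0) hd⟩
  obtain ⟨M', hM'⟩ : ∃ M, ∀ d ∈ s₀, d 1 ≤ M := ⟨_, fun d hd => Finset.le_sup (f := fun d => d 1) hd⟩
  refine ⟨M + M' + 1, fun N hN => ?_⟩
  have h := hs₀ ((Finset.range N ×ˢ Finset.range N).map ⟨_, hinj⟩) fun d hd => by
      rw [Finset.mem_map]
      refine ⟨(d 0, d 1), ?_, ?_⟩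
      · have h0 := hM d hd
        have h1 := hM' d hd
        simp only [Finset.mem_product, Finset.mem_range]
        exact ⟨by omega, by omega⟩
      · ext i; fin_cases i <;> simp
  rw [Finset.sum_map, Finset.sum_product] at h
  have h' : ∀ i j, (Finsupp.single (0 : Fin 2) i + Finsupp.single 1 j).prod
      (fun s e => (![x, y] : Fin 2 → A) s ^ e) = x ^ i * y ^ j := fun i j => by
    rw [Finsupp.prod_fintype _ _ (by simp)]
    simp
  simp only [Function.Embedding.coeFn_mk, h', ← mul_assoc] at h
  exact h

lemma fadd_comp_algHom {B : Type*} [CommRing B] [IsLocalRing B] [Algebra R B]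
    [IsAdicComplete (maximalIdeal B) B] (θ : A →ₐ[R] B)
    (hθ : ∀ x ∈ maximalIdeal A, θ x ∈ maximalIdeal B) (F : FormalGroup R)
    {x y : A} (hx : x ∈ maximalIdeal A) (hy : y ∈ maximalIdeal A) :
    θ (fadd F x y) = fadd F (θ x) (θ y) := by
  unfold fadd
  rw [evalMv_comp_algHom θ hθ (cons_mem hx hy)]
  congr 1
  ext s; fin_cases s <;> rfl

lemma evalMv_mem {σ : Type*} [Finite σ] {a : σ → A} (ha : ∀ s, a s ∈ maximalIdeal A)
    {f : MvPowerSeries σ R} (hf : MvPowerSeries.constantCoeff f = 0) :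
    evalMv a f ∈ maximalIdeal A := by
  obtain ⟨s, hs⟩ := evalMv_approx ha f 1
  rw [pow_one] at hs
  have h₂ : ∑ d ∈ s, algebraMap R A (MvPowerSeries.coeff d f) * d.prod (fun i e => a i ^ e)
      ∈ maximalIdeal A := Ideal.sum_mem _ fun d _ => by
    rcases eq_or_ne d 0 with rfl | hd
    · simp [hf]
    · obtain ⟨i, hi⟩ := Finsupp.ne_iff.1 hd
      refine Ideal.mul_mem_left _ _ (Ideal.mem_of_dvd _ (Finset.dvd_prod_of_mem _
        (Finsupp.mem_support_iff.2 hi)) (Ideal.pow_mem_of_mem _ (ha i) _ (Nat.pos_of_ne_zero hi)))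
  simpa using sub_mem h₂ (hs s subset_rfl)

lemma fadd_mem (F : FormalGroup R) {x y : A} (hx : x ∈ maximalIdeal A) (hy : y ∈ maximalIdeal A) :
    fadd F x y ∈ maximalIdeal A :=
  evalMv_mem (cons_mem hx hy) F.zero_constantCoeff

lemma hasSubst_cons {τ : Type*} {f g : MvPowerSeries τ R}
    (hf : MvPowerSeries.constantCoeff f = 0) (hg : MvPowerSeries.constantCoeff g = 0) :
    MvPowerSeries.HasSubst ![f, g] :=
  MvPowerSeries.hasSubst_of_constantCoeff_zero fun s => by fin_cases s <;> simpa

lemma evalMv_subst_fadd (F : FormalGroup R) [Finite τ] {a : τ → A}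
    (ha : ∀ s, a s ∈ maximalIdeal A) {f g : MvPowerSeries τ R}
    (hf : MvPowerSeries.constantCoeff f = 0) (hg : MvPowerSeries.constantCoeff g = 0) :
    evalMv a (MvPowerSeries.subst ![f, g] F.toPowerSeries) =
      fadd F (evalMv a f) (evalMv a g) := by
  rw [evalMv_subst ha (hasSubst_cons hf hg), fadd]
  congr 1
  ext s; fin_cases s <;> rfl

lemma constantCoeff_subst_fadd (F : FormalGroup R) {f g : MvPowerSeries τ R}
    (hf : MvPowerSeries.constantCoeff f = 0) (hg : MvPowerSeries.constantCoeff g = 0) :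
    MvPowerSeries.constantCoeff (MvPowerSeries.subst ![f, g] F.toPowerSeries) = 0 :=
  MvPowerSeries.constantCoeff_subst_eq_zero (hasSubst_cons hf hg)
    (fun s => by fin_cases s <;> simpa) F.zero_constantCoeff

lemma fadd_assoc (F : FormalGroup R) {x y z : A} (hx : x ∈ maximalIdeal A)
    (hy : y ∈ maximalIdeal A) (hz : z ∈ maximalIdeal A) :
    fadd F (fadd F x y) z = fadd F x (fadd F y z) := by
  have ha : ∀ s, (![x, y, z] : Fin 3 → A) s ∈ maximalIdeal A := by
    intro s; fin_cases s <;> simpa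
  have h := congrArg (evalMv ![x, y, z]) F.assoc
  have hX : ∀ i : Fin 3, MvPowerSeries.constantCoeff (MvPowerSeries.X i : MvPowerSeries (Fin 3) R)
    = 0 := fun i => MvPowerSeries.constantCoeff_X i
  rw [evalMv_subst_fadd F ha (constantCoeff_subst_fadd F (hX _) (hX _)) (hX _),
    evalMv_subst_fadd F ha (hX _) (hX _),
    evalMv_subst_fadd F ha (hX _) (constantCoeff_subst_fadd F (hX _) (hX _)),
    evalMv_subst_fadd F ha (hX _) (hX _)] at h
  simpa [evalMv_X] using h

lemma fadd_zero (F : FormalGroup R) {x : A} (hx : x ∈ maximalIdeal A) : fadd F x 0 = x := by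
  have h := congrArg (evalMv fun _ : Unit => x) F.Xzero_eq_X
  have h0 : evalMv (fun _ : Unit => x) (0 : MvPowerSeries Unit R) = 0 := by
    rw [← coe_evalMvHom _ (fun _ => hx), map_zero]
  rw [FormalGroup.Xzero, PowerSeries.X, evalMv_subst_fadd F (fun _ => hx) (MvPowerSeries.constantCoeff_X _)
    (map_zero _), h0] at h
  simpa [evalMv_X] using h

lemma IsHom.ev_fadd {F G : FormalGroup R} {φ : PowerSeries R} (hφ : IsHom F G φ) {x y : A}
    (hx : x ∈ maximalIdeal A) (hy : y ∈ maximalIdeal A) :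
    ev φ (fadd F x y) = fadd G (ev φ x) (ev φ y) := by
  have h := congrArg (evalMv ![x, y]) hφ.map_add
  have hX : ∀ i : Fin 2, MvPowerSeries.constantCoeff (MvPowerSeries.X i : MvPowerSeries (Fin 2) R)
    = 0 := fun i => MvPowerSeries.constantCoeff_X i
  have hs : ∀ i : Fin 2, PowerSeries.HasSubst (MvPowerSeries.X i : MvPowerSeries (Fin 2) R) :=
    fun i => PowerSeries.HasSubst.of_constantCoeff_zero (hX i)
  have hc : ∀ i : Fin 2, MvPowerSeries.constantCoeff
      (PowerSeries.subst (MvPowerSeries.X i : MvPowerSeries (Fin 2) R) φ) = 0 := fun i =>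
    PowerSeries.constantCoeff_subst_eq_zero (hX i) _ hφ.constantCoeff_eq_zero
  have he : ∀ i : Fin 2, evalMv ![x, y]
      (PowerSeries.subst (MvPowerSeries.X i : MvPowerSeries (Fin 2) R) φ) = ev φ (![x, y] i) := by
    intro i
    rw [PowerSeries.subst, evalMv_subst (cons_mem hx hy) (hs i).const, ev]
    simp [evalMv_X]
  rw [evalMv_subst_fadd G (cons_mem hx hy) (hc 0) (hc 1), he, he, PowerSeries.subst,
    evalMv_subst (cons_mem hx hy)
      (PowerSeries.HasSubst.of_constantCoeff_zero F.zero_constantCoeff).const] at h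
  exact h

end Eval

/-! ### Points of formal groups -/

section Points

variable {R : Type*} [CommRing R] {A : Type*} [CommRing A] [IsDomain A]
  [IsDiscreteValuationRing A] [Algebra R A] [IsAdicComplete (maximalIdeal A) A]

open IsDiscreteValuationRing hiding maximalIdeal

lemma exists_pow_le_span {c : A} (hc : c ≠ 0) : ∃ N, maximalIdeal A ^ N ≤ Ideal.span {c} := by
  obtain ⟨ϖ, hϖ⟩ := exists_irreducible A
  obtain ⟨n, hn⟩ := associated_pow_irreducible hc hϖ
  refine ⟨n, ?_⟩
  rw [hϖ.maximalIdeal_eq, Ideal.span_singleton_pow, Ideal.span_singleton_le_span_singleton]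
  exact hn.dvd

/-- Homogeneity: `c` factors out to the power `i + j ≥ 2`; one factor pairs with the difference to
give `y - y'`, another remains. This bounds the terms of degree at least two of a formal group law.
-/
lemma pow_mul_pow_sub_pow_dvd {c x y y' : A} (hx : c ∣ x) (hy : c ∣ y) (hy' : c ∣ y') {i j : ℕ}
    (hij : 2 ≤ i + j) : (y - y') * c ∣ x ^ i * (y ^ j - y' ^ j) := by
  obtain ⟨X, rfl⟩ := hx
  obtain ⟨Y, rfl⟩ := hy
  obtain ⟨Y', rfl⟩ := hy'
  rcases Nat.eq_zero_or_pos j with rfl | hj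
  · simp
  obtain ⟨w, hw⟩ := sub_dvd_pow_sub_pow Y Y' j
  obtain ⟨k, hk⟩ := Nat.exists_eq_add_of_le hij
  have : (c * X) ^ i * ((c * Y) ^ j - (c * Y') ^ j) = c ^ (i + j) * (X ^ i * (Y ^ j - Y' ^ j)) := by
    rw [mul_pow, mul_pow, mul_pow, pow_add]; ring
  rw [this, hw, hk]
  exact ⟨c ^ k * X ^ i * w, by ring⟩

/-- A formal group law is, in its second variable, a translation up to higher order terms. -/
lemma fadd_sub_fadd (F : FormalGroup R) {c x y y' : A} (hc : c ∈ maximalIdeal A)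
    (hx : c ∣ x) (hy : c ∣ y) (hy' : c ∣ y') :
    ∃ b, fadd F x y - fadd F x y' = (y - y') * (1 + c * b) := by
  rcases eq_or_ne y y' with rfl | hne
  · exact ⟨0, by simp⟩
  have hc0 : c ≠ 0 := by
    rintro rfl
    rw [zero_dvd_iff] at hy hy'
    exact hne (hy.trans hy'.symm)
  have hxm := Ideal.mem_of_dvd _ hx hc
  have hym := Ideal.mem_of_dvd _ hy hc
  have hym' := Ideal.mem_of_dvd _ hy' hc
  -- Precision high enough for truncation errors to be multiples of `(y - y') c`.
  obtain ⟨N, hN⟩ := exists_pow_le_span (mul_ne_zero (sub_ne_zero.2 hne) hc0)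
  obtain ⟨s₁, h₁⟩ := evalMv_approx (cons_mem hxm hym) F.toPowerSeries N
  obtain ⟨s₂, h₂⟩ := evalMv_approx (cons_mem hxm hym') F.toPowerSeries N
  classical
  -- The exponent of the monomial `Y`, the only one of degree at most one that contributes to the
  -- difference; it is forced into the finite sum.
  set e : Fin 2 →₀ ℕ := Finsupp.single 1 1
  have h₁' := hN (h₁ (insert e (s₁ ∪ s₂))
    (Finset.subset_union_left.trans (Finset.subset_insert _ _)))
  have h₂' := hN (h₂ (insert e (s₁ ∪ s₂))
    (Finset.subset_union_right.trans (Finset.subset_insert _ _)))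
  have hp : ∀ (z : A) (d : Fin 2 →₀ ℕ), d.prod (fun i e => (![x, z] : Fin 2 → A) i ^ e) =
      x ^ d 0 * z ^ d 1 := fun z d => by
    rw [Finsupp.prod_fintype _ _ (by simp)]; simp
  simp only [hp] at h₁' h₂'
  have h₃ := sub_mem h₁' h₂'
  rw [sub_sub_sub_comm, ← Finset.sum_sub_distrib] at h₃
  simp only [← mul_sub (algebraMap R A _)] at h₃
  rw [← Finset.add_sum_erase _ _ (Finset.mem_insert_self e _)] at h₃
  have h₄ : ∑ d ∈ (insert e (s₁ ∪ s₂)).erase e, algebraMap R A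
      (MvPowerSeries.coeff d F.toPowerSeries) * (x ^ d 0 * y ^ d 1 - x ^ d 0 * y' ^ d 1) ∈
      Ideal.span {(y - y') * c} := by
    refine Ideal.sum_mem _ fun d hd => Ideal.mul_mem_left _ _ ?_
    rw [Ideal.mem_span_singleton, ← mul_sub]
    rcases Nat.lt_or_ge (d 0 + d 1) 2 with hlt | hge
    · rcases Nat.eq_zero_or_pos (d 1) with h | h
      · simp [h]
      · refine absurd ?_ (Finset.ne_of_mem_erase hd)
        ext i
        fin_cases i
        · simp [e]; omega
        · simp [e]; omega
    · exact pow_mul_pow_sub_pow_dvd hx hy hy' hge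
  have he : algebraMap R A (MvPowerSeries.coeff e F.toPowerSeries) *
      (x ^ e 0 * y ^ e 1 - x ^ e 0 * y' ^ e 1) = y - y' := by
    rw [F.lin_coeff_Y]; simp [e]
  rw [he, add_sub_right_comm] at h₃
  have h₅ := (Ideal.add_mem_iff_left _ h₄).1 h₃
  obtain ⟨b, hb⟩ := Ideal.mem_span_singleton.1 h₅
  refine ⟨-b, ?_⟩
  change y - y' - (fadd F x y - fadd F x y') = _ at hb
  linear_combination -hb

/-- The iteration `y ↦ y - F(x, y)` converges: since `F(x, ·)` is a translation up to a factor `1 +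
ϖ b`, each step multiplies the residual `F(x, y)` by a multiple of `ϖ`. -/
lemma exists_fadd_eq_zero (F : FormalGroup R) {x : A} (hx : x ∈ maximalIdeal A) :
    ∃ y ∈ maximalIdeal A, fadd F x y = 0 := by
  let S : ℕ → A := fun n => Nat.rec 0 (fun _ y => y - fadd F x y) n
  have hS : ∀ n, S (n + 1) = S n - fadd F x (S n) := fun n => rfl
  obtain ⟨ϖ, hϖ⟩ := exists_irreducible A
  have hm := hϖ.maximalIdeal_eq
  have hϖm : ϖ ∈ maximalIdeal A := by rw [hm]; exact Ideal.mem_span_singleton_self _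
  have hd : ∀ z ∈ maximalIdeal A, ϖ ∣ z := fun z hz => by
    rwa [hm, Ideal.mem_span_singleton] at hz
  have key : ∀ n, S n ∈ maximalIdeal A ∧ fadd F x (S n) ∈ maximalIdeal A ^ (n + 1) := by
    intro n
    induction n with
    | zero =>
      refine ⟨zero_mem _, ?_⟩
      change fadd F x 0 ∈ _
      rw [fadd_zero F hx]
      simpa using hx
    | succ n ih =>
      obtain ⟨h₁, h₂⟩ := ih
      have hf : fadd F x (S n) ∈ maximalIdeal A := Ideal.pow_le_self (Nat.succ_ne_zero n) h₂
      have h₃ : S (n + 1) ∈ maximalIdeal A := by rw [hS]; exact sub_mem h₁ hf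
      refine ⟨h₃, ?_⟩
      obtain ⟨b, hb⟩ := fadd_sub_fadd F hϖm (hd _ hx) (hd _ h₃) (hd _ h₁)
      have : fadd F x (S (n + 1)) = fadd F x (S n) * (-(ϖ * b)) := by
        rw [sub_eq_iff_eq_add.1 hb, hS]; ring
      rw [this, pow_succ]
      exact Ideal.mul_mem_mul h₂ (neg_mem (Ideal.mul_mem_right _ _ hϖm))
  obtain ⟨y, hy⟩ := IsPrecomplete.prec (I := maximalIdeal A) (M := A) inferInstance (f := S) (by
    intro a b hab
    induction b, hab using Nat.le_induction with
    | base => exact SModEq.refl _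
    | succ b hab ih =>
      refine ih.trans ?_
      rw [SModEq.sub_mem, hS, sub_sub_cancel]
      simpa using Ideal.pow_le_pow_right (by omega) (key b).2)
  have hy' : ∀ n, S n - y ∈ maximalIdeal A ^ n := fun n => by
    simpa [SModEq.sub_mem] using hy n
  have hym : y ∈ maximalIdeal A := by
    have := sub_mem (key 1).1 (by simpa using hy' 1 : S 1 - y ∈ maximalIdeal A)
    simpa using this
  refine ⟨y, hym, eq_of_forall_sub_mem fun n => ?_⟩
  obtain ⟨b, hb⟩ := fadd_sub_fadd F hϖm (hd _ hx) (hd _ (key n).1) (hd _ hym)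
  have h₁ : fadd F x (S n) - fadd F x y ∈ maximalIdeal A ^ n := by
    rw [hb]; exact Ideal.mul_mem_right _ _ (hy' n)
  have h₂ : fadd F x (S n) ∈ maximalIdeal A ^ n := Ideal.pow_le_pow_right (by omega) (key n).2
  simpa using sub_mem h₂ h₁

variable (A) in
/-- The group of points of a formal group with values in the maximal ideal of `A`. -/
@[ext]
structure Points (F : FormalGroup R) where
  val : A
  mem : val ∈ maximalIdeal A

variable {F G : FormalGroup R}

namespace Points

instance : Add (Points A F) := ⟨fun x y => ⟨fadd F x.1 y.1, fadd_mem F x.2 y.2⟩⟩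
instance : Zero (Points A F) := ⟨⟨0, zero_mem _⟩⟩
instance : Neg (Points A F) := ⟨fun x =>
  ⟨(exists_fadd_eq_zero F x.2).choose, (exists_fadd_eq_zero F x.2).choose_spec.1⟩⟩

instance : AddGroup (Points A F) :=
  AddGroup.ofRightAxioms (fun x y z => Points.ext (fadd_assoc F x.2 y.2 z.2))
    (fun x => Points.ext (fadd_zero F x.2))
    (fun x => Points.ext (exists_fadd_eq_zero F x.2).choose_spec.2)

lemma val_add (x y : Points A F) : (x + y).1 = fadd F x.1 y.1 := rfl
@[simp] lemma val_zero : (0 : Points A F).1 = 0 := rfl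
lemma val_eq_zero {x : Points A F} : x.1 = 0 ↔ x = 0 := ⟨fun h => Points.ext h, fun h => by rw [h]; rfl⟩

/-- `F(x, ·)` is an isometry with `F(x, 0) = x`. Thus the distance between two points is the
valuation of their difference in the group. -/
lemma val_add_sub (x d : Points A F) : ∃ u, IsUnit u ∧ (x + d).1 - x.1 = d.1 * u := by
  obtain ⟨ϖ, hϖ⟩ := exists_irreducible A
  have hm := hϖ.maximalIdeal_eq
  have hϖm : ϖ ∈ maximalIdeal A := by rw [hm]; exact Ideal.mem_span_singleton_self _
  have hd : ∀ z ∈ maximalIdeal A, ϖ ∣ z := fun z hz => by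
    rwa [hm, Ideal.mem_span_singleton] at hz
  obtain ⟨b, hb⟩ := fadd_sub_fadd F hϖm (hd _ x.2) (hd _ d.2) (dvd_zero ϖ)
  refine ⟨1 + ϖ * b, ?_, ?_⟩
  · by_contra h
    have h1 := (mem_maximalIdeal _).2 h
    have h2 : ϖ * b ∈ maximalIdeal A := Ideal.mul_mem_right _ _ hϖm
    have h3 := sub_mem h1 h2
    rw [add_sub_cancel_right] at h3
    exact (Ideal.ne_top_iff_one _).1 (maximalIdeal.isMaximal A).ne_top h3
  · rw [val_add]
    rwa [fadd_zero F x.2, sub_zero] at hb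

lemma addVal_val_add_sub (x d : Points A F) :
    addVal A ((x + d).1 - x.1) = addVal A d.1 := by
  obtain ⟨u, hu, h⟩ := val_add_sub x d
  rw [h, addVal_mul, addVal_eq_zero_iff.2 hu, add_zero]

/-- The expansion `[k] x = k x + O(x²)`: multiplication by an integer prime to `p` preserves
valuations and multiplication by `p` raises them. -/
lemma val_nsmul (x : Points A F) (k : ℕ) : ∃ b, (k • x).1 = x.1 * (k + x.1 * b) := by
  induction k with
  | zero => exact ⟨0, by simp⟩
  | succ k ih =>
    obtain ⟨b, hb⟩ := ih
    obtain ⟨b', hb'⟩ := fadd_sub_fadd F x.2 dvd_rfl ⟨_, hb⟩ (dvd_zero x.1)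
    rw [fadd_zero F x.2, sub_zero, ← val_add, ← succ_nsmul'] at hb'
    refine ⟨b + b' * (k + x.1 * b), ?_⟩
    rw [sub_eq_iff_eq_add.1 hb', hb]
    push_cast
    ring

lemma addVal_nsmul_of_isUnit (x : Points A F) {k : ℕ} (hk : IsUnit (k : A)) :
    addVal A (k • x).1 = addVal A x.1 := by
  obtain ⟨b, hb⟩ := val_nsmul x k
  have hu : IsUnit ((k : A) + x.1 * b) := by
    by_contra h
    have h1 := (mem_maximalIdeal _).2 h
    have h3 := sub_mem h1 (Ideal.mul_mem_right b _ x.2)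
    rw [add_sub_cancel_right] at h3
    exact (mem_maximalIdeal _).1 h3 hk
  rw [hb, addVal_mul, addVal_eq_zero_iff.2 hu, add_zero]

lemma addVal_lt_addVal_nsmul {x : Points A F} (hx : x ≠ 0) {k : ℕ}
    (hk : (k : A) ∈ maximalIdeal A) : addVal A x.1 < addVal A (k • x).1 := by
  obtain ⟨b, hb⟩ := val_nsmul x k
  have h0 : addVal A x.1 ≠ ⊤ := by
    rw [Ne, addVal_eq_top_iff, val_eq_zero]; exact hx
  have h1 : addVal A ((k : A) + x.1 * b) ≠ 0 := by
    rw [Ne, addVal_eq_zero_iff]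
    exact (mem_maximalIdeal _).1 (add_mem hk (Ideal.mul_mem_right _ _ x.2))
  rw [hb, addVal_mul]
  generalize addVal A x.1 = a at h0
  generalize addVal A ((k : A) + x.1 * b) = c at h1
  lift a to ℕ using h0
  induction c with
  | top => simp
  | coe c =>
    norm_cast at h1 ⊢
    omega

omit [IsAdicComplete (maximalIdeal A) A] in
lemma isUnit_natCast_of_coprime {p k : ℕ} (hp : (p : A) ∈ maximalIdeal A) (h : p.Coprime k) :
    IsUnit (k : A) := by
  have := (Nat.isCoprime_iff_coprime.2 h).map (Int.castRingHom A)
  obtain ⟨a, b, hab⟩ := this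
  by_contra hk
  have hk' := (mem_maximalIdeal _).2 hk
  have h1 := add_mem (Ideal.mul_mem_left _ a hp) (Ideal.mul_mem_left _ b hk')
  simp only [eq_intCast, Int.cast_natCast] at hab
  rw [hab] at h1
  exact (Ideal.ne_top_iff_one _).1 (maximalIdeal.isMaximal A).ne_top h1

end Points

/-- The homomorphism on points induced by a homomorphism of formal groups. -/
def IsHom.onPoints {φ : PowerSeries R} (hφ : IsHom F G φ) : Points A F →+ Points A G :=
  AddMonoidHom.mk' (fun x => ⟨ev φ x.1, ev_mem x.2 hφ.constantCoeff_eq_zero⟩)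
    fun x y => Points.ext (hφ.ev_fadd x.2 y.2)

lemma IsHom.onPoints_val {φ : PowerSeries R} (hφ : IsHom F G φ) (x : Points A F) :
    (hφ.onPoints x).1 = ev φ x.1 := rfl

/-- The homomorphism on points induced by a homomorphism of coefficient rings. -/
def Points.map {B : Type*} [CommRing B] [IsDomain B]
    [IsDiscreteValuationRing B] [Algebra R B] [IsAdicComplete (maximalIdeal B) B]
    (θ : A →ₐ[R] B) (hθ : ∀ x ∈ maximalIdeal A, θ x ∈ maximalIdeal B) :
    Points A F →+ Points B F :=
  AddMonoidHom.mk' (fun x => ⟨θ x.1, hθ _ x.2⟩)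
    fun x y => Points.ext (fadd_comp_algHom θ hθ F x.2 y.2)

lemma Points.map_val {B : Type*} [CommRing B] [IsDomain B]
    [IsDiscreteValuationRing B] [Algebra R B] [IsAdicComplete (maximalIdeal B) B]
    (θ : A →ₐ[R] B) (hθ : ∀ x ∈ maximalIdeal A, θ x ∈ maximalIdeal B) (x : Points A F) :
    (Points.map θ hθ x).1 = θ x.1 := rfl

end Points

/-! ### Weierstrass factorization of isogenies -/

section Weierstrass

open Polynomial in
lemma exists_weierstrass {R : Type*} [CommRing R] [IsLocalRing R]
    [IsAdicComplete (maximalIdeal R) R] {g : PowerSeries R} {d : ℕ}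
    (hd : PowerSeries.coeff d g ∉ maximalIdeal R)
    (hlt : ∀ i < d, PowerSeries.coeff i g ∈ maximalIdeal R) :
    ∃ (f : R[X]) (h : PowerSeries R), f.Monic ∧ f.natDegree = d ∧
      (∀ i < d, f.coeff i ∈ maximalIdeal R) ∧ IsUnit h ∧ g = f * h := by
  have hord : (g.map (residue R)).order = d := by
    rw [PowerSeries.order_eq_nat]
    refine ⟨?_, fun i hi => ?_⟩
    · rw [PowerSeries.coeff_map, Ne, residue_eq_zero_iff]; exact hd
    · rw [PowerSeries.coeff_map, residue_eq_zero_iff]; exact hlt i hi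
  have hne : g.map (residue R) ≠ 0 := fun h => by
    rw [h, PowerSeries.order_zero] at hord; exact absurd hord (by simp)
  obtain ⟨f, h, H⟩ := PowerSeries.exists_isWeierstrassFactorization hne
  have hdeg : f.natDegree = d := by rw [H.natDegree_eq_toNat_order_map, hord]; rfl
  exact ⟨f, h, H.isDistinguishedAt.monic, hdeg,
    fun i hi => H.isDistinguishedAt.mem (hdeg ▸ hi), H.isUnit, H.eq_mul⟩

end Weierstrass

/-! ### Series of finite height and their rational zeros -/

section Height

variable {R : Type*} [CommRing R]

lemma HasHeight.coeff_mem [IsLocalRing R] {p h : ℕ} (hp : p.Prime) {φ : PowerSeries R}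
    (hφ : HasHeight p h φ)
    (h0 : PowerSeries.constantCoeff φ = 0) : PowerSeries.coeff (p ^ h) φ ∉ maximalIdeal R ∧
    ∀ i < p ^ h, PowerSeries.coeff i φ ∈ maximalIdeal R := by
  obtain ⟨ψ, hψ, hc⟩ := hφ
  have hp0 : p ^ h ≠ 0 := pow_ne_zero _ hp.ne_zero
  simp only [PowerSeries.coeff_subst_X_pow hp0] at hc
  constructor
  · intro hm
    have := sub_mem hm (hc (p ^ h))
    rw [if_pos dvd_rfl, sub_sub_cancel, Nat.div_self (Nat.pos_of_ne_zero hp0)] at this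
    exact (mem_maximalIdeal _).1 this hψ
  · intro i hi
    rcases Nat.eq_zero_or_pos i with rfl | hi0
    · rw [PowerSeries.coeff_zero_eq_constantCoeff, h0]; exact zero_mem _
    · simpa [Nat.not_dvd_of_pos_of_lt hi0 hi] using hc i

variable [IsDomain R] [IsDiscreteValuationRing R] [IsAdicComplete (maximalIdeal R) R]

open IsDiscreteValuationRing hiding maximalIdeal

lemma addVal_add_eq_of_lt {A : Type*} [CommRing A] [IsDomain A] [IsDiscreteValuationRing A]
    {a b : A} (h : addVal A a < addVal A b) : addVal A (a + b) = addVal A a :=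
  AddValuation.map_add_eq_of_lt_left _ h

lemma one_le_addVal_iff {A : Type*} [CommRing A] [IsDomain A] [IsDiscreteValuationRing A]
    {a : A} : 1 ≤ addVal A a ↔ a ∈ maximalIdeal A := by
  rw [Order.one_le_iff_ne_zero, Ne, addVal_eq_zero_iff, mem_maximalIdeal, mem_nonunits_iff]

lemma natCast_le_addVal_iff {A : Type*} [CommRing A] [IsDomain A] [IsDiscreteValuationRing A]
    {a : A} {n : ℕ} : n ≤ addVal A a ↔ a ∈ maximalIdeal A ^ n := by
  obtain ⟨ϖ, hϖ⟩ := exists_irreducible A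
  rw [hϖ.maximalIdeal_eq, Ideal.span_singleton_pow, Ideal.mem_span_singleton,
    ← addVal_le_iff_dvd, addVal_pow, addVal_uniformizer hϖ]
  simp

lemma exists_nat_addVal {A : Type*} [CommRing A] [IsDomain A] [IsDiscreteValuationRing A]
    {a : A} (h : a ≠ 0) : ∃ n : ℕ, addVal A a = n :=
  ENat.ne_top_iff_exists.1 (by rwa [Ne, addVal_eq_top_iff]) |>.imp fun _ h => h.symm

/-- For points close to `0`, `φ` sends valuation `n` to `k n + c`, where `k` is the order of `φ`,
while `[p]` adds `e = v(p)`. Since `φ` commutes with `[p]`, `k e = e` and so `k = 1`. Characteristic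
zero enters through `e` being finite. -/
lemma IsHom.coeff_one_ne_zero {F G : FormalGroup R} {φ : PowerSeries R} (hφ : IsHom F G φ)
    (hne : φ ≠ 0) {p : ℕ} (hpm : (p : R) ∈ maximalIdeal R) (hp0 : (p : R) ≠ 0) :
    PowerSeries.coeff 1 φ ≠ 0 := by
  obtain ⟨g, hg⟩ := PowerSeries.X_pow_order_dvd (φ := φ)
  set k := φ.order.toNat
  have hk : PowerSeries.coeff k φ ≠ 0 := PowerSeries.coeff_order hne
  have hk0 : k ≠ 0 := by
    intro h
    rw [h, PowerSeries.coeff_zero_eq_constantCoeff, hφ.constantCoeff_eq_zero] at hk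
    exact hk rfl
  have hgk : PowerSeries.constantCoeff g = PowerSeries.coeff k φ := by
    rw [hg, PowerSeries.coeff_X_pow_mul', if_pos le_rfl, Nat.sub_self,
      PowerSeries.coeff_zero_eq_constantCoeff]
  obtain ⟨e, he⟩ := exists_nat_addVal hp0
  obtain ⟨c, hc⟩ := exists_nat_addVal hk
  have he0 : e ≠ 0 := by
    rintro rfl
    have := one_le_addVal_iff.2 hpm
    rw [he] at this
    simp at this
  have hval : ∀ y : Points R F, ∀ n : ℕ, addVal R y.1 = n → c < n →
      addVal R (ev φ y.1) = (k * n + c : ℕ) := by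
    intro y n hn hcn
    obtain ⟨b, hb⟩ := ev_eq_add_mul y.2 g
    have h1 := congrArg (fun q => ev q y.1) hg
    simp only [ev_mul y.2, ev_pow y.2, ev_X, hb, hgk] at h1
    rw [h1, addVal_mul, addVal_pow, hn, Algebra.algebraMap_self_apply, addVal_add_eq_of_lt, hc]
    · simp
    · rw [addVal_mul, hc, hn]
      exact lt_of_lt_of_le (by exact_mod_cast hcn) le_self_add
  have hmul : ∀ (H : FormalGroup R) (y : Points R H), ∀ n : ℕ, addVal R y.1 = n → e < n →
      addVal R (p • y).1 = (n + e : ℕ) := by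
    intro H y n hn hen
    obtain ⟨b, hb⟩ := Points.val_nsmul y p
    rw [hb, addVal_mul, addVal_add_eq_of_lt, hn, he]
    · simp
    · rw [addVal_mul, hn, he]
      exact lt_of_lt_of_le (by exact_mod_cast hen) le_self_add
  obtain ⟨ϖ, hϖ⟩ := exists_irreducible R
  -- The exponent exceeds both `c` and `e`, so both valuation formulas apply.
  have hN : addVal R (ϖ ^ (c + e + 1)) = (c + e + 1 : ℕ) := by
    rw [addVal_pow, addVal_uniformizer hϖ]; simp
  let x : Points R F := ⟨ϖ ^ (c + e + 1), by
    rw [← one_le_addVal_iff, hN]; exact_mod_cast Nat.le_add_left 1 (c + e)⟩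
  have h1 := hval (p • x) _ (hmul F x _ hN (by omega)) (by omega)
  have h2 := hmul G (hφ.onPoints x) _ (hval x _ hN (by omega)) (by
    have := Nat.le_mul_of_pos_left (c + e + 1) (Nat.pos_of_ne_zero hk0); omega)
  rw [← map_nsmul, hφ.onPoints_val, h1] at h2
  have h3 : k * (c + e + 1 + e) + c = k * (c + e + 1) + c + e := by exact_mod_cast h2
  have h4 : k * e = 1 * e := by rw [mul_add k (c + e + 1) e] at h3; omega
  have h5 : k = 1 := Nat.eq_of_mul_eq_mul_right (Nat.pos_of_ne_zero he0) h4
  rwa [h5] at hk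

open Polynomial in
/-- A power series of Weierstrass degree `d` with `d` distinct zeros is, up to a unit, the product
of the corresponding linear factors. -/
lemma exists_eq_prod_mul {φ : PowerSeries R} {d : ℕ}
    (hd : PowerSeries.coeff d φ ∉ maximalIdeal R)
    (hlt : ∀ i < d, PowerSeries.coeff i φ ∈ maximalIdeal R) {r : ℕ → R}
    (hr : ∀ k < d, r k ∈ maximalIdeal R) (hr0 : ∀ k < d, ev φ (r k) = 0)
    (hinj : Set.InjOn r (Set.Iio d)) :
    ∃ h : PowerSeries R, IsUnit h ∧
      φ = ((∏ k ∈ Finset.range d, (X - C (r k)) : R[X]) : PowerSeries R) * h := by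
  obtain ⟨f, h, hf, hdeg, -, hu, hfh⟩ := exists_weierstrass hd hlt
  refine ⟨h, hu, ?_⟩
  have hroot : ∀ k < d, f.IsRoot (r k) := fun k hk => by
    have h1 := hr0 k hk
    rw [hfh, ev_mul (hr k hk), ev_coe (hr k hk)] at h1
    have := (isUnit_ev (hr k hk) hu).mul_left_eq_zero.1 h1
    rwa [Polynomial.coe_aeval_eq_eval] at this
  have hprod : (∏ k ∈ Finset.range d, (X - C (r k))) =
      (((Multiset.range d).map r).map fun a => X - C a).prod := by
    rw [Multiset.map_map]; rfl
  have hmonic : (∏ k ∈ Finset.range d, (X - C (r k))).Monic :=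
    monic_prod_of_monic _ _ fun k _ => monic_X_sub_C _
  have hdvd : (∏ k ∈ Finset.range d, (X - C (r k))) ∣ f := by
    rw [hprod, Multiset.prod_X_sub_C_dvd_iff_le_roots hf.ne_zero,
      Multiset.le_iff_subset ((Multiset.nodup_range d).map_on fun a ha b hb hab =>
        hinj (by simpa using ha) (by simpa using hb) hab)]
    intro a ha
    obtain ⟨k, hk, rfl⟩ := Multiset.mem_map.1 ha
    exact (mem_roots hf.ne_zero).2 (hroot k (by simpa using hk))
  rw [hfh, eq_of_monic_of_dvd_of_natDegree_le hmonic hf hdvd (by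
    rw [hdeg, natDegree_prod_of_monic _ _ fun k _ => monic_X_sub_C _]; simp)]

variable {p : ℕ} {F G : FormalGroup R} {φ : PowerSeries R}

/-- The group difference is `[l - k] z` with `l - k` prime to `p`, so the points of a kernel of
order `p` are equidistant. -/
lemma Points.addVal_nsmul_sub_nsmul (hp : p.Prime) (hpm : (p : R) ∈ maximalIdeal R)
    (z : Points R F) {k l : ℕ} (hkl : k < l) (hl : l < p) :
    addVal R ((l • z).1 - (k • z).1) = addVal R z.1 := by
  have : l • z = k • z + (l - k) • z := by rw [← add_nsmul]; congr 1; omega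
  rw [this, Points.addVal_val_add_sub]
  refine Points.addVal_nsmul_of_isUnit _ (Points.isUnit_natCast_of_coprime hpm ?_)
  exact Nat.coprime_of_lt_prime (by omega) (by omega) hp

lemma Points.injOn_nsmul (hp : p.Prime) (hpm : (p : R) ∈ maximalIdeal R)
    {z : Points R F} (hz : z ≠ 0) : Set.InjOn (fun k : ℕ => (k • z).1) (Set.Iio p) := by
  have hne : ∀ k l : ℕ, k < l → l < p → (k • z).1 ≠ (l • z).1 := by
    intro k l hkl hl h
    have h1 := Points.addVal_nsmul_sub_nsmul hp hpm z hkl hl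
    rw [h, sub_self, addVal_zero, eq_comm, addVal_eq_top_iff, Points.val_eq_zero] at h1
    exact hz h1
  intro k hk l hl h
  rcases lt_trichotomy k l with hlt | rfl | hlt
  · exact absurd h (hne k l hlt hl)
  · rfl
  · exact absurd h.symm (hne l k hlt hk)

/-- Height one means Weierstrass degree `p`, and the multiples `[k] z` with `k < p` already supply
`p` distinct zeros. -/
lemma IsIsogeny.exists_eq_prod (hφ : IsIsogeny p 1 F G φ) (hp : p.Prime)
    (hpm : (p : R) ∈ maximalIdeal R) {z : Points R F} (hz : z ≠ 0) (hz0 : ev φ z.1 = 0) :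
    ∃ h : PowerSeries R, IsUnit h ∧ φ = ((∏ k ∈ Finset.range p,
      (Polynomial.X - Polynomial.C ((k • z).1)) : Polynomial R) : PowerSeries R) * h := by
  obtain ⟨h1, h2⟩ := hφ.hasHeight.coeff_mem hp hφ.isHom.constantCoeff_eq_zero
  rw [pow_one] at h1 h2
  refine exists_eq_prod_mul h1 h2 (fun k _ => (k • z).2) (fun k _ => ?_)
    (Points.injOn_nsmul hp hpm hz)
  have : hφ.isHom.onPoints z = 0 := Points.ext hz0
  rw [← hφ.isHom.onPoints_val, map_nsmul, this, nsmul_zero]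
  rfl

lemma addVal_prod {B : Type*} [CommRing B] [IsDomain B] [IsDiscreteValuationRing B]
    {ι : Type*} (s : Finset ι) (f : ι → B) :
    addVal B (∏ k ∈ s, f k) = ∑ k ∈ s, addVal B (f k) := by
  classical
  induction s using Finset.induction_on with
  | empty => simp
  | insert a s ha ih => rw [Finset.prod_insert ha, Finset.sum_insert ha, addVal_mul, ih]

/-- Removing the factor `T` for `k = 0`, the linear coefficient is a unit times the product of the
`p - 1` values `-[k] z`, all of the valuation of `z`. -/
lemma IsIsogeny.addVal_coeff_one (hφ : IsIsogeny p 1 F G φ) (hp : p.Prime)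
    (hpm : (p : R) ∈ maximalIdeal R) {z : Points R F} (hz : z ≠ 0) (hz0 : ev φ z.1 = 0) :
    addVal R (PowerSeries.coeff 1 φ) = (p - 1 : ℕ) * addVal R z.1 := by
  obtain ⟨h, hu, hφh⟩ := hφ.exists_eq_prod hp hpm hz hz0
  obtain ⟨q, rfl⟩ : ∃ q, p = q + 1 := ⟨p - 1, (Nat.succ_pred_eq_of_pos hp.pos).symm⟩
  rw [Finset.prod_range_succ'] at hφh
  simp only [zero_nsmul, Points.val_zero, map_zero, sub_zero, Polynomial.coe_mul,
    Polynomial.coe_X] at hφh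
  rw [hφh, mul_right_comm, ← zero_add 1, PowerSeries.coeff_succ_mul_X, PowerSeries.coeff_zero_eq_constantCoeff,
    map_mul, addVal_mul, addVal_eq_zero_iff.2 (hu.map _), add_zero,
    ← PowerSeries.coeff_zero_eq_constantCoeff_apply, Polynomial.coeff_coe,
    Polynomial.coeff_zero_prod]
  have hk : ∀ k ∈ Finset.range q, addVal R ((Polynomial.X - Polynomial.C ((k + 1) • z).1).coeff 0)
      = addVal R z.1 := by
    intro k hk
    rw [Polynomial.coeff_sub, Polynomial.coeff_X_zero, Polynomial.coeff_C_zero, zero_sub,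
      AddValuation.map_neg]
    refine Points.addVal_nsmul_of_isUnit _ (Points.isUnit_natCast_of_coprime hpm ?_)
    exact Nat.coprime_of_lt_prime (Nat.succ_ne_zero k) (by simpa using hk) hp
  rw [addVal_prod, Finset.sum_congr rfl hk]
  simp

end Height

/-! ### Valuations along a chain of isogenies of height one -/

section Chain

variable {R : Type*} [CommRing R] {φs : ℕ → PowerSeries R} {n : ℕ}

section

variable {A : Type*} [CommRing A] [IsLocalRing A] [Algebra R A]
  [IsAdicComplete (maximalIdeal A) A]

lemma ev_comp_succ {a : A} (ha : a ∈ maximalIdeal A) {i k : ℕ}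
    (hc : PowerSeries.constantCoeff (φs (i + k + 1)) = 0) :
    ev (comp φs i (k + 1)) a = ev (comp φs i k) (ev (φs (i + k + 1)) a) :=
  ev_subst ha hc _

/-- The recursion defining `comp` adds the innermost map; here the outermost one is split off, which
is what going up from `G₀` requires. -/
lemma ev_comp_succ' (hc : ∀ i < n, PowerSeries.constantCoeff (φs (i + 1)) = 0) {i k : ℕ}
    (hik : i + k < n) {a : A} (ha : a ∈ maximalIdeal A) :
    ev (comp φs i (k + 1)) a = ev (φs (i + 1)) (ev (comp φs (i + 1) k) a) := by
  induction k generalizing a with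
  | zero =>
    rw [ev_comp_succ ha (hc _ hik)]
    simp only [comp, ev_X]
  | succ k ih =>
    have h1 : i + (k + 1) + 1 = i + 1 + k + 1 := by omega
    rw [ev_comp_succ ha (hc _ hik), ih (by omega) (ev_mem ha (hc _ hik)), h1,
      ev_comp_succ ha (h1 ▸ hc _ hik)]

/-- The image of `a` under `φ_{i+1} ∘ ⋯ ∘ φₙ`. -/
def chain (φs : ℕ → PowerSeries R) (n i : ℕ) (a : A) : A := ev (comp φs i (n - i)) a

lemma chain_self (a : A) : chain φs n n a = a := by
  rw [chain, Nat.sub_self]; exact ev_X a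

lemma chain_eq_ev_chain_succ (hc : ∀ i < n, PowerSeries.constantCoeff (φs (i + 1)) = 0) {i : ℕ}
    (hi : i < n) {a : A} (ha : a ∈ maximalIdeal A) :
    chain φs n i a = ev (φs (i + 1)) (chain φs n (i + 1) a) := by
  have h1 : n - i = (n - (i + 1)) + 1 := by omega
  rw [chain, h1, ev_comp_succ' hc (by omega) ha]
  rfl

lemma chain_mem (hc : ∀ i < n, PowerSeries.constantCoeff (φs (i + 1)) = 0) {i : ℕ}
    (hi : i ≤ n) {a : A} (ha : a ∈ maximalIdeal A) : chain φs n i a ∈ maximalIdeal A := by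
  induction hi using Nat.decreasingInduction with
  | of_succ i hi ih =>
    rw [chain_eq_ev_chain_succ hc hi ha]
    exact ev_mem ih (hc i hi)
  | self => rwa [chain_self]

end

variable {A : Type*} [CommRing A] [IsDomain A] [IsDiscreteValuationRing A] [Algebra R A]
  [IsAdicComplete (maximalIdeal A) A] {Gs : ℕ → FormalGroup R}

lemma exists_chainHom (hom : ∀ i < n, IsHom (Gs (i + 1)) (Gs i) (φs (i + 1))) {i : ℕ}
    (hi : i ≤ n) :
    ∃ f : Points A (Gs n) →+ Points A (Gs i), ∀ x, (f x).1 = chain φs n i x.1 := by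
  induction hi using Nat.decreasingInduction with
  | of_succ i hi ih =>
    obtain ⟨f, hf⟩ := ih
    refine ⟨(hom i hi).onPoints.comp f, fun x => ?_⟩
    rw [chain_eq_ev_chain_succ (fun i hi => (hom i hi).constantCoeff_eq_zero) hi x.2, ← hf]
    rfl
  | self => exact ⟨AddMonoidHom.id _, fun x => (chain_self _).symm⟩

end Chain

/-! ### Valuations of images and preimages under isogenies with rational kernel -/

section Valuation

open IsDiscreteValuationRing hiding maximalIdeal

variable {R : Type*} [CommRing R] [IsDomain R] [IsDiscreteValuationRing R]
  [IsAdicComplete (maximalIdeal R) R] {p : ℕ}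
  {A : Type*} [CommRing A] [IsDomain A] [IsDiscreteValuationRing A] [Algebra R A]
  [IsAdicComplete (maximalIdeal A) A] {e : ℕ}

lemma algebraMap_mem_maximalIdeal (he0 : e ≠ 0)
    (he : ∀ r : R, addVal A (algebraMap R A r) = e * addVal R r) {r : R}
    (hr : r ∈ maximalIdeal R) : algebraMap R A r ∈ maximalIdeal A := by
  rw [← one_le_addVal_iff] at hr ⊢
  rw [he]
  exact le_trans (by exact_mod_cast Nat.one_le_iff_ne_zero.2 he0) (le_mul_of_one_le_right' hr)

/-- The value of an isogeny of height one at a point is determined by the distances of the point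
to the kernel. -/
lemma IsIsogeny.addVal_ev {F G : FormalGroup R} {φ : PowerSeries R}
    (hφ : IsIsogeny p 1 F G φ) (hp : p.Prime) (hpm : (p : R) ∈ maximalIdeal R)
    {z : Points R F} (hz : z ≠ 0) (hz0 : ev φ z.1 = 0) {a : A} (ha : a ∈ maximalIdeal A) :
    addVal A (ev φ a) = ∑ k ∈ Finset.range p, addVal A (a - algebraMap R A (k • z).1) := by
  obtain ⟨h, hu, hφh⟩ := hφ.exists_eq_prod hp hpm hz hz0
  rw [hφh, ev_mul ha, ev_coe ha, addVal_mul, addVal_eq_zero_iff.2 (isUnit_ev ha hu), add_zero,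
    map_prod, addVal_prod]
  simp

/-- A point nearer to the unit sphere than the nonzero kernel points is at distance `v(a)` from each
of the `p` kernel points. -/
lemma IsIsogeny.addVal_ev_of_lt {F G : FormalGroup R} {φ : PowerSeries R}
    (hφ : IsIsogeny p 1 F G φ) (hp : p.Prime) (hpm : (p : R) ∈ maximalIdeal R)
    (he : ∀ r : R, addVal A (algebraMap R A r) = e * addVal R r)
    {z : Points R F} (hz : z ≠ 0) (hz0 : ev φ z.1 = 0) {a : A} (ha : a ∈ maximalIdeal A)
    (hlt : addVal A a < e * addVal R z.1) : addVal A (ev φ a) = p * addVal A a := by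
  rw [hφ.addVal_ev hp hpm hz hz0 ha, Finset.sum_congr rfl (g := fun _ => addVal A a)]
  · simp
  intro k hk
  rcases Nat.eq_zero_or_pos k with rfl | hk0
  · simp
  rw [sub_eq_add_neg, addVal_add_eq_of_lt]
  rw [AddValuation.map_neg, he, Points.addVal_nsmul_of_isUnit _
    (Points.isUnit_natCast_of_coprime hpm ?_)]
  · exact hlt
  · exact Nat.coprime_of_lt_prime (by omega) (by simpa using hk) hp

/-- If `a` were as small as the nonzero kernel points, every one of the `p` factors would have
valuation at least that of `z`. -/
lemma IsIsogeny.addVal_lt_of_addVal_ev_lt {F G : FormalGroup R} {φ : PowerSeries R}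
    (hφ : IsIsogeny p 1 F G φ) (hp : p.Prime) (hpm : (p : R) ∈ maximalIdeal R)
    (he : ∀ r : R, addVal A (algebraMap R A r) = e * addVal R r)
    {z : Points R F} (hz : z ≠ 0) (hz0 : ev φ z.1 = 0) {a : A} (ha : a ∈ maximalIdeal A)
    (hlt : addVal A (ev φ a) < p * (e * addVal R z.1)) : addVal A a < e * addVal R z.1 := by
  by_contra hge
  rw [not_lt] at hge
  refine absurd hlt (not_lt.2 ?_)
  rw [hφ.addVal_ev hp hpm hz hz0 ha]
  have : ∀ k ∈ Finset.range p, e * addVal R z.1 ≤ addVal A (a - algebraMap R A (k • z).1) := by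
    intro k hk
    rcases Nat.eq_zero_or_pos k with rfl | hk0
    · simpa using hge
    refine le_trans (le_min hge ?_) ((addVal A).map_sub _ _)
    rw [he, Points.addVal_nsmul_of_isUnit _ (Points.isUnit_natCast_of_coprime hpm ?_)]
    exact Nat.coprime_of_lt_prime (by omega) (by simpa using hk) hp
  simpa using Finset.card_nsmul_le_sum _ _ _ this

variable {n : ℕ} {Gs : ℕ → FormalGroup R} {φs : ℕ → PowerSeries R}

/-- `x₀` generates the kernel of `φ₁ ∘ ⋯ ∘ φₙ`, the kernel of `φ_{j+1} ∘ ⋯ ∘ φₙ` being generated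
by `[pʲ] x₀`. -/
structure IsKernelGenerator (p n : ℕ) (Gs : ℕ → FormalGroup R) (φs : ℕ → PowerSeries R)
    (x₀ : Points R (Gs n)) : Prop where
  isIsogeny : ∀ i < n, IsIsogeny p 1 (Gs (i + 1)) (Gs i) (φs (i + 1))
  pow_nsmul : p ^ n • x₀ = 0
  chain_ne_zero : ∀ j < n, chain φs n (j + 1) (p ^ j • x₀).1 ≠ 0
  chain_eq_zero : ∀ j < n, chain φs n j (p ^ j • x₀).1 = 0

namespace IsKernelGenerator

variable {x₀ : Points R (Gs n)} (H : IsKernelGenerator p n Gs φs x₀)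
include H

lemma constantCoeff : ∀ i < n, PowerSeries.constantCoeff (φs (i + 1)) = 0 :=
  fun i hi => (H.isIsogeny i hi).isHom.constantCoeff_eq_zero

lemma exists_chainHom {i : ℕ} (hi : i ≤ n) :
    ∃ f : Points A (Gs n) →+ Points A (Gs i), ∀ x, (f x).1 = chain φs n i x.1 :=
  FormalIsogeny.exists_chainHom (fun i hi => (H.isIsogeny i hi).isHom) hi

/-- The valuations of the generators of the kernels of the `φᵢ`. -/
lemma exists_level : ∃ S : ℕ → ℕ, ∀ j < n, ∃ z : Points R (Gs (j + 1)), z ≠ 0 ∧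
    z.1 = chain φs n (j + 1) (p ^ j • x₀).1 ∧ ev (φs (j + 1)) z.1 = 0 ∧ addVal R z.1 = S j := by
  have : ∀ j, ∃ s : ℕ, j < n → ∃ z : Points R (Gs (j + 1)), z ≠ 0 ∧
      z.1 = chain φs n (j + 1) (p ^ j • x₀).1 ∧ ev (φs (j + 1)) z.1 = 0 ∧ addVal R z.1 = s := by
    intro j
    by_cases hj : j < n
    · obtain ⟨s, hs⟩ := exists_nat_addVal (H.chain_ne_zero j hj)
      refine ⟨s, fun _ => ⟨⟨_, chain_mem H.constantCoeff hj (p ^ j • x₀).2⟩, ?_, rfl, ?_, hs⟩⟩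
      · rw [Ne, ← Points.val_eq_zero]; exact H.chain_ne_zero j hj
      · rw [← chain_eq_ev_chain_succ H.constantCoeff hj (p ^ j • x₀).2]
        exact H.chain_eq_zero j hj
    · exact ⟨0, fun h => absurd h hj⟩
  exact Classical.axiomOfChoice this

variable {S : ℕ → ℕ} (hS : ∀ j < n, ∃ z : Points R (Gs (j + 1)), z ≠ 0 ∧
    z.1 = chain φs n (j + 1) (p ^ j • x₀).1 ∧ ev (φs (j + 1)) z.1 = 0 ∧ addVal R z.1 = S j)
  (hp : p.Prime) (hpm : (p : R) ∈ maximalIdeal R)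
include hS hp hpm

lemma t_eq {j : ℕ} (hj : j < n) : t φs (j + 1) = (p - 1) * S j := by
  obtain ⟨z, hz, -, hz0, hzS⟩ := hS j hj
  rw [t, (H.isIsogeny j hj).addVal_coeff_one hp hpm hz hz0, hzS]
  norm_cast

/-- The image `w` of `[pʲ] x₀` in `G_{j+2}` satisfies `φ_{j+2}(w) = z` and `[p] w = z'`, with `z`,
`z'` the generators at the two levels. As `[p]` strictly raises valuations, `v(w) < v(z')`, hence
`v(z) = p v(w) < p v(z')`. -/
lemma level_lt {j : ℕ} (hj : j + 1 < n) : S j < p * S (j + 1) := by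
  obtain ⟨z, hz, hzc, hz0, hzS⟩ := hS j (by omega)
  obtain ⟨z', hz', hzc', hz0', hzS'⟩ := hS (j + 1) hj
  obtain ⟨f, hf⟩ := H.exists_chainHom (A := R) (i := j + 2) hj
  have h1 : ev (φs (j + 2)) (f (p ^ j • x₀)).1 = z.1 := by
    rw [hf, hzc, chain_eq_ev_chain_succ H.constantCoeff hj (p ^ j • x₀).2]
  have h2 : p • f (p ^ j • x₀) = z' := by
    ext
    rw [← map_nsmul, ← mul_nsmul, ← pow_succ, hf, hzc']
  have hne : f (p ^ j • x₀) ≠ 0 := by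
    intro h
    rw [h, nsmul_zero] at h2
    exact hz' h2.symm
  have h3 := Points.addVal_lt_addVal_nsmul hne hpm
  rw [h2] at h3
  have h4 := (H.isIsogeny (j + 1) hj).addVal_ev_of_lt (A := R) (e := 1) hp hpm (by simp) hz' hz0'
    (f (p ^ j • x₀)).2 (by simpa using h3)
  rw [h1, hzS] at h4
  obtain ⟨v, hv⟩ := exists_nat_addVal (Points.val_eq_zero.not.2 hne)
  rw [hv, hzS'] at h3
  rw [hv] at h4
  have h5 : S j = p * v := by exact_mod_cast h4
  have h6 : v < S (j + 1) := by exact_mod_cast h3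
  rw [h5]
  exact Nat.mul_lt_mul_of_pos_left h6 hp.pos

/-- Valuations in a tower of preimages under the `φᵢ`. -/
lemma addVal_chain (he : ∀ r : R, addVal A (algebraMap R A r) = e * addVal R r)
    (he0 : e ≠ 0) {a : A}
    (ha : a ∈ maximalIdeal A) {i : ℕ} {N : ℕ} (hN : addVal A (chain φs n i a) = N)
    (hlt : i < n → N < p * (e * S i)) {l : ℕ} (hl : i + l ≤ n) :
    ∃ v : ℕ, addVal A (chain φs n (i + l) a) = v ∧ p ^ l * v = N ∧
      (i + l < n → v < p * (e * S (i + l))) := by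
  induction l with
  | zero => exact ⟨N, by simpa using hN, by simp, hlt⟩
  | succ l ih =>
    obtain ⟨v, hv, hvN, hvlt⟩ := ih (by omega)
    have hl' : i + l < n := by omega
    obtain ⟨z, hz, -, hz0, hzS⟩ := hS (i + l) hl'
    rw [chain_eq_ev_chain_succ H.constantCoeff hl' ha] at hv
    have hm := chain_mem H.constantCoeff (Nat.succ_le_of_lt hl') ha
    have h1 := (H.isIsogeny _ hl').addVal_lt_of_addVal_ev_lt hp hpm he hz hz0 hm (by
      rw [hv, hzS]; exact_mod_cast hvlt hl')
    have h2 := (H.isIsogeny _ hl').addVal_ev_of_lt hp hpm he hz hz0 hm h1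
    have hne : chain φs n (i + l + 1) a ≠ 0 := by
      intro h
      rw [h, addVal_zero] at h1
      exact not_top_lt h1
    obtain ⟨v', hv'⟩ := exists_nat_addVal hne
    rw [hv, hv'] at h2
    rw [hv', hzS] at h1
    have h3 : v = p * v' := by exact_mod_cast h2
    have h4 : v' < e * S (i + l) := by exact_mod_cast h1
    -- The bound `v' < e S_{i+l}` passes to the next level because `S_{i+l} < p S_{i+l+1}`.
    refine ⟨v', hv', by rw [pow_succ, mul_assoc, ← h3, hvN], fun hlt' => h4.trans ?_⟩
    have h5 := H.level_lt hS hp hpm (j := i + l) (by omega)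
    calc e * S (i + l) < e * (p * S (i + l + 1)) :=
          Nat.mul_lt_mul_of_pos_left h5 (Nat.pos_of_ne_zero he0)
      _ = _ := by rw [← mul_assoc, mul_comm e p, mul_assoc]; rfl

/-- The point `[pʲ] x₀` is reached from the kernel generator at level `j + 1` by `n - (j + 1)`
preimages, each dividing the valuation by `p`. -/
lemma addVal_pow_nsmul {j : ℕ} (hj : j < n) :
    ∃ v : ℕ, addVal R (p ^ j • x₀).1 = v ∧ p ^ (n - (j + 1)) * v = S j := by
  obtain ⟨z, hz, hzc, hz0, hzS⟩ := hS j hj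
  obtain ⟨v, hv, hvN, -⟩ := H.addVal_chain hS hp hpm (A := R) (e := 1) (by simp) one_ne_zero
    (p ^ j • x₀).2 (i := j + 1) (N := S j) (by rw [← hzc, hzS])
    (fun h => by rw [one_mul]; exact H.level_lt hS hp hpm h) (l := n - (j + 1)) (by omega)
  rw [show j + 1 + (n - (j + 1)) = n by omega, chain_self] at hv
  exact ⟨v, hv, hvN⟩

end IsKernelGenerator

end Valuation

/-! ### Finite extensions of complete discrete valuation rings -/

section FiniteExtension

/-- Membership in `Iⁿ M` is tested on the coordinates in a finite basis, so completeness is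
inherited coordinatewise. -/
lemma isAdicComplete_of_free {R M : Type*} [CommRing R] [AddCommGroup M] [Module R M]
    [Module.Free R M] [Module.Finite R M] (I : Ideal R) [IsAdicComplete I R] :
    IsAdicComplete I M := by
  let b := Module.Free.chooseBasis R M
  have hcoord : ∀ (n : ℕ) (x : M), x ∈ (I ^ n • ⊤ : Submodule R M) → ∀ i, b.repr x i ∈ I ^ n := by
    intro n x hx i
    induction hx using Submodule.smul_induction_on' with
    | smul r hr y _ =>
      rw [map_smul, Finsupp.smul_apply, smul_eq_mul]
      exact Ideal.mul_mem_right _ _ hr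
    | add x _ y _ hx hy =>
      rw [map_add, Finsupp.add_apply]
      exact add_mem hx hy
  have hmem : ∀ (n : ℕ) (x : M), (∀ i, b.repr x i ∈ I ^ n) → x ∈ (I ^ n • ⊤ : Submodule R M) := by
    intro n x hx
    rw [← b.sum_repr x]
    exact Submodule.sum_mem _ fun i _ => Submodule.smul_mem_smul (hx i) trivial
  refine { haus' := fun x hx => ?_, prec' := fun f hf => ?_ }
  · have : b.repr x = 0 := by
      ext i
      refine IsHausdorff.haus (I := I) inferInstance _ fun n => ?_
      have := hcoord n x (by simpa [SModEq.zero] using hx n) i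
      simpa [SModEq.zero] using this
    simpa using this
  · have : ∀ i, ∃ l, ∀ n, b.repr (f n) i ≡ l [SMOD (I ^ n • ⊤ : Ideal R)] := fun i =>
      IsPrecomplete.prec (I := I) inferInstance fun {m n} hmn => by
        have h := hcoord m _ (SModEq.sub_mem.1 (hf hmn)) i
        rw [map_sub, Finsupp.sub_apply] at h
        rw [SModEq.sub_mem]
        simpa using h
    choose l hl using this
    refine ⟨∑ i, l i • b i, fun n => ?_⟩
    rw [SModEq.sub_mem]
    refine hmem n _ fun i => ?_
    have := hl i n
    rw [SModEq.sub_mem] at this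
    rw [map_sub, Finsupp.sub_apply, b.repr_sum_self]
    simpa using this

/-- The quotient by `J` is Artinian, so some power of `a` is associated there with an idempotent. By
Hensel's lemma it lifts to a root of `X² - X`, which in a domain is `0` or `1`; accordingly `a` is
nilpotent or a unit modulo `J`, and `1 - a` or `a` is a unit. -/
lemma isLocalRing_of_isAdicComplete_map {R A : Type*} [CommRing R] [IsLocalRing R] [CommRing A]
    [IsDomain A] [Algebra R A] [Module.Finite R A]
    [IsAdicComplete ((maximalIdeal R).map (algebraMap R A)) A] : IsLocalRing A := by
  set J := (maximalIdeal R).map (algebraMap R A)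
  have hJ : J ≤ Ideal.jacobson ⊥ := IsAdicComplete.le_jacobson_bot J
  have hart : IsArtinianRing (A ⧸ J) := by
    let : Field (R ⧸ maximalIdeal R) := Ideal.Quotient.field _
    have : Module.Finite (R ⧸ maximalIdeal R) (A ⧸ J) :=
      Module.Finite.of_restrictScalars_finite R _ _
    exact IsArtinianRing.of_finite (R ⧸ maximalIdeal R) (A ⧸ J)
  refine IsLocalRing.of_isUnit_or_isUnit_one_sub_self fun a => ?_
  set q := Ideal.Quotient.mk J
  obtain ⟨k, hk0, c, hc⟩ : ∃ k, k ≠ 0 ∧ ∃ c, q a ^ k = q a ^ (2 * k) * c := by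
    -- The descending chain of the ideals `(aⁿ)` stabilizes.
    obtain ⟨n, y, hy⟩ := IsArtinian.exists_pow_succ_smul_dvd (q a) (1 : A ⧸ J)
    simp only [smul_eq_mul, mul_one] at hy
    have h1 : ∀ j, q a ^ n * (q a * y) ^ j = q a ^ n := fun j => by
      induction j with
      | zero => simp
      | succ j ih => rw [pow_succ, ← mul_assoc, ih, ← mul_assoc, ← pow_succ, hy]
    refine ⟨n + 1, by omega, y ^ (n + 1), ?_⟩
    calc q a ^ (n + 1) = q a ^ n * (q a * y) ^ (n + 1) * q a := by rw [h1, pow_succ]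
      _ = _ := by ring
  obtain ⟨c, rfl⟩ := Ideal.Quotient.mk_surjective c
  set e := a ^ k * c
  have hqe : q e * q e = q e := by
    simp only [e, map_mul, map_pow]
    calc q a ^ k * q c * (q a ^ k * q c) = q a ^ (2 * k) * q c * q c := by ring
      _ = q a ^ k * q c := by rw [← hc]
  have heJ : e * e - e ∈ J := by
    rw [← Ideal.Quotient.eq_zero_iff_mem, map_sub, map_mul, hqe, sub_self]
  -- The derivative `2e - 1` is its own inverse modulo `J`, since `(2e - 1)² = 4(e² - e) + 1`.
  open Polynomial in
  obtain ⟨r, hr, hre⟩ := HenselianRing.is_henselian (I := J) (X ^ 2 - X : A[X])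
    (by monicity!) e (by simpa [sq] using heJ) (by
      refine IsUnit.of_mul_eq_one (q (2 * e - 1)) ?_
      have : q (e * e - e) = 0 := Ideal.Quotient.eq_zero_iff_mem.2 heJ
      have h4 : q ((2 * e - 1) * (2 * e - 1)) = 1 := by
        have : (2 * e - 1) * (2 * e - 1) = 4 * (e * e - e) + 1 := by ring
        rw [this, map_add, map_mul, ‹q (e * e - e) = 0›, mul_zero, zero_add, map_one]
      have h5 : (X ^ 2 - X : A[X]).derivative.eval e = 2 * e - 1 := by
        simp [one_add_one_eq_two]
      rw [h5, ← h4, map_mul])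
  have hr' : r * (r - 1) = 0 := by
    have h5 : r ^ 2 - r = 0 := by simpa [Polynomial.IsRoot] using hr
    linear_combination h5
  have hqr : q r = q e := by rw [← sub_eq_zero, ← map_sub, Ideal.Quotient.eq_zero_iff_mem]; exact hre
  have hak : q a ^ k = q a ^ k * q e := by
    simp only [e, map_mul, map_pow]
    rw [← mul_assoc, ← pow_add, ← two_mul, ← hc]
  rcases mul_eq_zero.1 hr' with h0 | h1
  · right
    rw [← hqr, h0, map_zero, mul_zero, ← map_pow, Ideal.Quotient.eq_zero_iff_mem] at hak
    have h6 : a ∈ Ideal.jacobson (⊥ : Ideal A) := by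
      rw [Ideal.jacobson, Ideal.mem_sInf]
      intro M hM
      exact hM.2.isPrime.mem_of_pow_mem k ((Ideal.mem_sInf.1 (hJ hak)) hM)
    have := Ideal.mem_jacobson_bot.1 h6 (-1)
    rwa [mul_neg, mul_one, neg_add_eq_sub] at this
  · left
    have h7 : q e = 1 := by rw [← hqr, sub_eq_zero.1 h1, map_one]
    have h8 : IsUnit (q a) := by
      obtain ⟨k, rfl⟩ := Nat.exists_eq_succ_of_ne_zero hk0
      refine IsUnit.of_mul_eq_one (q a ^ k * q c) ?_
      rw [← h7]
      simp only [e, map_mul, map_pow, pow_succ]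
      ring
    have := isLocalHom_of_le_jacobson_bot J hJ
    exact isUnit_of_map_unit q a h8

/-- The two adic topologies coincide; the limit of an `I`-adic Cauchy sequence is found along
indices divisible by `e`, where it is `J`-adically Cauchy. -/
lemma isAdicComplete_of_pow_eq {A : Type*} [CommRing A] {I J : Ideal A} {e : ℕ} (he : e ≠ 0)
    (h : J = I ^ e) [IsAdicComplete J A] : IsAdicComplete I A := by
  have hJI : J ≤ I := h ▸ Ideal.pow_le_self he
  refine { haus' := fun x hx => ?_, prec' := fun f hf => ?_ }
  · refine IsHausdorff.haus (I := J) inferInstance _ fun n => ?_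
    rw [h, ← pow_mul]
    exact hx _
  · obtain ⟨L, hL⟩ := IsPrecomplete.prec (I := J) inferInstance (f := fun n => f (e * n))
      fun {m n} hmn => by
        rw [h, ← pow_mul]
        exact hf (Nat.mul_le_mul_left e hmn)
    refine ⟨L, fun n => ?_⟩
    refine (hf (Nat.le_mul_of_pos_left n (Nat.pos_of_ne_zero he))).trans ?_
    exact (hL n).mono (Submodule.smul_mono_left (Ideal.pow_right_mono hJI n))

lemma exists_sub_algebraMap_mem_of_finrank_eq_one {R A : Type*} [CommRing R] [CommRing A]
    [Algebra R A] {P : Ideal R} {Q : Ideal A} [P.IsMaximal] [Q.IsMaximal] [Q.LiesOver P]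
    (h : Module.finrank (R ⧸ P) (A ⧸ Q) = 1) (a : A) : ∃ r : R, a - algebraMap R A r ∈ Q := by
  let : Field (R ⧸ P) := Ideal.Quotient.field _
  have : Nontrivial (A ⧸ Q) := Ideal.Quotient.nontrivial_iff.2 (Ideal.IsMaximal.ne_top ‹_›)
  obtain ⟨c, hc⟩ := (finrank_eq_one_iff_of_nonzero' (K := R ⧸ P) (1 : A ⧸ Q) one_ne_zero).1 h
    (Ideal.Quotient.mk _ a)
  obtain ⟨r, rfl⟩ := Ideal.Quotient.mk_surjective c
  refine ⟨r, ?_⟩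
  rw [← Ideal.Quotient.eq_zero_iff_mem, map_sub, ← hc, Algebra.smul_def, mul_one, sub_eq_zero]
  rfl

open IsDiscreteValuationRing hiding maximalIdeal

variable {R : Type*} [CommRing R] [IsDomain R] [IsDiscreteValuationRing R]
  [IsAdicComplete (maximalIdeal R) R]
  {K : Type*} [Field K] [Algebra R K] [IsFractionRing R K]
  {L : Type*} [Field L] [Algebra K L] [Algebra R L] [IsScalarTower R K L]

variable (R L) in
lemma integralClosure_algebraMap_injective [FaithfulSMul R L] :
    Function.Injective (algebraMap R (integralClosure R L)) :=
  FaithfulSMul.algebraMap_injective R (integralClosure R L)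

variable (R K L) in
include K in
lemma faithfulSMul_of_tower : FaithfulSMul R L := by
  rw [faithfulSMul_iff_algebraMap_injective, IsScalarTower.algebraMap_eq R K L]
  exact (algebraMap K L).injective.comp (IsFractionRing.injective R K)

variable [CharZero K] [FiniteDimensional K L]

variable (R K L) in
include K in
lemma finite_integralClosure : Module.Finite R (integralClosure R L) :=
  IsIntegralClosure.finite R K L (integralClosure R L)

variable (R K L) in
include K in
/-- The integral closure of a complete discrete valuation ring in a finite extension is a complete
discrete valuation ring. -/
lemma isDiscreteValuationRing_integralClosure :
    ∃ _ : IsDiscreteValuationRing (integralClosure R L),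
      IsAdicComplete (maximalIdeal (integralClosure R L)) (integralClosure R L) := by
  have := finite_integralClosure R K L
  have := faithfulSMul_of_tower R K L
  have hinj := integralClosure_algebraMap_injective R L
  have : Module.IsTorsionFree R (integralClosure R L) := inferInstance
  have : Module.Free R (integralClosure R L) := inferInstance
  have : IsAdicComplete (maximalIdeal R) (integralClosure R L) := isAdicComplete_of_free _
  -- Completeness is first obtained for the ideal generated by `𝔪_R`, a power of the maximal ideal
  -- of the closure; that power is removed at the end.
  have hc : IsAdicComplete ((maximalIdeal R).map (algebraMap R (integralClosure R L)))
    (integralClosure R L) := (IsAdicComplete.map_algebraMap_iff _ _).2 this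
  have hloc : IsLocalRing (integralClosure R L) := isLocalRing_of_isAdicComplete_map (R := R)
  have hded : IsDedekindDomain (integralClosure R L) := integralClosure.isDedekindDomain R K L
  have hnf : ¬ IsField (integralClosure R L) := fun h => by
    have := isField_of_isIntegral_of_isField hinj h
    exact IsDiscreteValuationRing.not_isField R this
  have hdvr : IsDiscreteValuationRing (integralClosure R L) :=
    ((IsDiscreteValuationRing.TFAE _ hnf).out 0 2).2 hded
  refine ⟨hdvr, ?_⟩
  obtain ⟨π, hπ⟩ := exists_irreducible R
  obtain ⟨ϖ, hϖ⟩ := exists_irreducible (integralClosure R L)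
  have hπ0 : algebraMap R (integralClosure R L) π ≠ 0 := fun h =>
    hπ.ne_zero (hinj (h.trans (map_zero _).symm))
  obtain ⟨e, he⟩ := associated_pow_irreducible hπ0 hϖ
  have hJ : (maximalIdeal R).map (algebraMap R (integralClosure R L)) =
      maximalIdeal (integralClosure R L) ^ e := by
    rw [hπ.maximalIdeal_eq, Ideal.map_span, Set.image_singleton, hϖ.maximalIdeal_eq,
      Ideal.span_singleton_pow, Ideal.span_singleton_eq_span_singleton]
    exact he
  refine isAdicComplete_of_pow_eq (e := e) ?_ hJ
  rintro rfl
  have hu : IsUnit (algebraMap R (integralClosure R L) π) := by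
    simpa [associated_one_iff_isUnit] using he
  exact hπ.not_isUnit (isUnit_of_map_unit (algebraMap R (integralClosure R L)) _ hu)

variable (R K L) in
include K in
/-- The fundamental identity `e f = [L : K]` for complete discrete valuation rings. -/
lemma exists_ramification [IsDiscreteValuationRing (integralClosure R L)] :
    ∃ e f : ℕ, e ≠ 0 ∧ e * f = Module.finrank K L ∧
      (∀ r : R, addVal (integralClosure R L) (algebraMap R _ r) = e * addVal R r) ∧
      (maximalIdeal R).map (algebraMap R (integralClosure R L)) =
        maximalIdeal (integralClosure R L) ^ e ∧
      (f = 1 → ∀ a : integralClosure R L, ∃ r : R,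
        a - algebraMap R _ r ∈ maximalIdeal (integralClosure R L)) := by
  have := finite_integralClosure R K L
  have := faithfulSMul_of_tower R K L
  have hinj := integralClosure_algebraMap_injective R L
  obtain ⟨π, hπ⟩ := exists_irreducible R
  obtain ⟨ϖ, hϖ⟩ := exists_irreducible (integralClosure R L)
  have hπ0 : algebraMap R (integralClosure R L) π ≠ 0 := fun h =>
    hπ.ne_zero (hinj (h.trans (map_zero _).symm))
  obtain ⟨e, he⟩ := associated_pow_irreducible hπ0 hϖ
  have hJ : (maximalIdeal R).map (algebraMap R (integralClosure R L)) =
      maximalIdeal (integralClosure R L) ^ e := by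
    rw [hπ.maximalIdeal_eq, Ideal.map_span, Set.image_singleton, hϖ.maximalIdeal_eq,
      Ideal.span_singleton_pow, Ideal.span_singleton_eq_span_singleton]
    exact he
  have he0 : e ≠ 0 := by
    rintro rfl
    have hu : IsUnit (algebraMap R (integralClosure R L) π) := by
      simpa [associated_one_iff_isUnit] using he
    exact hπ.not_isUnit (isUnit_of_map_unit (algebraMap R (integralClosure R L)) _ hu)
  have hval : addVal (integralClosure R L) (algebraMap R _ π) = e := by
    rw [(addVal_eq_iff_associated _ _).2 he, addVal_pow, addVal_uniformizer hϖ]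
    simp
  have hfrac : IsFractionRing (integralClosure R L) L :=
    integralClosure.isFractionRing_of_finite_extension K L
  have hid := Ideal.ramificationIdx_mul_inertiaDeg_of_isLocalRing (S := integralClosure R L) K L
    (IsDiscreteValuationRing.not_a_field R)
  have hram : Ideal.ramificationIdx' (maximalIdeal R) (maximalIdeal (integralClosure R L)) = e := by
    refine Ideal.ramificationIdx'_spec hJ.le ?_
    rw [hJ, hϖ.maximalIdeal_eq, Ideal.span_singleton_pow, Ideal.span_singleton_pow,
      Ideal.span_singleton_le_span_singleton, pow_dvd_pow_iff hϖ.ne_zero hϖ.not_isUnit]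
    omega
  rw [hram] at hid
  refine ⟨e, _, he0, hid, fun r => ?_, hJ, fun hf a => ?_⟩
  · rcases eq_or_ne r 0 with rfl | hr
    · simp [he0]
    · obtain ⟨k, u, rfl⟩ := eq_unit_mul_pow_irreducible hr hπ
      rw [map_mul, map_pow, addVal_mul, addVal_mul, addVal_pow, addVal_pow, hval,
        addVal_uniformizer hπ, addVal_eq_zero_iff.2 u.isUnit,
        addVal_eq_zero_iff.2 (u.isUnit.map _)]
      simp [mul_comm]
  · have hlo : (maximalIdeal (integralClosure R L)).LiesOver (maximalIdeal R) := inferInstance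
    rw [Ideal.inertiaDeg'_algebraMap] at hf
    exact exists_sub_algebraMap_mem_of_finrank_eq_one hf a

end FiniteExtension

/-! ### Points over the algebraic closure -/

section Convergence

variable {R : Type*} [CommRing R] {B : Type*} [CommRing B] [Algebra R B]

lemma ConvergesTo.map {A : Type*} [CommRing A] [Algebra R A] (ι : A →ₐ[R] B) {s : ℕ → A} {y : A}
    (h : ConvergesTo R s y) : ConvergesTo R (fun N => ι (s N)) (ι y) := by
  intro r hr
  filter_upwards [h r hr] with N hN
  simpa using map_dvd ι hN

lemma ConvergesTo.unique (hB : ∀ y : B, (∀ r : R, r ≠ 0 → algebraMap R B r ∣ y) → y = 0)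
    {s : ℕ → B} {y z : B} (h : ConvergesTo R s y) (h' : ConvergesTo R s z) : y = z := by
  rw [← sub_eq_zero]
  refine hB _ fun r hr => ?_
  obtain ⟨N, h₁, h₂⟩ := ((h r hr).and (h' r hr)).exists
  simpa using dvd_sub h₂ h₁

lemma HasValue.map {A : Type*} [CommRing A] [Algebra R A] (ι : A →ₐ[R] B) {f : PowerSeries R}
    {x y : A} (h : HasValue f x y) : HasValue f (ι x) (ι y) := by
  simpa [HasValue] using ConvergesTo.map ι h

lemma HasFormalSum.map {A : Type*} [CommRing A] [Algebra R A] (ι : A →ₐ[R] B) {F : FormalGroup R}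
    {x y z : A} (h : HasFormalSum F x y z) : HasFormalSum F (ι x) (ι y) (ι z) := by
  simpa [HasFormalSum] using ConvergesTo.map ι h

variable {A : Type*} [CommRing A] [IsDomain A] [IsDiscreteValuationRing A] [Algebra R A]
  [IsAdicComplete (maximalIdeal A) A]

lemma hasValue_ev (hinj : Function.Injective (algebraMap R A)) (f : PowerSeries R) {a : A}
    (ha : a ∈ maximalIdeal A) : HasValue f a (ev f a) := by
  intro r hr
  obtain ⟨N, hN⟩ := exists_pow_le_span ((map_ne_zero_iff _ hinj).2 hr)
  obtain ⟨N₀, h⟩ := ev_approx ha f N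
  filter_upwards [eventually_ge_atTop N₀] with M hM
  exact Ideal.mem_span_singleton.1 (hN (h M hM))

lemma hasFormalSum_fadd (hinj : Function.Injective (algebraMap R A)) (F : FormalGroup R)
    {x y : A} (hx : x ∈ maximalIdeal A) (hy : y ∈ maximalIdeal A) :
    HasFormalSum F x y (fadd F x y) := by
  intro r hr
  obtain ⟨N, hN⟩ := exists_pow_le_span ((map_ne_zero_iff _ hinj).2 hr)
  obtain ⟨N₀, h⟩ := fadd_approx F hx hy N
  filter_upwards [eventually_ge_atTop N₀] with M hM
  exact Ideal.mem_span_singleton.1 (hN (h M hM))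

/-- Limits are unique in the separated ring `B`, so the relational multiples unwind to multiples in
the group of points. -/
lemma hasMultiple_iff (hinj : Function.Injective (algebraMap R A)) (ι : A →ₐ[R] B)
    (hB : ∀ y : B, (∀ r : R, r ≠ 0 → algebraMap R B r ∣ y) → y = 0) {F : FormalGroup R}
    (x : Points A F) (k : ℕ) (z : B) : HasMultiple F (ι x.1) k z ↔ z = ι (k • x).1 := by
  induction k generalizing z with
  | zero => simp [HasMultiple]
  | succ k ih =>
    simp only [HasMultiple, ih, exists_eq_left]
    have h : HasFormalSum F (ι (k • x).1) (ι x.1) (ι ((k + 1) • x).1) := by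
      rw [succ_nsmul, Points.val_add]
      exact (hasFormalSum_fadd hinj F (k • x).2 x.2).map ι
    exact ⟨fun h' => ConvergesTo.unique hB h' h, fun h' => h' ▸ h⟩

end Convergence

/-! ### Nonvanishing of composites modulo the maximal ideal -/

section Reduction

/-- Writing `f = Xᵈ u` with `u(0) ≠ 0`, the substitution is `gᵈ u(g)`, and `u(g)` keeps the constant
term of `u`. -/
lemma subst_ne_zero {k : Type*} [Field k] {f g : PowerSeries k} (hf : f ≠ 0) (hg : g ≠ 0)
    (hg0 : PowerSeries.constantCoeff g = 0) : PowerSeries.subst g f ≠ 0 := by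
  have hs := PowerSeries.HasSubst.of_constantCoeff_zero' hg0
  obtain ⟨u, hu⟩ := PowerSeries.X_pow_order_dvd (φ := f)
  have hu0 : PowerSeries.constantCoeff u ≠ 0 := by
    have h := PowerSeries.coeff_order hf
    generalize f.order.toNat = d at h hu
    rwa [hu, PowerSeries.coeff_X_pow_mul', if_pos le_rfl, Nat.sub_self,
      PowerSeries.coeff_zero_eq_constantCoeff] at h
  obtain ⟨v, hv⟩ : PowerSeries.X ∣ u - PowerSeries.C (PowerSeries.constantCoeff u) := by
    rw [PowerSeries.X_dvd_iff]; simp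
  have h1 : PowerSeries.constantCoeff (PowerSeries.subst g u) = PowerSeries.constantCoeff u := by
    have hC : PowerSeries.subst g (PowerSeries.C (PowerSeries.constantCoeff u)) =
        PowerSeries.C (PowerSeries.constantCoeff u) := PowerSeries.subst_C _
    have h := congrArg (fun q => PowerSeries.constantCoeff (PowerSeries.subst g q))
      (sub_eq_iff_eq_add.1 hv)
    simp only [PowerSeries.subst_add hs, PowerSeries.subst_mul hs, PowerSeries.subst_X hs, hC] at h
    rw [h]
    simp [hg0]
  rw [hu, PowerSeries.subst_mul hs, PowerSeries.subst_pow hs, PowerSeries.subst_X hs]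
  refine mul_ne_zero (pow_ne_zero _ hg) fun h => hu0 ?_
  rw [← h1, h, map_zero]

variable {R : Type*} [CommRing R] [IsLocalRing R]

lemma map_residue_subst_ne_zero {f g : PowerSeries R} (hf : f.map (residue R) ≠ 0)
    (hg : g.map (residue R) ≠ 0) (hg0 : PowerSeries.constantCoeff g = 0) :
    (PowerSeries.subst g f).map (residue R) ≠ 0 := by
  have hs := PowerSeries.HasSubst.of_constantCoeff_zero' hg0
  have h : (PowerSeries.subst g f).map (residue R) =
    PowerSeries.subst (g.map (residue R)) (f.map (residue R)) := PowerSeries.map_subst hs f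
  rw [h]
  refine subst_ne_zero hf hg ?_
  rw [← PowerSeries.coeff_zero_eq_constantCoeff_apply, PowerSeries.coeff_map,
    PowerSeries.coeff_zero_eq_constantCoeff_apply, hg0, map_zero]

lemma map_residue_comp_ne_zero {φs : ℕ → PowerSeries R} {n : ℕ}
    (hc : ∀ i < n, PowerSeries.constantCoeff (φs (i + 1)) = 0)
    (hr : ∀ i < n, (φs (i + 1)).map (residue R) ≠ 0) {i k : ℕ} (h : i + k ≤ n) :
    (comp φs i k).map (residue R) ≠ 0 := by
  induction k with
  | zero => simp [comp, PowerSeries.X_ne_zero]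
  | succ k ih =>
    exact map_residue_subst_ne_zero (ih (by omega)) (hr _ (by omega)) (hc _ (by omega))

lemma constantCoeff_comp {φs : ℕ → PowerSeries R} {n : ℕ}
    (hc : ∀ i < n, PowerSeries.constantCoeff (φs (i + 1)) = 0) {i k : ℕ} (h : i + k ≤ n) :
    PowerSeries.constantCoeff (comp φs i k) = 0 := by
  induction k with
  | zero => simp [comp]
  | succ k ih =>
    exact PowerSeries.constantCoeff_subst_eq_zero (hc _ (by omega)) _ (ih (by omega))

end Reduction

/-! ### Descent from the algebraic closure to finite extensions -/

section AlgebraicClosure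

variable {R : Type*} [CommRing R] [IsDomain R] [IsDiscreteValuationRing R]
  [IsAdicComplete (maximalIdeal R) R]
  {K : Type*} [Field K] [Algebra R K] [IsFractionRing R K]
  {Kbar : Type*} [Field Kbar] [Algebra K Kbar] [Algebra R Kbar] [IsScalarTower R K Kbar]

/-- The inclusion of the integral closure in an intermediate field. -/
def integralInclusion (R : Type*) [CommRing R] {K : Type*} [Field K] [Algebra R K]
    {Kbar : Type*} [Field Kbar] [Algebra K Kbar] [Algebra R Kbar] [IsScalarTower R K Kbar]
    (L : IntermediateField K Kbar) :
    integralClosure R L →ₐ[R] integralClosure R Kbar :=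
  (L.val.restrictScalars R).mapIntegralClosure

lemma coe_integralInclusion (L : IntermediateField K Kbar) (a : integralClosure R L) :
    ((integralInclusion R L a : integralClosure R Kbar) : Kbar) = ((a : L) : Kbar) := rfl

lemma integralInclusion_injective (L : IntermediateField K Kbar) :
    Function.Injective (integralInclusion R L) := fun _ _ h =>
  Subtype.ext (Subtype.ext (congrArg (fun z : integralClosure R Kbar => (z : Kbar)) h))

lemma exists_integralInclusion_eq (L : IntermediateField K Kbar) {x : integralClosure R Kbar}
    (hx : (x : Kbar) ∈ L) : ∃ a, integralInclusion R L a = x := by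
  refine ⟨⟨⟨x, hx⟩, ?_⟩, rfl⟩
  exact (isIntegral_algHom_iff (L.val.restrictScalars R) L.val.injective).1 x.2

lemma mem_maximalIdeal_of_mem_jacobson (L : IntermediateField K Kbar)
    [IsLocalRing (integralClosure R L)] {a : integralClosure R L}
    (h : integralInclusion R L a ∈ Ring.jacobson (integralClosure R Kbar)) :
    a ∈ maximalIdeal (integralClosure R L) := by
  rw [mem_maximalIdeal]
  intro hu
  have hu' : IsUnit (integralInclusion R L a) := hu.map _
  obtain ⟨M, hM⟩ := Ideal.exists_maximal (integralClosure R Kbar)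
  exact hM.ne_top (Ideal.eq_top_of_isUnit_mem _ (Ring.jacobson_le_of_isMaximal M h) hu')

/-- Every maximal ideal of an integral extension lies over the maximal ideal of `R`. -/
lemma mem_jacobson_of_pow_mem {z : integralClosure R Kbar} {k : ℕ}
    (h : z ^ k ∈ (maximalIdeal R).map (algebraMap R (integralClosure R Kbar))) :
    z ∈ Ring.jacobson (integralClosure R Kbar) := by
  rw [Ring.jacobson_eq_sInf_isMaximal, Ideal.mem_sInf]
  intro M hM
  have hM' : M.IsMaximal := hM
  have h1 : M.comap (algebraMap R (integralClosure R Kbar)) = maximalIdeal R :=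
    IsLocalRing.eq_maximalIdeal (Ideal.isMaximal_comap_of_isIntegral_of_isMaximal M)
  exact hM'.isPrime.mem_of_pow_mem k (Ideal.map_le_iff_le_comap.2 h1.ge h)

lemma algebraMap_mem_jacobson_iff {r : R} :
    algebraMap R (integralClosure R Kbar) r ∈ Ring.jacobson (integralClosure R Kbar) ↔
      r ∈ maximalIdeal R := by
  constructor
  · intro h
    rw [mem_maximalIdeal]
    intro hu
    obtain ⟨M, hM⟩ := Ideal.exists_maximal (integralClosure R Kbar)
    exact hM.ne_top (Ideal.eq_top_of_isUnit_mem _ (Ring.jacobson_le_of_isMaximal M h) (hu.map _))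
  · intro h
    exact mem_jacobson_of_pow_mem (k := 1) (by rw [pow_one]; exact Ideal.mem_map_of_mem _ h)

open IsDiscreteValuationRing hiding maximalIdeal

variable [CharZero K] [IsAlgClosure K Kbar]

-- In the discrete valuation ring of `K(y)` a nonzero `y` has finite valuation, and quotients of `y`
-- by elements of `R` remain in `K(y)`; divisibility by high powers of a uniformizer is thus
-- impossible.
variable (R K Kbar) in
include K in
lemma integralClosure_separated (y : integralClosure R Kbar)
    (hy : ∀ r : R, r ≠ 0 → algebraMap R _ r ∣ y) : y = 0 := by
  have halg : Algebra.IsAlgebraic K Kbar := IsAlgClosure.isAlgebraic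
  let L := IntermediateField.adjoin K {(y : Kbar)}
  have : FiniteDimensional K L :=
    IntermediateField.adjoin.finiteDimensional (Algebra.IsIntegral.isIntegral _)
  obtain ⟨hdvr, -⟩ := isDiscreteValuationRing_integralClosure R K L
  have := faithfulSMul_of_tower R K L
  have hinj := integralClosure_algebraMap_injective R L
  obtain ⟨a, hay⟩ := exists_integralInclusion_eq (R := R) (x := y) L
    (IntermediateField.mem_adjoin_simple_self K _)
  by_contra hne
  have ha : a ≠ 0 := fun h => hne (by rw [← hay, h, map_zero])
  obtain ⟨N, hN⟩ := exists_nat_addVal ha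
  obtain ⟨e, f, he0, -, he, -⟩ := exists_ramification R K L
  obtain ⟨π, hπ⟩ := exists_irreducible R
  obtain ⟨z, hz⟩ := hy (π ^ (N + 1)) (pow_ne_zero _ hπ.ne_zero)
  have hr0 : algebraMap R L (π ^ (N + 1)) ≠ 0 := by
    rw [Ne, FaithfulSMul.algebraMap_eq_zero_iff]; exact pow_ne_zero _ hπ.ne_zero
  have hzL : (z : Kbar) ∈ L := by
    have h1 : ((a : L) : Kbar) = ((algebraMap R L (π ^ (N + 1)) : L) : Kbar) * z :=
      congrArg (fun w : integralClosure R Kbar => (w : Kbar)) (hay.trans hz)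
    have h2 : (z : Kbar) = (((a : L) / algebraMap R L (π ^ (N + 1)) : L) : Kbar) := by
      rw [IntermediateField.coe_div, eq_div_iff (fun h => hr0 (Subtype.ext h)), mul_comm]
      exact h1.symm
    rw [h2]
    exact SetLike.coe_mem _
  obtain ⟨b, rfl⟩ := exists_integralInclusion_eq L hzL
  have h3 : a = algebraMap R _ (π ^ (N + 1)) * b := by
    apply integralInclusion_injective L
    rw [hay, hz, map_mul, AlgHom.commutes]
  have h4 : addVal (integralClosure R L) a = e * (N + 1 : ℕ) + addVal _ b := by
    rw [h3, addVal_mul, he, addVal_pow, addVal_uniformizer hπ]; simp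
  rw [hN] at h4
  have h5 : ((N + 1 : ℕ) : ℕ∞) ≤ N := by
    rw [h4]
    refine le_trans ?_ le_self_add
    exact_mod_cast Nat.le_mul_of_pos_left _ (Nat.pos_of_ne_zero he0)
  have h6 : N + 1 ≤ N := by exact_mod_cast h5
  omega

variable (K Kbar) in
/-- A power series of positive Weierstrass degree has a zero over a finite extension. -/
lemma exists_ev_eq_zero {Q : PowerSeries R}
    (hQ : Q.map (residue R) ≠ 0) (hQ0 : PowerSeries.constantCoeff Q ∈ maximalIdeal R) :
    ∃ (L : IntermediateField K Kbar) (_ : FiniteDimensional K L)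
      (_ : IsDiscreteValuationRing (integralClosure R L))
      (_ : IsAdicComplete (maximalIdeal (integralClosure R L)) (integralClosure R L))
      (a : integralClosure R L), a ∈ maximalIdeal (integralClosure R L) ∧ ev Q a = 0 := by
  set d := (Q.map (residue R)).order.toNat
  have hd : PowerSeries.coeff d Q ∉ maximalIdeal R := fun h =>
    PowerSeries.coeff_order hQ (by rw [PowerSeries.coeff_map, residue_eq_zero_iff]; exact h)
  have hlt : ∀ i < d, PowerSeries.coeff i Q ∈ maximalIdeal R := fun i hi => by
    rw [← residue_eq_zero_iff, ← PowerSeries.coeff_map]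
    exact PowerSeries.coeff_of_lt_order_toNat _ hi
  have hd0 : d ≠ 0 := by
    intro h
    rw [h, PowerSeries.coeff_zero_eq_constantCoeff_apply] at hd
    exact hd hQ0
  obtain ⟨f, h, hf, hdeg, hfm, hu, hfh⟩ := exists_weierstrass hd hlt
  have halg : Algebra.IsAlgebraic K Kbar := IsAlgClosure.isAlgebraic
  have hclosed : IsAlgClosed Kbar := IsAlgClosure.isAlgClosed K
  obtain ⟨w, hw⟩ := IsAlgClosed.exists_root (f.map (algebraMap R Kbar)) (by
    rw [hf.degree_map, Polynomial.degree_eq_natDegree hf.ne_zero, hdeg]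
    exact_mod_cast hd0)
  have hw' : Polynomial.aeval w f = 0 := by
    rwa [Polynomial.IsRoot, Polynomial.eval_map_algebraMap] at hw
  let L := IntermediateField.adjoin K {w}
  have hfin : FiniteDimensional K L :=
    IntermediateField.adjoin.finiteDimensional (Algebra.IsIntegral.isIntegral _)
  obtain ⟨hdvr, hcomp⟩ := isDiscreteValuationRing_integralClosure R K L
  obtain ⟨e, -, he0, -, he, -⟩ := exists_ramification R K L
  let x : integralClosure R Kbar := ⟨w, f, hf, hw'⟩
  obtain ⟨a, ha⟩ := exists_integralInclusion_eq (R := R) (x := x) L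
    (IntermediateField.mem_adjoin_simple_self K _)
  have hfa : Polynomial.aeval a f = 0 := by
    apply integralInclusion_injective L
    rw [← Polynomial.aeval_algHom_apply, ha, map_zero]
    apply Subtype.ext
    rw [← Subalgebra.coe_val, ← Polynomial.aeval_algHom_apply]
    exact hw'
  -- The polynomial is distinguished, so `aᵈ` is a combination of powers of `a` with coefficients in
  -- `𝔪_R`.
  have ham : a ∈ maximalIdeal (integralClosure R L) := by
    refine (maximalIdeal.isMaximal _).isPrime.mem_of_pow_mem d ?_
    rw [Polynomial.aeval_eq_sum_range, hdeg, Finset.sum_range_succ, ← hdeg,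
      hf.coeff_natDegree, one_smul, hdeg] at hfa
    rw [eq_neg_of_add_eq_zero_right hfa]
    refine neg_mem (Ideal.sum_mem _ fun i hi => ?_)
    rw [Algebra.smul_def]
    exact Ideal.mul_mem_right _ _ (algebraMap_mem_maximalIdeal he0 he
      (hfm i (Finset.mem_range.1 hi)))
  refine ⟨L, hfin, hdvr, hcomp, a, ham, ?_⟩
  rw [hfh, ev_mul ham, ev_coe ham, hfa, zero_mul]

variable {p n : ℕ} {F G : FormalGroup R} {φ : PowerSeries R}
  {Gs : ℕ → FormalGroup R} {φs : ℕ → PowerSeries R}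

-- The delicate point is that `[pʲ] x₀` is not killed by `φ_{j+2} ∘ ⋯ ∘ φₙ`. Otherwise neither is
-- any other point of the kernel of `φ_{j+1} ∘ ⋯ ∘ φₙ` kept alive, all of them being multiples of
-- `[pʲ] x₀`. But with `φ_{j+1} = T q`, the series `q ∘ φ_{j+2} ∘ ⋯ ∘ φₙ` has nonunit constant term
-- and nonzero reduction, hence a zero over a finite extension, and this zero maps to a nonzero
-- point of the kernel of `φ_{j+1}`.
include K in
lemma IsFactorization.exists_isKernelGenerator (hp : p.Prime) (hpm : (p : R) ∈ maximalIdeal R)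
    (hker : HasRationalCyclicKernel (integralClosure R Kbar) (Gs n) φ)
    (hfac : IsFactorization (integralClosure R Kbar) p n (Gs n) G φ Gs φs) :
    ∃ x₀ : Points R (Gs n), IsKernelGenerator p n Gs φs x₀ := by
  set O := integralClosure R Kbar
  have hO := integralClosure_separated R K Kbar
  have hRinj : Function.Injective (algebraMap R R) := Function.injective_id
  have hRK : FaithfulSMul R Kbar := by
    rw [faithfulSMul_iff_algebraMap_injective, IsScalarTower.algebraMap_eq R K Kbar]
    exact (algebraMap K Kbar).injective.comp (IsFractionRing.injective R K)
  have hOinj : Function.Injective (algebraMap R O) := integralClosure_algebraMap_injective R Kbar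
  have hp0 : (p : R) ≠ 0 := by
    intro h
    have : algebraMap R K p = 0 := by rw [h, map_zero]
    rw [map_natCast] at this
    exact hp.ne_zero (by exact_mod_cast this)
  have hisog : ∀ i < n, IsIsogeny p 1 (Gs (i + 1)) (Gs i) (φs (i + 1)) := fun i hi =>
    hfac.isIsogeny (i + 1) (by omega) hi
  have hc : ∀ i < n, PowerSeries.constantCoeff (φs (i + 1)) = 0 :=
    fun i hi => (hisog i hi).isHom.constantCoeff_eq_zero
  have hcoeff : ∀ i < n, _ := fun i hi => (hisog i hi).hasHeight.coeff_mem hp (hc i hi)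
  have hr : ∀ i < n, (φs (i + 1)).map (residue R) ≠ 0 := fun i hi h => by
    refine (hcoeff i hi).1 ?_
    rw [← residue_eq_zero_iff, ← PowerSeries.coeff_map, h, map_zero]
  obtain ⟨x₁, hx₁, hgen⟩ := hker.cyclic
  obtain ⟨r₀, rfl⟩ := hker.rational x₁ hx₁
  let x₀ : Points R (Gs n) := ⟨r₀, algebraMap_mem_jacobson_iff.1 hx₁.1⟩
  have hmul := hasMultiple_iff hRinj (Algebra.ofId R O) hO (F := Gs n)
  have hzero : ∀ j ≤ n, chain φs n j (p ^ j • x₀).1 = 0 := by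
    intro j hj
    have h1 : algebraMap R O (p ^ j • x₀).1 ∈ kernel O (comp φs j (n - j)) := by
      rw [hfac.kernel_comp j hj]
      exact ⟨_, hx₁, (hmul x₀ _ _).2 rfl⟩
    have h2 := (hasValue_ev hRinj (comp φs j (n - j)) (p ^ j • x₀).2).map (Algebra.ofId R O)
    have h3 := ConvergesTo.unique hO h2 h1.2
    exact hOinj (h3.trans (map_zero _).symm)
  refine ⟨x₀, hisog, ?_, fun j hj hj0 => ?_, fun j hj => hzero j hj.le⟩
  · have := hzero n le_rfl
    rw [chain_self] at this
    exact Points.val_eq_zero.1 this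
  · obtain ⟨q, hq⟩ : PowerSeries.X ∣ φs (j + 1) := by
      rw [PowerSeries.X_dvd_iff, hc j hj]
    have hq0 : PowerSeries.constantCoeff q = PowerSeries.coeff 1 (φs (j + 1)) := by
      rw [hq, ← zero_add 1, PowerSeries.coeff_succ_X_mul,
        PowerSeries.coeff_zero_eq_constantCoeff_apply]
    have hqr : q.map (residue R) ≠ 0 := fun h => hr j hj (by rw [hq, map_mul, h, mul_zero])
    have hΨ : PowerSeries.constantCoeff (comp φs (j + 1) (n - (j + 1))) = 0 :=
      constantCoeff_comp hc (by omega)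
    have hQ := map_residue_subst_ne_zero hqr
      (map_residue_comp_ne_zero hc hr (i := j + 1) (k := n - (j + 1)) (by omega)) hΨ
    have h1ne : PowerSeries.coeff 1 (φs (j + 1)) ≠ 0 :=
      (hisog j hj).isHom.coeff_one_ne_zero (fun h => hr j hj (by rw [h, map_zero])) hpm hp0
    have hQ0 : PowerSeries.constantCoeff
        (PowerSeries.subst (comp φs (j + 1) (n - (j + 1))) q) ∈ maximalIdeal R := by
      have h0 : (0 : R) ∈ maximalIdeal R := zero_mem _
      obtain ⟨b, hb⟩ := ev_eq_add_mul h0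
        (PowerSeries.subst (comp φs (j + 1) (n - (j + 1))) q)
      rw [ev_subst h0 hΨ] at hb
      obtain ⟨b', hb'⟩ := ev_eq_add_mul h0 (comp φs (j + 1) (n - (j + 1)))
      rw [hΨ, map_zero, zero_mul, zero_add] at hb'
      obtain ⟨b'', hb''⟩ := ev_eq_add_mul h0 q
      rw [hb', hb'', zero_mul, zero_mul, add_zero, add_zero] at hb
      have h2 : PowerSeries.coeff 1 (φs (j + 1)) =
        PowerSeries.constantCoeff (PowerSeries.subst (comp φs (j + 1) (n - (j + 1))) q) :=
          hq0 ▸ hb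
      rw [← h2]
      exact (hcoeff j hj).2 1 (by rw [pow_one]; exact hp.one_lt)
    obtain ⟨L, hfin, hdvr, hcomp, a, ha, hQa⟩ := exists_ev_eq_zero K Kbar hQ hQ0
    have := faithfulSMul_of_tower R K L
    have hAinj := integralClosure_algebraMap_injective R L
    obtain ⟨e, -, he0, -, he, -⟩ := exists_ramification R K L
    rw [ev_subst ha hΨ] at hQa
    change ev q (chain φs n (j + 1) a) = 0 at hQa
    have hbm : chain φs n (j + 1) a ∈ maximalIdeal (integralClosure R L) :=
      chain_mem hc hj ha
    -- Since `q(0)` is the nonzero linear coefficient of `φ_{j+1}`, a zero of `q` cannot be `0`.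
    have hb0 : chain φs n (j + 1) a ≠ 0 := by
      intro h
      obtain ⟨b, hb⟩ := ev_eq_add_mul hbm q
      rw [hQa, h, zero_mul, add_zero, hq0] at hb
      exact h1ne (hAinj (hb.symm.trans (map_zero _).symm))
    have ha0 : chain φs n j a = 0 := by
      have h2 := congrArg (fun g => ev g (chain φs n (j + 1) a)) hq
      simp only [ev_mul hbm, hQa, mul_zero] at h2
      rw [chain_eq_ev_chain_succ hc hj ha, h2]
    have hak : integralInclusion R L a ∈ kernel O (comp φs j (n - j)) := by
      refine ⟨?_, ?_⟩
      -- With `e` the ramification index, `aᵉ` is divisible by a uniformizer of `R`.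
      · refine mem_jacobson_of_pow_mem (k := e) ?_
        have h3 : a ^ e ∈ (maximalIdeal R).map (algebraMap R (integralClosure R L)) := by
          obtain ⟨π, hπ⟩ := exists_irreducible R
          rw [hπ.maximalIdeal_eq, Ideal.map_span, Set.image_singleton, Ideal.mem_span_singleton,
            ← addVal_le_iff_dvd, he, addVal_uniformizer hπ, addVal_pow, mul_one]
          have := one_le_addVal_iff.2 ha
          calc (e : ℕ∞) = e • 1 := by simp
            _ ≤ _ := nsmul_le_nsmul_right this e
        have h4 := Ideal.mem_map_of_mem (integralInclusion R L : integralClosure R L →+* O) h3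
        rw [Ideal.map_map] at h4
        have h5 : (integralInclusion R L : integralClosure R L →+* O).comp
          (algebraMap R (integralClosure R L)) = algebraMap R O :=
            (integralInclusion R L).comp_algebraMap
        rw [h5] at h4
        simpa using h4
      · have h3 := (hasValue_ev hAinj (comp φs j (n - j)) ha).map (integralInclusion R L)
        have h4 : ev (comp φs j (n - j)) a = 0 := ha0
        rwa [h4, map_zero] at h3
    rw [hfac.kernel_comp j hj.le] at hak
    obtain ⟨w, hw, hwm⟩ := hak
    obtain ⟨k, hk⟩ := hgen w hw
    rw [show algebraMap R O r₀ = Algebra.ofId R O x₀.1 from rfl, hmul] at hk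
    rw [hk, hmul] at hwm
    have hθ : ∀ x ∈ maximalIdeal R, Algebra.ofId R (integralClosure R L) x ∈
      maximalIdeal (integralClosure R L) := fun x hx => algebraMap_mem_maximalIdeal he0 he hx
    have h6 : a = algebraMap R _ (p ^ j • k • x₀).1 := by
      apply integralInclusion_injective L
      rw [hwm, AlgHom.commutes]
      rfl
    refine hb0 ?_
    have h7 : chain φs n (j + 1) (Algebra.ofId R (integralClosure R L) (p ^ j • k • x₀).1) =
        Algebra.ofId R (integralClosure R L) (chain φs n (j + 1) (p ^ j • k • x₀).1) :=
      (ev_comp_algHom _ hθ (p ^ j • k • x₀).2 _).symm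
    rw [h6]
    refine h7.trans ?_
    obtain ⟨g, hg⟩ := exists_chainHom (A := R) (fun i hi => (hisog i hi).isHom) (i := j + 1) hj
    have h8 : g (p ^ j • x₀) = 0 := Points.ext ((hg _).trans hj0)
    rw [← hg, nsmul_left_comm, map_nsmul, h8, nsmul_zero, Points.val_zero, map_zero]

end AlgebraicClosure

/-! ### Ramification filtrations -/

section RamificationNumber

open IsDiscreteValuationRing hiding maximalIdeal

variable {R : Type*} [CommRing R] {A : Type*} [CommRing A] [IsDomain A]
  [IsDiscreteValuationRing A] [Algebra R A]

lemma natCast_add_left_cancel {a : ℕ} {b c : ℕ∞} (h : a + b = a + c) : b = c :=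
  WithTop.add_left_cancel (ENat.natCast_ne_top a) h

lemma AlgHom.map_pow_maximalIdeal {τ : A →ₐ[R] A}
    (hτ : ∀ x ∈ maximalIdeal A, τ x ∈ maximalIdeal A) {k : ℕ} {x : A}
    (hx : x ∈ maximalIdeal A ^ k) : τ x ∈ maximalIdeal A ^ k := by
  have : (maximalIdeal A ^ k).map τ ≤ maximalIdeal A ^ k := by
    rw [Ideal.map_pow]
    exact Ideal.pow_right_mono (Ideal.map_le_iff_le_comap.2 hτ) k
  exact this (Ideal.mem_map_of_mem _ hx)

/-- If the residue field does not grow, an endomorphism acts trivially modulo a power of the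
maximal ideal as soon as it fixes a uniformizer modulo this power. -/
lemma sub_mem_pow_of_uniformizer (hres : ∀ a : A, ∃ r : R, a - algebraMap R A r ∈ maximalIdeal A)
    {ϖ : A} (hϖ : Irreducible ϖ) {τ : A →ₐ[R] A}
    (hτ : ∀ x ∈ maximalIdeal A, τ x ∈ maximalIdeal A) {N : ℕ}
    (h : τ ϖ - ϖ ∈ maximalIdeal A ^ N) (a : A) : τ a - a ∈ maximalIdeal A ^ N := by
  have key : ∀ k, ∃ q : Polynomial R, a - Polynomial.aeval ϖ q ∈ maximalIdeal A ^ k := by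
    intro k
    induction k with
    | zero => exact ⟨0, by simp⟩
    | succ k ih =>
      obtain ⟨q, hq⟩ := ih
      rw [hϖ.maximalIdeal_eq, Ideal.span_singleton_pow, Ideal.mem_span_singleton] at hq
      obtain ⟨b, hb⟩ := hq
      obtain ⟨r, hr⟩ := hres b
      refine ⟨q + Polynomial.C r * Polynomial.X ^ k, ?_⟩
      have : a - Polynomial.aeval ϖ (q + Polynomial.C r * Polynomial.X ^ k) =
          ϖ ^ k * (b - algebraMap R A r) := by
        simp only [map_add, map_mul, map_pow, Polynomial.aeval_C, Polynomial.aeval_X]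
        linear_combination hb
      rw [this, pow_succ]
      refine Ideal.mul_mem_mul (Ideal.pow_mem_pow ?_ k) hr
      rw [hϖ.maximalIdeal_eq]
      exact Ideal.mem_span_singleton_self _
  obtain ⟨q, hq⟩ := key N
  have h1 := AlgHom.map_pow_maximalIdeal hτ hq
  have h2 : Polynomial.aeval (τ ϖ) q - Polynomial.aeval ϖ q ∈ maximalIdeal A ^ N := by
    have := Polynomial.sub_dvd_eval_sub (τ ϖ) ϖ (q.map (algebraMap R A))
    rw [Polynomial.eval_map_algebraMap, Polynomial.eval_map_algebraMap] at this
    exact Ideal.mem_of_dvd _ this h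
  rw [map_sub, ← Polynomial.aeval_algHom_apply] at h1
  have := add_mem (sub_mem h1 hq) h2
  rwa [show τ a - Polynomial.aeval (τ ϖ) q - (a - Polynomial.aeval ϖ q) +
    (Polynomial.aeval (τ ϖ) q - Polynomial.aeval ϖ q) = τ a - a by ring] at this

/-- An element of valuation prime to `p` in a totally wildly ramified extension detects the
ramification numbers. -/
lemma exists_uniformizer_addVal_sub {p n m d : ℕ} (hp : p.Prime) (hn : n ≠ 0)
    (hpA : (p : A) ∈ maximalIdeal A) {π : R} (hπ : addVal A (algebraMap R A π) = (p ^ n : ℕ))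
    {x : A} (hx : addVal A x = m) (hpm : ¬ p ∣ m) {τ : A →ₐ[R] A}
    (hd : addVal A (τ x - x) = d) (hmd : m < d) :
    ∃ ϖ, Irreducible ϖ ∧ addVal A (τ ϖ - ϖ) = (d - m + 1 : ℕ) := by
  have hcop : Nat.Coprime m (p ^ n) := (((Nat.Prime.coprime_iff_not_dvd hp).2 hpm).symm).pow_right n
  have hpn1 : 1 < p ^ n := Nat.one_lt_pow hn hp.one_lt
  -- From `m α = β pⁿ + 1` the quotient `ϖ = x^α / π^β` has valuation one.
  obtain ⟨α, -, hα⟩ := Nat.exists_mul_mod_eq_one_of_coprime hcop hpn1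
  set β := m * α / p ^ n
  have hαβ : m * α = β * p ^ n + 1 := by
    have := Nat.div_add_mod (m * α) (p ^ n)
    rw [hα] at this
    rw [← this, mul_comm]
  have hαp : p.Coprime α := by
    rw [Nat.Prime.coprime_iff_not_dvd hp]
    intro h
    have h1 : p ∣ β * p ^ n := Dvd.dvd.mul_left (dvd_pow_self p hn) β
    have h2 : p ∣ β * p ^ n + 1 := hαβ ▸ Dvd.dvd.mul_left h m
    exact hp.one_lt.ne' (Nat.dvd_one.1 ((Nat.dvd_add_right h1).1 h2))
  have hαu : IsUnit (α : A) := Points.isUnit_natCast_of_coprime hpA hαp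
  have hvx : addVal A (x ^ α) = (β * p ^ n + 1 : ℕ) := by
    rw [addVal_pow, hx, ← hαβ, mul_comm m α]; simp
  have hvπ : addVal A (algebraMap R A π ^ β) = (β * p ^ n : ℕ) := by
    rw [addVal_pow, hπ]; simp
  obtain ⟨ϖ, hϖ⟩ : algebraMap R A π ^ β ∣ x ^ α := by
    rw [← addVal_le_iff_dvd, hvx, hvπ]; exact_mod_cast Nat.le_succ _
  have hπ0 : algebraMap R A π ^ β ≠ 0 := by
    intro h
    rw [h, addVal_zero] at hvπ
    exact ENat.top_ne_natCast _ hvπ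
  have hϖ1 : addVal A ϖ = 1 := by
    rw [hϖ, addVal_mul, hvπ, Nat.cast_add] at hvx
    exact_mod_cast natCast_add_left_cancel hvx
  have hirr : Irreducible ϖ := by
    obtain ⟨ϖ', hϖ'⟩ := exists_irreducible A
    have : Associated ϖ ϖ' := by
      rw [← addVal_eq_iff_associated, hϖ1, addVal_uniformizer hϖ']
    exact this.symm.irreducible hϖ'
  refine ⟨ϖ, hirr, ?_⟩
  obtain ⟨ε, hε⟩ : x ∣ τ x - x := by
    rw [← addVal_le_iff_dvd, hx, hd]; exact_mod_cast hmd.le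
  have hvε : addVal A ε = (d - m : ℕ) := by
    rw [hε, addVal_mul, hx, show d = m + (d - m) by omega, Nat.cast_add] at hd
    rw [natCast_add_left_cancel hd]
  have hεm : ε ∈ maximalIdeal A := by
    rw [← one_le_addVal_iff, hvε]; exact_mod_cast (by omega : 1 ≤ d - m)
  -- With `τ x = x (1 + ε)`, the ratio `τ ϖ / ϖ` is `(1 + ε)^α`; as `α` is prime to `p`, it differs
  -- from `1` by `ε` times a unit.
  obtain ⟨c, hc⟩ : ∃ c, (1 + ε) ^ α = 1 + ε * (α + ε * c) := by
    obtain ⟨c, hc⟩ := Polynomial.binomExpansion (Polynomial.X ^ α : Polynomial A) 1 ε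
    refine ⟨c, ?_⟩
    simp only [Polynomial.eval_pow, Polynomial.eval_X, one_pow, Polynomial.derivative_X_pow,
      Polynomial.eval_mul, Polynomial.eval_C, mul_one] at hc
    rw [hc]; ring
  have hu : IsUnit ((α : A) + ε * c) := by
    by_contra h
    have h3 := sub_mem ((mem_maximalIdeal _).2 h) (Ideal.mul_mem_right c _ hεm)
    rw [add_sub_cancel_right] at h3
    exact (mem_maximalIdeal _).1 h3 hαu
  have hτϖ : τ ϖ - ϖ = ϖ * (ε * (α + ε * c)) := by
    apply mul_left_cancel₀ hπ0
    have h1 : algebraMap R A π ^ β * τ ϖ = τ x ^ α := by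
      rw [← map_pow τ, hϖ, map_mul, map_pow, AlgHom.commutes]
    have h2 : τ x = x * (1 + ε) := by linear_combination hε
    rw [mul_sub, h1, h2, mul_pow, hc, ← hϖ, ← mul_assoc, ← hϖ]
    ring
  rw [hτϖ, addVal_mul, addVal_mul, hϖ1, hvε, addVal_eq_zero_iff.2 hu, add_zero, add_comm]
  norm_cast

/-- The uniformizer built from `x` both tests the congruence and, by residual triviality of the
extension, controls it for all elements. -/
lemma forall_sub_mem_pow_iff {p n m d : ℕ} (hp : p.Prime) (hn : n ≠ 0)
    (hres : ∀ a : A, ∃ r : R, a - algebraMap R A r ∈ maximalIdeal A)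
    (hpA : (p : A) ∈ maximalIdeal A) {π : R} (hπ : addVal A (algebraMap R A π) = (p ^ n : ℕ))
    {x : A} (hx : addVal A x = m) (hpm : ¬ p ∣ m) {τ : A →ₐ[R] A}
    (hτ : ∀ x ∈ maximalIdeal A, τ x ∈ maximalIdeal A)
    (hd : addVal A (τ x - x) = d) (hmd : m < d) (N : ℕ) :
    (∀ a, τ a - a ∈ maximalIdeal A ^ N) ↔ N ≤ d - m + 1 := by
  obtain ⟨ϖ, hϖ, h⟩ := exists_uniformizer_addVal_sub hp hn hpA hπ hx hpm hd hmd
  constructor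
  · intro h'
    have := natCast_le_addVal_iff.2 (h' ϖ)
    rw [h] at this
    exact_mod_cast this
  · intro hN
    refine sub_mem_pow_of_uniformizer hres hϖ hτ ?_
    rw [← natCast_le_addVal_iff, h]
    exact_mod_cast hN

end RamificationNumber

/-! ### The Herbrand function as an integral of a step function -/

section Herbrand

variable {p n : ℕ} (hp : p.Prime) {l : ℕ → ℝ}

/-- The number of `j < n` with `l j < s`. -/
def countBelow (n : ℕ) (l : ℕ → ℝ) (s : ℝ) : ℕ := ((Finset.range n).filter fun j => l j < s).card

lemma countBelow_mono : Monotone (countBelow n l) := fun _ _ hst =>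
  Finset.card_le_card (Finset.monotone_filter_right _ fun _ _ h => h.trans_le hst)

lemma countBelow_le {s : ℝ} : countBelow n l s ≤ n :=
  (Finset.card_filter_le _ _).trans (Finset.card_range n).le

lemma countBelow_of_le (hl : ∀ i j, i < j → j < n → l i < l j) {j : ℕ} (hj : j < n) {s : ℝ}
    (h₁ : ∀ i < j, l i < s) (h₂ : s ≤ l j) : countBelow n l s = j := by
  rw [countBelow, show ((Finset.range n).filter fun i => l i < s) = Finset.range j from ?_,
    Finset.card_range]
  ext i
  simp only [Finset.mem_filter, Finset.mem_range]
  constructor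
  · rintro ⟨hi, his⟩
    by_contra hij
    rcases (not_lt.1 hij).eq_or_lt with rfl | h
    · exact absurd his (not_lt.2 h₂)
    · exact absurd (his.trans_le h₂) (not_lt.2 (hl j i h hi).le)
  · exact fun hi => ⟨hi.trans hj, h₁ i hi⟩

/-- The density of the Herbrand function. -/
def density (p n : ℕ) (l : ℕ → ℝ) (s : ℝ) : ℝ := ((p ^ countBelow n l s : ℕ) : ℝ)⁻¹

include hp in
lemma density_antitone : Antitone (density p n l) := fun s t hst =>
  inv_anti₀ (by exact_mod_cast pow_pos hp.pos _)
    (by exact_mod_cast Nat.pow_le_pow_right hp.pos (countBelow_mono hst))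

include hp in
lemma density_pos (s : ℝ) : 0 < density p n l s :=
  inv_pos.2 (by exact_mod_cast pow_pos hp.pos _)

include hp in
lemma density_intervalIntegrable (a b : ℝ) :
    IntervalIntegrable (density p n l) MeasureTheory.volume a b :=
  (density_antitone hp).intervalIntegrable

/-- The primitive of the density. -/
def primitive (p n : ℕ) (l : ℕ → ℝ) (u : ℝ) : ℝ := ∫ s in (0 : ℝ)..u, density p n l s

include hp in
lemma primitive_sub (a b : ℝ) :
    primitive p n l b - primitive p n l a = ∫ s in a..b, density p n l s :=
  intervalIntegral.integral_interval_sub_left (density_intervalIntegrable hp _ _)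
    (density_intervalIntegrable hp _ _)

include hp in
lemma primitive_strictMono : StrictMono (primitive p n l) := by
  intro a b hab
  rw [← sub_pos, primitive_sub hp]
  exact intervalIntegral.intervalIntegral_pos_of_pos (density_intervalIntegrable hp _ _)
    (density_pos hp) hab

include hp in
lemma primitive_continuous : Continuous (primitive p n l) :=
  intervalIntegral.continuous_primitive (density_intervalIntegrable hp) 0

-- The density is continuous from the left at the jumps, so constancy is only needed on the
-- half-open interval, which is the domain of the interval integral.
include hp in
lemma primitive_sub_of_countBelow_eq {a b : ℝ} {k : ℕ}
    (h : ∀ s, a < s → s ≤ b → countBelow n l s = k) (hab : a ≤ b) :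
    primitive p n l b - primitive p n l a = (b - a) * ((p ^ k : ℕ) : ℝ)⁻¹ := by
  rw [primitive_sub hp, intervalIntegral.integral_congr_ae (g := fun _ => ((p ^ k : ℕ) : ℝ)⁻¹)]
  · simp
  · refine MeasureTheory.ae_of_all _ fun s hs => ?_
    rw [Set.uIoc_of_le hab] at hs
    rw [density, h s hs.1 hs.2]

include hp in
lemma primitive_of_le (hl : ∀ i j, i < j → j < n → l i < l j) (hn : 0 < n) (h0 : 0 < l 0) {u : ℝ}
    (hu : u ≤ l 0) : primitive p n l u = u := by
  have hc : ∀ s, s ≤ l 0 → countBelow n l s = 0 := fun s hs =>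
    countBelow_of_le hl hn (by simp) hs
  have h00 : primitive p n l 0 = 0 := intervalIntegral.integral_same
  rcases le_total 0 u with h | h
  · have := primitive_sub_of_countBelow_eq (n := n) (l := l) hp (k := 0)
      (fun s _ hs => hc s (hs.trans hu)) h
    simpa [h00] using this
  · have := primitive_sub_of_countBelow_eq (n := n) (l := l) hp (k := 0)
      (fun s _ hs => hc s (hs.trans h0.le)) h
    simpa [h00] using this

include hp in
lemma primitive_succ (hl : ∀ i j, i < j → j < n → l i < l j) {j : ℕ} (hj : j + 1 < n) :
    primitive p n l (l (j + 1)) =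
      primitive p n l (l j) + (l (j + 1) - l j) * ((p ^ (j + 1) : ℕ) : ℝ)⁻¹ := by
  rw [← primitive_sub_of_countBelow_eq hp (fun s h₁ h₂ => ?_) (hl j (j + 1) (by omega) hj).le]
  · ring
  · refine countBelow_of_le hl hj (fun i hi => ?_) h₂
    rcases (Nat.lt_succ_iff.1 hi).eq_or_lt with rfl | h
    · exact h₁
    · exact (hl i j h (by omega)).trans h₁

-- The primitive starts at `-1` and grows at least with slope `p⁻ⁿ`, so the intermediate value
-- theorem reaches every `v ≥ -1`.
include hp in
lemma primitive_surjOn (hl : ∀ i j, i < j → j < n → l i < l j) (hn : 0 < n) (h0 : 0 < l 0) {v : ℝ}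
    (hv : -1 ≤ v) : ∃ u, -1 ≤ u ∧ primitive p n l u = v := by
  have h1 : primitive p n l (-1) = -1 := primitive_of_le hp hl hn h0 (by linarith)
  have hlow : ∀ u, 0 ≤ u → u * ((p ^ n : ℕ) : ℝ)⁻¹ ≤ primitive p n l u := by
    intro u hu
    have : ∫ _ in (0 : ℝ)..u, ((p ^ n : ℕ) : ℝ)⁻¹ ≤ primitive p n l u := by
      refine intervalIntegral.integral_mono_on hu (by simp) (density_intervalIntegrable hp _ _)
        fun s _ => ?_
      refine inv_anti₀ (by exact_mod_cast pow_pos hp.pos _) ?_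
      have : countBelow n l s ≤ n := countBelow_le
      exact_mod_cast Nat.pow_le_pow_right hp.pos this
    simpa using this
  have hpn : (0 : ℝ) < ((p ^ n : ℕ) : ℝ) := by exact_mod_cast pow_pos hp.pos _
  have hb : v ≤ primitive p n l (|v| * ((p ^ n : ℕ) : ℝ)) := by
    refine (le_abs_self v).trans (le_trans (le_of_eq ?_) (hlow _ (by positivity)))
    field_simp
  have hle : (-1 : ℝ) ≤ |v| * ((p ^ n : ℕ) : ℝ) := by
    have : 0 ≤ |v| * ((p ^ n : ℕ) : ℝ) := by positivity
    linarith
  obtain ⟨u, hu, huv⟩ := intermediate_value_Icc hle (primitive_continuous hp).continuousOn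
    (show v ∈ Set.Icc (primitive p n l (-1)) _ from ⟨by rw [h1]; exact hv, hb⟩)
  exact ⟨u, hu.1, huv⟩

lemma card_filter_dvd {i : ℕ} (hp : p.Prime) (hi : i ≤ n) :
    ((Finset.range (p ^ n)).filter fun k => p ^ i ∣ k).card = p ^ (n - i) := by
  have hpi : 0 < p ^ i := pow_pos hp.pos i
  have hmul : p ^ n = p ^ i * p ^ (n - i) := by rw [← pow_add]; congr 1; omega
  rw [show ((Finset.range (p ^ n)).filter fun k => p ^ i ∣ k) =
    (Finset.range (p ^ (n - i))).image (fun k => p ^ i * k) from ?_,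
    Finset.card_image_of_injective _ fun a b h => Nat.eq_of_mul_eq_mul_left hpi h,
    Finset.card_range]
  ext k
  simp only [Finset.mem_filter, Finset.mem_range, Finset.mem_image]
  constructor
  · rintro ⟨hk, q, rfl⟩
    exact ⟨q, by rw [hmul] at hk; exact Nat.lt_of_mul_lt_mul_left hk, rfl⟩
  · rintro ⟨q, hq, rfl⟩
    exact ⟨by rw [hmul]; exact Nat.mul_lt_mul_of_pos_left hq hpi, dvd_mul_right _ _⟩

end Herbrand

/-! ### From lower jumps to upper jumps -/

section Jumps

variable (R K L : Type*) [CommRing R] [Field K] [Algebra R K] [Field L] [Algebra K L] [Algebra R L]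
  [IsScalarTower R K L]

/-- The lower ramification filtration of a cyclic extension of degree `pⁿ` with lower jumps
`l 0 < ⋯ < l (n - 1)`. -/
structure HasLowerJumps (p n : ℕ) (l : ℕ → ℝ) (κ : (L ≃ₐ[K] L) → ℕ) : Prop where
  injective : Function.Injective κ
  range_eq : Set.range κ = Set.Iio (p ^ n)
  strictMono : ∀ i j, i < j → j < n → l i < l j
  pos : 0 < l 0
  mem_iff : ∀ u σ, σ ∈ lowerRamificationGroup R K L u ↔ ∀ j < n, l j < u → p ^ (j + 1) ∣ κ σ

variable {R K L} {p n : ℕ} {l : ℕ → ℝ} {κ : (L ≃ₐ[K] L) → ℕ}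

namespace HasLowerJumps

variable (H : HasLowerJumps R K L p n l κ) (hp : p.Prime) (hn : 0 < n)
include H

/-- The lower jumps below `u` form an initial segment, and the divisibility at the last of them
implies the others. -/
lemma mem_iff_countBelow {u : ℝ} {σ : L ≃ₐ[K] L} :
    σ ∈ lowerRamificationGroup R K L u ↔ p ^ countBelow n l u ∣ κ σ := by
  rw [H.mem_iff]
  have hc : ∀ j < n, l j < u → j + 1 ≤ countBelow n l u := by
    intro j hj hju
    rw [countBelow, ← Finset.card_range (j + 1)]
    refine Finset.card_le_card fun i hi => ?_
    simp only [Finset.mem_range, Finset.mem_filter] at hi ⊢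
    refine ⟨by omega, ?_⟩
    rcases (Nat.lt_succ_iff.1 hi).eq_or_lt with rfl | h
    · exact hju
    · exact (H.strictMono i j h hj).trans hju
  constructor
  · intro h
    rcases Nat.eq_zero_or_pos (countBelow n l u) with h0 | h0
    · rw [h0, pow_zero]; exact one_dvd _
    have hle : countBelow n l u ≤ n := countBelow_le
    have hlast : l (countBelow n l u - 1) < u := by
      by_contra hge
      rw [not_lt] at hge
      have hsub : ((Finset.range n).filter fun j => l j < u) ⊆
          Finset.range (countBelow n l u - 1) := by
        intro i hi
        simp only [Finset.mem_range, Finset.mem_filter] at hi ⊢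
        by_contra hi'
        rcases (not_lt.1 hi').eq_or_lt with h1 | h1
        · rw [h1] at hge; exact absurd hi.2 (not_lt.2 hge)
        · exact absurd (hi.2.trans_le hge) (not_lt.2 (H.strictMono _ i h1 hi.1).le)
      have := Finset.card_le_card hsub
      rw [Finset.card_range] at this
      change countBelow n l u ≤ _ at this
      omega
    have := h _ (by omega) hlast
    rwa [Nat.sub_add_cancel h0] at this
  · exact fun h j hj hju => (pow_dvd_pow p (hc j hj hju)).trans h

-- Orders are counted through the bijection `κ` onto `{0, …, pⁿ - 1}`; `κ` need not be known to be a
-- homomorphism.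
include hp in
lemma natCard_lowerRamificationGroup (u : ℝ) :
    Nat.card (lowerRamificationGroup R K L u) = p ^ (n - countBelow n l u) := by
  rw [← card_filter_dvd hp countBelow_le, ← Fintype.card_coe, ← Nat.card_eq_fintype_card]
  refine Nat.card_congr (Equiv.ofBijective (fun σ => ⟨κ σ.1, ?_⟩) ⟨fun σ τ h => ?_, ?_⟩)
  · rw [Finset.mem_filter, Finset.mem_range]
    exact ⟨H.range_eq.le ⟨σ.1, rfl⟩, H.mem_iff_countBelow.1 σ.2⟩
  · exact Subtype.ext (H.injective (congrArg Subtype.val h))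
  · rintro ⟨k, hk⟩
    rw [Finset.mem_filter, Finset.mem_range] at hk
    obtain ⟨σ, rfl⟩ := H.range_eq.ge hk.1
    exact ⟨⟨σ, H.mem_iff_countBelow.2 hk.2⟩, rfl⟩

include hn in
lemma lowerRamificationGroup_zero : lowerRamificationGroup R K L 0 = ⊤ := by
  refine eq_top_iff.2 fun σ _ => H.mem_iff_countBelow.2 ?_
  rw [countBelow_of_le H.strictMono hn (by simp) H.pos.le, pow_zero]
  exact one_dvd _

include hp hn in
lemma herbrand_eq : herbrand R K L = primitive p n l := by
  funext u
  rw [herbrand, primitive]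
  congr 1
  funext s
  rw [H.lowerRamificationGroup_zero hn, Subgroup.relIndex_top_right, density]
  have h0 := H.natCard_lowerRamificationGroup hp 0
  rw [H.lowerRamificationGroup_zero hn, countBelow_of_le H.strictMono hn (by simp) H.pos.le,
    Subgroup.card_top] at h0
  have h := (lowerRamificationGroup R K L s).card_mul_index
  rw [h0, H.natCard_lowerRamificationGroup hp, tsub_zero] at h
  have h1 : p ^ n = p ^ (n - countBelow n l s) * p ^ countBelow n l s := by
    rw [← pow_add, Nat.sub_add_cancel countBelow_le]
  rw [h1] at h
  rw [Nat.eq_of_mul_eq_mul_left (pow_pos hp.pos _) h]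

-- Strict monotonicity of the Herbrand function makes the chosen preimage in the definition of the
-- upper numbering equal to `u`.
include hp hn in
lemma upperRamificationGroup_primitive {u : ℝ} (hu : -1 ≤ u) :
    upperRamificationGroup R K L (primitive p n l u) = lowerRamificationGroup R K L u := by
  rw [upperRamificationGroup, H.herbrand_eq hp hn]
  congr 1
  exact (primitive_strictMono hp).injective (Function.invFunOn_eq ⟨u, hu, rfl⟩)

-- The element with `κ σ = pʲ` leaves the filtration exactly at `l j`.
include hp in
lemma exists_mem_notMem {j : ℕ} (hj : j < n) : ∃ σ ∈ lowerRamificationGroup R K L (l j),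
    ∀ u, l j < u → σ ∉ lowerRamificationGroup R K L u := by
  obtain ⟨σ, hσ⟩ := H.range_eq.ge (show p ^ j < p ^ n from Nat.pow_lt_pow_right hp.one_lt hj)
  refine ⟨σ, (H.mem_iff _ _).2 fun i hi hij => ?_, fun u hu h => ?_⟩
  · rw [hσ]
    refine pow_dvd_pow p ?_
    by_contra hji
    rcases (Nat.lt_succ_iff.1 (not_le.1 hji)).eq_or_lt with rfl | h
    · exact lt_irrefl _ hij
    · exact absurd hij (not_lt.2 (H.strictMono j i h hi).le)
  · have := (H.mem_iff _ _).1 h j hj hu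
    rw [hσ, Nat.pow_dvd_pow_iff_le_right hp.one_lt] at this
    omega

include hn in
lemma pos_of_lt {j : ℕ} (hj : j < n) : 0 < l j := by
  rcases Nat.eq_zero_or_pos j with rfl | h
  · exact H.pos
  · exact H.pos.trans (H.strictMono 0 j h hj)

/-- Away from the finitely many `l j`, no comparison `l j < u` changes on a small interval to the
right of `u`. -/
lemma exists_lowerRamificationGroup_eq {u : ℝ} (hu : ∀ j < n, l j ≠ u) :
    ∃ u', u < u' ∧ lowerRamificationGroup R K L u' = lowerRamificationGroup R K L u := by
  have hev : ∀ᶠ u' in nhdsWithin u (Set.Ioi u), ∀ j ∈ Finset.range n, (l j < u' ↔ l j < u) := by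
    rw [Finset.eventually_all]
    intro j hj
    rcases (hu j (Finset.mem_range.1 hj)).lt_or_gt with h | h
    · filter_upwards [self_mem_nhdsWithin] with u' hu'
      exact iff_of_true (h.trans hu') h
    · filter_upwards [mem_nhdsWithin_of_mem_nhds (Iio_mem_nhds h)] with u' hu'
      exact iff_of_false (not_lt.2 (le_of_lt hu')) (not_lt.2 h.le)
  obtain ⟨u', h, hu'⟩ := (hev.and self_mem_nhdsWithin).exists
  refine ⟨u', hu', Subgroup.ext fun σ => ?_⟩
  rw [H.mem_iff, H.mem_iff]
  exact forall₂_congr fun j hj => by rw [h j (Finset.mem_range.2 hj)]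

include hp hn in
theorem upperJumps_eq : upperJumps R K L = {v | ∃ j < n, v = primitive p n l (l j)} := by
  ext v
  constructor
  · rintro ⟨hv, h⟩
    obtain ⟨u, hu, rfl⟩ := primitive_surjOn hp H.strictMono hn H.pos hv
    by_contra hne
    obtain ⟨u', huu', heq⟩ := H.exists_lowerRamificationGroup_eq (u := u) fun j hj hju =>
      hne ⟨j, hj, by rw [hju]⟩
    apply h (primitive p n l u' - primitive p n l u) (sub_pos.2 (primitive_strictMono hp huu'))
    rw [add_sub_cancel, H.upperRamificationGroup_primitive hp hn hu,
      H.upperRamificationGroup_primitive hp hn (hu.trans huu'.le), heq]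
  · rintro ⟨j, hj, rfl⟩
    have hlj := H.pos_of_lt hn hj
    have hv : -1 ≤ primitive p n l (l j) := by
      rw [← primitive_of_le hp H.strictMono hn H.pos (u := -1) (by linarith [H.pos])]
      exact (primitive_strictMono hp).monotone (by linarith)
    refine ⟨hv, fun ε hε heq => ?_⟩
    obtain ⟨u, hu, huv⟩ := primitive_surjOn hp H.strictMono hn H.pos
      (show -1 ≤ primitive p n l (l j) + ε by linarith)
    have hlt : l j < u := (primitive_strictMono (n := n) (l := l) hp).lt_iff_lt.1 (by linarith)
    rw [← huv, H.upperRamificationGroup_primitive hp hn (by linarith),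
      H.upperRamificationGroup_primitive hp hn hu] at heq
    obtain ⟨σ, hσ, hσ'⟩ := H.exists_mem_notMem hp hj
    exact hσ' u hlt (heq ▸ hσ)

include hp in
theorem upperRamificationGroup_ne_bot {j : ℕ} (hj : j < n) :
    upperRamificationGroup R K L (primitive p n l (l j)) ≠ ⊥ := by
  have hn : 0 < n := by omega
  rw [H.upperRamificationGroup_primitive hp hn (by linarith [H.pos_of_lt hn hj])]
  intro h
  obtain ⟨σ, hσ, hσ'⟩ := H.exists_mem_notMem hp hj
  rw [h, Subgroup.mem_bot] at hσ
  exact hσ' (l j + 1) (by linarith) (hσ ▸ one_mem _)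

end HasLowerJumps

/-- The Herbrand function at the lower jumps `p ^ (j + 1) S_j - m`. -/
lemma primitive_lowerJump (hp : p.Prime) {S : ℕ → ℕ} {m : ℕ}
    (hl : ∀ i j, i < j → j < n → ((p ^ (i + 1) * S i : ℕ) : ℝ) - m < (p ^ (j + 1) * S j : ℕ) - m)
    (h0 : 0 < ((p ^ (0 + 1) * S 0 : ℕ) : ℝ) - m) {φs : ℕ → PowerSeries R} [IsDomain R]
    [IsDiscreteValuationRing R] (ht : ∀ j < n, t φs (j + 1) = (p - 1) * S j) {j : ℕ} (hj : j < n) :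
    primitive p n (fun j => ((p ^ (j + 1) * S j : ℕ) : ℝ) - m) ((p ^ (j + 1) * S j : ℕ) - m) =
      c p φs (j + 1) - m := by
  have hp1 : (p : ℝ) - 1 ≠ 0 := by
    have : (1 : ℝ) < p := by exact_mod_cast hp.one_lt
    linarith
  have hp0 : (p : ℝ) ≠ 0 := by exact_mod_cast hp.ne_zero
  have htR : ∀ j < n, (t φs (j + 1) : ℝ) = ((p : ℝ) - 1) * S j := fun j hj => by
    rw [ht j hj, Nat.cast_mul, Nat.cast_sub hp.one_lt.le, Nat.cast_one]
  induction j with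
  | zero =>
    rw [primitive_of_le hp hl hj h0 le_rfl, c, zero_add, Finset.Icc_self, Finset.sum_singleton,
      htR 0 hj]
    push_cast
    field_simp
    ring
  | succ j ih =>
    have h := primitive_succ hp hl hj
    rw [h, ih (by omega), c, c, Finset.sum_Icc_succ_top (show 1 ≤ j + 1 + 1 by omega), htR j (by omega),
      htR (j + 1) hj]
    push_cast
    field_simp
    ring

end Jumps

/-! ### Galois extensions and the cokernel filtration -/

section Field

open Polynomial

variable {K L : Type*} [Field K] [Field L] [Algebra K L] [FiniteDimensional K L]

lemma finrank_le_of_aeval_eq_zero {ξ : L} (hξ : IntermediateField.adjoin K {ξ} = ⊤) {P : K[X]}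
    (hP : P ≠ 0) (hr : aeval ξ P = 0) : Module.finrank K L ≤ P.natDegree := by
  rw [← (Field.primitive_element_iff_minpoly_natDegree_eq K ξ).1 hξ]
  exact natDegree_le_of_dvd (minpoly.dvd K ξ hr) hP

lemma algebra_adjoin_eq_top {ξ : L} (hξ : IntermediateField.adjoin K {ξ} = ⊤) :
    Algebra.adjoin K {ξ} = ⊤ := by
  rw [← IntermediateField.adjoin_simple_toSubalgebra_of_isAlgebraic
    (Algebra.IsAlgebraic.isAlgebraic ξ), hξ, IntermediateField.top_toSubalgebra]

/-- A primitive extension is Galois if a polynomial vanishing at a primitive element has as many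
roots as its degree indicates. -/
lemma isGalois_of_roots [CharZero K] {ξ : L} (hξ : IntermediateField.adjoin K {ξ} = ⊤) {P : K[X]}
    (hP : P ≠ 0) (hr : aeval ξ P = 0) {d : ℕ} (hd : P.natDegree ≤ d) {r : ℕ → L}
    (hroot : ∀ k < d, aeval (r k) P = 0) (hinj : Set.InjOn r (Set.Iio d)) : IsGalois K L := by
  classical
  have hP' : P.map (algebraMap K L) ≠ 0 := (Polynomial.map_ne_zero_iff (algebraMap K L).injective).2 hP
  have hs : (P.map (algebraMap K L)).Splits := by
    rw [splits_iff_card_roots]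
    refine le_antisymm (card_roots' _) ?_
    rw [natDegree_map]
    calc P.natDegree ≤ d := hd
      _ = ((Finset.range d).image r).card := by
        rw [Finset.card_image_of_injOn (by simpa using hinj), Finset.card_range]
      _ ≤ (P.map (algebraMap K L)).roots.toFinset.card := by
        refine Finset.card_le_card fun x hx => ?_
        obtain ⟨k, hk, rfl⟩ := Finset.mem_image.1 hx
        rw [Multiset.mem_toFinset, mem_roots hP', IsRoot, eval_map_algebraMap]
        exact hroot k (Finset.mem_range.1 hk)
      _ ≤ _ := Multiset.toFinset_card_le _
  have hint : IsIntegral K ξ := Algebra.IsIntegral.isIntegral ξ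
  have hsplit : IsSplittingField K L (minpoly K ξ) := by
    refine ⟨hs.of_dvd hP' (Polynomial.map_dvd _ (minpoly.dvd K ξ hr)), ?_⟩
    rw [eq_top_iff, ← algebra_adjoin_eq_top hξ]
    refine Algebra.adjoin_mono (Set.singleton_subset_iff.2 ?_)
    exact (mem_rootSet.2 ⟨minpoly.ne_zero hint, minpoly.aeval K ξ⟩)
  exact IsGalois.of_separable_splitting_field (minpoly.irreducible hint).separable

end Field

/-! ### Representatives of exact level -/

section Cokernel

open IsDiscreteValuationRing hiding maximalIdeal

variable {R : Type*} [CommRing R] [IsDomain R] [IsDiscreteValuationRing R]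
  [IsAdicComplete (maximalIdeal R) R] {F G : FormalGroup R} {φ : PowerSeries R}

lemma eq_zero_of_forall_dvd (y : R) (hy : ∀ r : R, r ≠ 0 → algebraMap R R r ∣ y) : y = 0 := by
  by_contra h
  obtain ⟨π, hπ⟩ := exists_irreducible R
  obtain ⟨c, hc⟩ := hy (π * y) (mul_ne_zero hπ.ne_zero h)
  rw [Algebra.algebraMap_self, RingHom.id_apply, mul_right_comm] at hc
  exact hπ.not_isUnit (IsUnit.of_mul_eq_one c (mul_right_cancel₀ h (by rw [one_mul]; exact hc.symm)))

/-- An element of exact level `m` is congruent, modulo the image of the isogeny, to an element of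
valuation `m`. -/
lemma exists_eq_fadd_of_mem_cokernelFiltration (hφ : PowerSeries.constantCoeff φ = 0) {m : ℕ} (hm : m ≠ 0) {y : R}
    (h : y ∈ cokernelFiltration G φ m) (h' : y ∉ cokernelFiltration G φ (m + 1)) :
    ∃ u z : R, u ∈ maximalIdeal R ∧ z ∈ maximalIdeal R ∧ addVal R u = m ∧
      y = fadd G u (ev φ z) := by
  obtain ⟨hy, u, hu, z, hz, w, hw, hs⟩ := h
  have hinj : Function.Injective (algebraMap R R) := Function.injective_id
  have hum := Ideal.pow_le_self hm hu
  have hw' := ConvergesTo.unique eq_zero_of_forall_dvd hw (hasValue_ev hinj φ hz)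
  have hs' := ConvergesTo.unique eq_zero_of_forall_dvd hs
    (hasFormalSum_fadd hinj G hum (hw' ▸ ev_mem hz hφ))
  refine ⟨u, z, hum, hz, le_antisymm ?_ (natCast_le_addVal_iff.2 hu), hw' ▸ hs'⟩
  -- A larger valuation of `u` would place `y` in level `m + 1`.
  refine Order.le_of_lt_add_one (not_le.1 fun hlt => h' ⟨hy, u, ?_, z, hz, w, hw, hs⟩)
  rw [← natCast_le_addVal_iff]
  exact_mod_cast hlt

end Cokernel

/-! ### Extensions generated by preimages under an isogeny -/

section Kernel

open IsDiscreteValuationRing hiding maximalIdeal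

variable {R : Type*} [CommRing R] [IsDomain R] [IsDiscreteValuationRing R]
  [IsAdicComplete (maximalIdeal R) R] {p n : ℕ}
  {A : Type*} [CommRing A] [IsDomain A] [IsDiscreteValuationRing A] [Algebra R A]
  [IsAdicComplete (maximalIdeal A) A]
  {Gs : ℕ → FormalGroup R} {φs : ℕ → PowerSeries R} {x₀ : Points R (Gs n)}

namespace IsKernelGenerator

variable (H : IsKernelGenerator p n Gs φs x₀)
include H

lemma addOrderOf_eq (hp : p.Prime) (hn : n ≠ 0) : addOrderOf x₀ = p ^ n := by
  have := Fact.mk hp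
  obtain ⟨n, rfl⟩ := Nat.exists_eq_succ_of_ne_zero hn
  refine addOrderOf_eq_prime_pow (fun h => ?_) H.pow_nsmul
  have := H.chain_ne_zero n (by omega)
  rw [chain_self, h] at this
  exact this rfl

lemma injOn_nsmul (hp : p.Prime) (hn : n ≠ 0) :
    Set.InjOn (fun k : ℕ => (k • x₀).1) (Set.Iio (p ^ n)) := by
  intro k hk l hl h
  rw [← H.addOrderOf_eq hp hn] at hk hl
  exact nsmul_injOn_Iio_addOrderOf hk hl (Points.ext h)

lemma chain_nsmul (k : ℕ) : chain φs n 0 (k • x₀).1 = 0 := by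
  obtain ⟨f, hf⟩ := H.exists_chainHom (A := R) (i := 0) (Nat.zero_le n)
  rcases Nat.eq_zero_or_pos n with rfl | hn
  · have := H.pow_nsmul
    rw [pow_zero, one_nsmul] at this
    rw [this, nsmul_zero, ← hf, map_zero]; rfl
  have h : f x₀ = 0 := Points.ext (by
    have := H.chain_eq_zero 0 hn
    rw [pow_zero, one_nsmul] at this
    rw [hf, this]; rfl)
  rw [← hf, map_nsmul, h, nsmul_zero]; rfl

lemma chain_add_nsmul (z : Points R (Gs n)) (k : ℕ) :
    chain φs n 0 (z + k • x₀).1 = chain φs n 0 z.1 := by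
  obtain ⟨f, hf⟩ := H.exists_chainHom (A := R) (i := 0) (Nat.zero_le n)
  have h : f (k • x₀) = 0 := Points.ext ((hf _).trans (H.chain_nsmul k))
  rw [← hf, map_add, h, add_zero, hf]

lemma chain_add_map (hθ : ∀ r ∈ maximalIdeal R, Algebra.ofId R A r ∈ maximalIdeal A)
    {u : R} (hu : u ∈ maximalIdeal R) {x : Points A (Gs n)}
    (hxu : chain φs n 0 x.1 = algebraMap R A u) (z : Points R (Gs n)) :
    chain φs n 0 (x + Points.map _ hθ z).1 =
      algebraMap R A (fadd (Gs 0) u (chain φs n 0 z.1)) := by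
  obtain ⟨f, hf⟩ := H.exists_chainHom (A := A) (i := 0) (Nat.zero_le n)
  have hz : chain φs n 0 z.1 ∈ maximalIdeal R := chain_mem H.constantCoeff (Nat.zero_le n) z.2
  rw [← hf, map_add, Points.val_add, hf, hf, hxu]
  refine Eq.trans ?_ (fadd_comp_algHom (Algebra.ofId R A) hθ (Gs 0) hu hz).symm
  congr 1
  exact (ev_comp_algHom (Algebra.ofId R A) hθ z.2 (comp φs 0 (n - 0))).symm

/-- Subtracting the rational point `z` from `w` removes the part of the image coming from `F(K)` and
leaves `u`, the representative of controlled valuation. -/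
lemma chain_sub_map (hθ : ∀ r ∈ maximalIdeal R, Algebra.ofId R A r ∈ maximalIdeal A)
    {u : R} (hu : u ∈ maximalIdeal R) {w : Points A (Gs n)} {z : Points R (Gs n)}
    (hw : chain φs n 0 w.1 = algebraMap R A (fadd (Gs 0) u (chain φs n 0 z.1))) :
    chain φs n 0 (w - Points.map _ hθ z).1 = algebraMap R A u := by
  obtain ⟨f, hf⟩ := H.exists_chainHom (A := A) (i := 0) (Nat.zero_le n)
  obtain ⟨g, hg⟩ := H.exists_chainHom (A := R) (i := 0) (Nat.zero_le n)
  have hz : f (Points.map _ hθ z) = Points.map _ hθ (g z) := by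
    ext
    rw [hf, Points.map_val, Points.map_val, hg]
    exact (ev_comp_algHom (Algebra.ofId R A) hθ z.2 (comp φs 0 (n - 0))).symm
  have hw' : f w = Points.map _ hθ (⟨u, hu⟩ + g z) := by
    ext
    rw [hf, hw, ← hg]
    rfl
  rw [← hf, map_sub, hw', hz, map_add, add_sub_cancel_right]
  rfl

/-- The points of the kernel over an extension are multiples of the generator. -/
lemma exists_nsmul_of_chain_eq_zero (hp : p.Prime) (hn : n ≠ 0)
    (hht : HasHeight p n (comp φs 0 n)) {d : A} (hd : d ∈ maximalIdeal A)
    (h0 : chain φs n 0 d = 0) : ∃ k < p ^ n, d = algebraMap R A (k • x₀).1 := by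
  obtain ⟨h1, h2⟩ := hht.coeff_mem hp (constantCoeff_comp H.constantCoeff (by omega))
  obtain ⟨h, hu, hφh⟩ := exists_eq_prod_mul h1 h2 (r := fun k => (k • x₀).1)
    (fun k _ => (k • x₀).2) (fun k _ => H.chain_nsmul k) (H.injOn_nsmul hp hn)
  change ev (comp φs 0 n) d = 0 at h0
  rw [hφh, ev_mul hd, ev_coe hd, map_prod] at h0
  rcases mul_eq_zero.1 h0 with h0 | h0
  · obtain ⟨k, hk, hk0⟩ := Finset.prod_eq_zero_iff.1 h0
    refine ⟨k, Finset.mem_range.1 hk, ?_⟩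
    simpa [sub_eq_zero] using hk0
  · exact absurd h0 (isUnit_ev hd hu).ne_zero

end IsKernelGenerator

end Kernel

section Extension

open IsDiscreteValuationRing hiding maximalIdeal

variable {R : Type*} [CommRing R] [IsDomain R] [IsDiscreteValuationRing R]
  [IsAdicComplete (maximalIdeal R) R] {p n : ℕ}
  {K L : Type*} [Field K] [CharZero K] [Algebra R K] [IsFractionRing R K] [Field L] [Algebra K L]
  [Algebra R L] [IsScalarTower R K L] [FiniteDimensional K L]

/-- The action of the Galois group on the integral closure. -/
def galRestrict (R : Type*) {K L : Type*} [CommRing R] [Field K] [Algebra R K] [Field L]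
    [Algebra K L] [Algebra R L] [IsScalarTower R K L] (σ : L ≃ₐ[K] L) :
    integralClosure R L →ₐ[R] integralClosure R L :=
  (AlgEquiv.mapIntegralClosure (σ.restrictScalars R) : _ ≃ₐ[R] _)

omit [IsDomain R] [IsDiscreteValuationRing R] [IsAdicComplete (maximalIdeal R) R] [CharZero K]
  [IsFractionRing R K] [FiniteDimensional K L] in
lemma galRestrict_mem [IsLocalRing (integralClosure R L)] (σ : L ≃ₐ[K] L)
    (x : integralClosure R L) (hx : x ∈ maximalIdeal (integralClosure R L)) :
    galRestrict R σ x ∈ maximalIdeal (integralClosure R L) := by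
  rw [mem_maximalIdeal, mem_nonunits_iff] at hx ⊢
  exact fun h => hx ((MulEquiv.isUnit_map
    (AlgEquiv.mapIntegralClosure (σ.restrictScalars R) : _ ≃ₐ[R] _)).1 h)

omit [IsDomain R] [IsDiscreteValuationRing R] [IsAdicComplete (maximalIdeal R) R] [CharZero K]
  [IsFractionRing R K] [FiniteDimensional K L] in
lemma mem_lowerRamificationGroup_iff [IsLocalRing (integralClosure R L)] {σ : L ≃ₐ[K] L} {u : ℝ} :
    σ ∈ lowerRamificationGroup R K L u ↔
      ∀ a, galRestrict R σ a - a ∈ maximalIdeal (integralClosure R L) ^ (⌈u⌉ + 1).toNat := by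
  rw [lowerRamificationGroup, ringJacobson_eq_maximalIdeal]
  exact AddSubgroup.mem_inertia

variable [IsDiscreteValuationRing (integralClosure R L)]
  [IsAdicComplete (maximalIdeal (integralClosure R L)) (integralClosure R L)]
  {Gs : ℕ → FormalGroup R} {φs : ℕ → PowerSeries R} {x₀ : Points R (Gs n)}
  (H : IsKernelGenerator p n Gs φs x₀) (hp : p.Prime) (hpm : (p : R) ∈ maximalIdeal R)

/-- The preimages of a point under an isogeny of height `n` are zeros of a polynomial of degree
`p ^ n`. -/
lemma exists_polynomial (hp : p.Prime) (hht : HasHeight p n (comp φs 0 n))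
    (h0 : PowerSeries.constantCoeff (comp φs 0 n) = 0) {y : R} (hy : y ∈ maximalIdeal R) :
    ∃ P : Polynomial K, P ≠ 0 ∧ P.natDegree = p ^ n ∧ ∀ a ∈ maximalIdeal (integralClosure R L),
      ev (comp φs 0 n) a = algebraMap R _ y → Polynomial.aeval (a : L) P = 0 := by
  obtain ⟨h1, h2⟩ := hht.coeff_mem hp h0
  have hpn : p ^ n ≠ 0 := pow_ne_zero _ hp.ne_zero
  -- Subtracting a constant in the maximal ideal leaves the Weierstrass degree equal to `pⁿ`.
  obtain ⟨f, h, hf, hdeg, -, hu, hfh⟩ := exists_weierstrass (d := p ^ n)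
    (g := comp φs 0 n - PowerSeries.C y) (by rwa [map_sub, PowerSeries.coeff_C_of_ne_zero hpn, sub_zero])
    (fun i hi => by
      refine map_sub (PowerSeries.coeff (R := R) i) _ _ ▸ sub_mem (h2 i hi) ?_
      rw [PowerSeries.coeff_C]
      split_ifs
      exacts [hy, zero_mem _])
  refine ⟨f.map (algebraMap R K), (hf.map _).ne_zero, by rw [hf.natDegree_map, hdeg],
    fun a ha hay => ?_⟩
  have h3 : ev (comp φs 0 n - PowerSeries.C y) a = 0 := by
    rw [ev_sub ha, hay, ev_C ha, sub_self]
  rw [hfh, ev_mul ha, ev_coe ha] at h3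
  have h4 := (mul_eq_zero.1 h3).resolve_right (isUnit_ev ha hu).ne_zero
  rw [Polynomial.aeval_map_algebraMap, ← Subalgebra.coe_val (integralClosure R L),
    Polynomial.aeval_algHom_apply, h4, map_zero]

include H hp hpm in
/-- An element whose image under the isogeny has small valuation prime to `p` generates a totally
ramified extension. -/
lemma ramification_of_chain {S : ℕ → ℕ} (hS : ∀ j < n, ∃ z : Points R (Gs (j + 1)), z ≠ 0 ∧
      z.1 = chain φs n (j + 1) (p ^ j • x₀).1 ∧ ev (φs (j + 1)) z.1 = 0 ∧ addVal R z.1 = S j)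
    {m : ℕ} (hmp : ¬ p ∣ m) (hmS : m < p * S 0) {u : R} (hu : addVal R u = m)
    {x : integralClosure R L} (hx : x ∈ maximalIdeal (integralClosure R L))
    (hxu : chain φs n 0 x = algebraMap R _ u) (hle : Module.finrank K L ≤ p ^ n) :
    Module.finrank K L = p ^ n ∧ addVal (integralClosure R L) x = m ∧
    (∀ r : R, addVal (integralClosure R L) (algebraMap R _ r) = (p ^ n : ℕ) * addVal R r) ∧
      (maximalIdeal R).map (algebraMap R (integralClosure R L)) =
        maximalIdeal (integralClosure R L) ^ (p ^ n) ∧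
      ∀ a : integralClosure R L, ∃ r : R,
        a - algebraMap R _ r ∈ maximalIdeal (integralClosure R L) := by
  obtain ⟨e, f, he0, hef, he, hmap, hf1⟩ := exists_ramification R K L
  obtain ⟨v, hv, hvN, -⟩ := H.addVal_chain hS hp hpm he he0 hx (i := 0) (N := e * m)
    (by rw [hxu, he, hu]; norm_cast)
    (fun _ => by rw [← mul_assoc, mul_comm p e, mul_assoc]
                 exact Nat.mul_lt_mul_of_pos_left hmS (Nat.pos_of_ne_zero he0))
    (l := n) (by omega)
  rw [zero_add, chain_self] at hv
  -- The relation `pⁿ v_L(x) = e m` with `m` prime to `p` forces the ramification.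
  have hdvd : p ^ n ∣ e := by
    have hcop : Nat.Coprime (p ^ n) m := ((Nat.Prime.coprime_iff_not_dvd hp).2 hmp).pow_left n
    exact hcop.dvd_of_dvd_mul_right ⟨v, hvN.symm⟩
  have hpos : 0 < Module.finrank K L := Module.finrank_pos
  have hed : e ∣ Module.finrank K L := ⟨f, hef.symm⟩
  have he' : e = p ^ n := le_antisymm ((Nat.le_of_dvd hpos hed).trans hle)
    (Nat.le_of_dvd (Nat.pos_of_ne_zero he0) hdvd)
  have hfin : Module.finrank K L = p ^ n := le_antisymm hle (he' ▸ Nat.le_of_dvd hpos hed)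
  subst he'
  have hf : f = 1 := Nat.eq_of_mul_eq_mul_left (pow_pos hp.pos n) (by rw [hef, hfin, mul_one])
  rw [Nat.eq_of_mul_eq_mul_left (pow_pos hp.pos n) hvN] at hv
  exact ⟨hfin, hv, he, hmap, hf1 hf⟩

end Extension

/-! ### Ramification of the extensions generated by preimages -/

section Extension

open IsDiscreteValuationRing hiding maximalIdeal

variable {R : Type*} [CommRing R] [IsDomain R] [IsDiscreteValuationRing R]
  [IsAdicComplete (maximalIdeal R) R] {p n : ℕ}
  {K L : Type*} [Field K] [CharZero K] [Algebra R K] [IsFractionRing R K] [Field L] [Algebra K L]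
  [Algebra R L] [IsScalarTower R K L] [FiniteDimensional K L]
  [IsDiscreteValuationRing (integralClosure R L)]
  [IsAdicComplete (maximalIdeal (integralClosure R L)) (integralClosure R L)]
  {Gs : ℕ → FormalGroup R} {φs : ℕ → PowerSeries R} {x₀ : Points R (Gs n)}
  (H : IsKernelGenerator p n Gs φs x₀) (hp : p.Prime) (hpm : (p : R) ∈ maximalIdeal R)
  (hn : n ≠ 0) (hht : HasHeight p n (comp φs 0 n))
  (hθ : ∀ r ∈ maximalIdeal R, Algebra.ofId R (integralClosure R L) r ∈
    maximalIdeal (integralClosure R L))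
  {x : Points (integralClosure R L) (Gs n)} {u : R}
  (hxu : chain φs n 0 x.1 = algebraMap R _ u) {z : Points R (Gs n)}
  (hgen : IntermediateField.adjoin K {((x + Points.map _ hθ z).1 : L)} = ⊤)

omit [CharZero K] [IsFractionRing R K] [FiniteDimensional K L] in
include H hp hn hht hxu in
/-- The Galois group translates the points above a rational point by the kernel. -/
lemma exists_galRestrict_eq (σ : L ≃ₐ[K] L) : ∃ k < p ^ n,
    Points.map (galRestrict R σ) (galRestrict_mem σ) x = x + Points.map _ hθ (k • x₀) := by
  set τ : Points (integralClosure R L) (Gs n) →+ _ :=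
    Points.map (galRestrict R σ) (galRestrict_mem σ)
  obtain ⟨f, hf⟩ := H.exists_chainHom (A := integralClosure R L) (i := 0) (Nat.zero_le n)
  have h1 : f (τ x) = f x := by
    ext
    rw [hf, hf, hxu]
    have h := ev_comp_algHom (galRestrict R σ) (galRestrict_mem σ) x.2 (comp φs 0 (n - 0))
    change _ = chain φs n 0 (τ x).1 at h
    rw [← h]
    change ((galRestrict R σ (chain φs n 0 x.1) : integralClosure R L) : L) = _
    rw [hxu, AlgHom.commutes]
  have h2 : chain φs n 0 (-x + τ x).1 = 0 := by
    rw [← hf, map_add, map_neg, h1, neg_add_cancel]; rfl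
  obtain ⟨k, hk, h3⟩ := H.exists_nsmul_of_chain_eq_zero hp hn hht (-x + τ x).2 h2
  refine ⟨k, hk, ?_⟩
  rw [← neg_add_eq_iff_eq_add]
  exact Points.ext h3

-- The extension is generated by the sum of `x` and a rational point, and the Galois group fixes the
-- latter.
include hgen in
omit [CharZero K] [IsFractionRing R K] in
lemma eq_of_map_galRestrict_eq {σ τ : L ≃ₐ[K] L}
    (h : Points.map (galRestrict R σ) (galRestrict_mem σ) x =
      Points.map (galRestrict R τ) (galRestrict_mem τ) x) : σ = τ := by
  have hz : ∀ σ : L ≃ₐ[K] L, Points.map (galRestrict R σ) (galRestrict_mem σ)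
      (Points.map (Algebra.ofId R (integralClosure R L)) hθ z) = Points.map _ hθ z := fun σ =>
    Points.ext ((galRestrict R σ).commutes _)
  have h1 : Points.map (galRestrict R σ) (galRestrict_mem σ) (x + Points.map _ hθ z) =
      Points.map (galRestrict R τ) (galRestrict_mem τ) (x + Points.map _ hθ z) := by
    rw [map_add, map_add, h, hz, hz]
  have h2 : (σ : L →ₐ[K] L) = τ := by
    refine AlgHom.ext_of_adjoin_eq_top (algebra_adjoin_eq_top hgen) ?_
    rintro _ rfl
    exact congrArg (fun w => ((w : Points (integralClosure R L) (Gs n)).1 : L)) h1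
  exact AlgEquiv.coe_toAlgHom_injective h2

include H hp hn hht hxu hgen in
/-- A preimage of a rational point under the isogeny generates a Galois extension. -/
lemma isGalois_of_chain (hu : u ∈ maximalIdeal R) :
    IsGalois K L := by
  have hinj : Function.Injective (algebraMap R (integralClosure R L)) := by
    have := faithfulSMul_of_tower R K L
    exact integralClosure_algebraMap_injective R L
  obtain ⟨P, hP, hdeg, hroot⟩ := exists_polynomial (K := K) (L := L) hp hht
    (constantCoeff_comp H.constantCoeff (by omega)) (y := fadd (Gs 0) u (chain φs n 0 z.1))
    (fadd_mem _ hu (chain_mem H.constantCoeff (Nat.zero_le n) z.2))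
  -- The `pⁿ` translates by the kernel all lie above the same rational point, so they are as many
  -- roots in `L` as the degree allows.
  refine isGalois_of_roots hgen hP (hroot _ (Points.mem _) (H.chain_add_map hθ hu hxu z)) hdeg.le
    (r := fun k => ((x + Points.map _ hθ (z + k • x₀)).1 : L))
    (fun k _ => hroot _ (Points.mem _) ?_) fun k hk l hl h => ?_
  · rw [← H.chain_add_nsmul z k]
    exact H.chain_add_map hθ hu hxu (z + k • x₀)
  · have h1 : x + Points.map _ hθ (z + k • x₀) = x + Points.map _ hθ (z + l • x₀) :=
      Points.ext (Subtype.ext h)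
    have h2 : z + k • x₀ = z + l • x₀ :=
      Points.ext (hinj (congrArg Points.val (add_left_cancel h1)))
    exact H.injOn_nsmul hp hn hk hl (congrArg Points.val (add_left_cancel h2))

end Extension

section Jumps

lemma strictMono_of_succ {n : ℕ} {l : ℕ → ℝ} (h : ∀ j, j + 1 < n → l j < l (j + 1)) (i j : ℕ)
    (hij : i < j) (hj : j < n) : l i < l j := by
  induction j, hij using Nat.le_induction with
  | base => exact h i hj
  | succ j hij ih => exact (ih (by omega)).trans (h j hj)

lemma toNat_ceil_add_one_le_iff {u : ℝ} {m d : ℕ} (hmd : m < d) :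
    (⌈u⌉ + 1).toNat ≤ d - m + 1 ↔ u ≤ (d : ℝ) - m := by
  have : u ≤ (d : ℝ) - m ↔ ⌈u⌉ ≤ (d : ℤ) - m := by
    rw [Int.ceil_le]; push_cast; rfl
  rw [this]
  omega

end Jumps

/-! ### The lower ramification filtration -/

section LowerJumps

open IsDiscreteValuationRing hiding maximalIdeal

variable {R : Type*} [CommRing R] [IsDomain R] [IsDiscreteValuationRing R]
  [IsAdicComplete (maximalIdeal R) R] {p n : ℕ}
  {K L : Type*} [Field K] [CharZero K] [Algebra R K] [IsFractionRing R K] [Field L] [Algebra K L]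
  [Algebra R L] [IsScalarTower R K L] [FiniteDimensional K L]
  [IsDiscreteValuationRing (integralClosure R L)]
  [IsAdicComplete (maximalIdeal (integralClosure R L)) (integralClosure R L)]
  {Gs : ℕ → FormalGroup R} {φs : ℕ → PowerSeries R} {x₀ : Points R (Gs n)}
  (H : IsKernelGenerator p n Gs φs x₀) (hp : p.Prime) (hpm : (p : R) ∈ maximalIdeal R)
  (hn : n ≠ 0) (hht : HasHeight p n (comp φs 0 n))
  (hθ : ∀ r ∈ maximalIdeal R, Algebra.ofId R (integralClosure R L) r ∈
    maximalIdeal (integralClosure R L))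
  {x : Points (integralClosure R L) (Gs n)} {u : R}
  (hxu : chain φs n 0 x.1 = algebraMap R _ u) {z : Points R (Gs n)}
  (hgen : IntermediateField.adjoin K {((x + Points.map _ hθ z).1 : L)} = ⊤)
  {S : ℕ → ℕ} (hS : ∀ j < n, ∃ z : Points R (Gs (j + 1)), z ≠ 0 ∧
      z.1 = chain φs n (j + 1) (p ^ j • x₀).1 ∧ ev (φs (j + 1)) z.1 = 0 ∧ addVal R z.1 = S j)

-- Over `K` the valuation of `[pʲ] x₀` is `S_j / p^{n-j-1}`; total ramification multiplies it by
-- `pⁿ`, and the factor `k` prime to `p` is harmless.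
include H hS hp hpm in
omit [IsAdicComplete (maximalIdeal (integralClosure R L)) (integralClosure R L)] in
lemma addVal_algebraMap_nsmul (he : ∀ r : R, addVal (integralClosure R L) (algebraMap R _ r) =
      (p ^ n : ℕ) * addVal R r) {j k : ℕ} (hj : j < n) (hk : p.Coprime k) :
    addVal (integralClosure R L) (algebraMap R _ ((p ^ j * k) • x₀).1) =
      (p ^ (j + 1) * S j : ℕ) := by
  obtain ⟨v, hv, hvS⟩ := H.addVal_pow_nsmul hS hp hpm hj
  rw [he, mul_nsmul, Points.addVal_nsmul_of_isUnit _ (Points.isUnit_natCast_of_coprime hpm hk),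
    hv, ← hvS, ← mul_assoc, ← pow_add, show j + 1 + (n - (j + 1)) = n by omega]
  norm_cast

include H hp hpm hn hht hxu hgen hS in
/-- The lower ramification filtration of the extension generated by a preimage under the isogeny of
a point whose valuation is small and prime to `p`. -/
theorem exists_hasLowerJumps [IsGalois K L] {m : ℕ} (hmp : ¬ p ∣ m) (hmS : m < p * S 0)
    (hfin : Module.finrank K L = p ^ n) (hxm : addVal (integralClosure R L) x.1 = m)
    (he : ∀ r : R, addVal (integralClosure R L) (algebraMap R _ r) = (p ^ n : ℕ) * addVal R r)
    (hres : ∀ a : integralClosure R L, ∃ r : R,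
      a - algebraMap R _ r ∈ maximalIdeal (integralClosure R L)) :
    ∃ κ, HasLowerJumps R K L p n (fun j => ((p ^ (j + 1) * S j : ℕ) : ℝ) - m) κ := by
  choose κ hκ hκx using exists_galRestrict_eq (K := K) H hp hn hht hθ hxu
  have hinj : Function.Injective κ := fun σ τ h =>
    eq_of_map_galRestrict_eq hθ hgen (by rw [hκx, hκx, h])
  have hpmA : (p : integralClosure R L) ∈ maximalIdeal (integralClosure R L) := by
    simpa using hθ _ hpm
  obtain ⟨π, hπ⟩ := exists_irreducible R
  have hπe : addVal (integralClosure R L) (algebraMap R _ π) = (p ^ n : ℕ) := by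
    rw [he, addVal_uniformizer hπ, mul_one]
  have hlt : ∀ j, j + 1 < n → ((p ^ (j + 1) * S j : ℕ) : ℝ) - m <
      ((p ^ (j + 1 + 1) * S (j + 1) : ℕ) : ℝ) - m := by
    intro j hj
    have h1 := H.level_lt hS hp hpm hj
    have h2 : p ^ (j + 1) * S j < p ^ (j + 1 + 1) * S (j + 1) := by
      rw [pow_succ p (j + 1), mul_assoc]
      exact Nat.mul_lt_mul_of_pos_left h1 (pow_pos hp.pos _)
    exact sub_lt_sub_right (by exact_mod_cast h2) _
  have hmono := strictMono_of_succ hlt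
  have hmS' : (m : ℝ) < (p ^ (0 + 1) * S 0 : ℕ) := by
    rw [zero_add, pow_one]; exact_mod_cast hmS
  refine ⟨κ, hinj, ?_, hmono, sub_pos.2 hmS', fun s σ => ?_⟩
  -- Injectivity suffices for surjectivity, since the Galois group has order `pⁿ`.
  · have hbij : Function.Bijective (fun σ => (⟨κ σ, hκ σ⟩ : Fin (p ^ n))) := by
      refine Function.Injective.bijective_of_nat_card_le
        (fun σ τ h => hinj (congrArg Fin.val h)) ?_
      rw [IsGalois.card_aut_eq_finrank, hfin, Nat.card_fin]
    ext k
    constructor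
    · rintro ⟨σ, rfl⟩; exact hκ σ
    · intro hk
      obtain ⟨σ, hσ⟩ := hbij.2 ⟨k, hk⟩
      exact ⟨σ, congrArg Fin.val hσ⟩
  · rw [mem_lowerRamificationGroup_iff]
    -- The identity is treated apart: `κ σ = 0` has no exact power of `p`.
    rcases Nat.eq_zero_or_pos (κ σ) with h0 | h0
    · have hσ : σ = 1 := by
        refine eq_of_map_galRestrict_eq hθ hgen ?_
        rw [hκx, h0, zero_nsmul, map_zero, add_zero]
        exact Points.ext rfl
      refine iff_of_true (fun a => ?_) fun j _ _ => by rw [h0]; exact dvd_zero _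
      have : galRestrict R σ a = a := by rw [hσ]; rfl
      rw [this, sub_self]
      exact zero_mem _
    · obtain ⟨j, k, hk, hjk⟩ := Nat.exists_eq_pow_mul_and_not_dvd h0.ne' p hp.ne_one
      have hjn : j < n := by
        rw [← Nat.pow_lt_pow_iff_right hp.one_lt]
        exact lt_of_le_of_lt (Nat.le_of_dvd h0 ⟨k, hjk⟩) (hκ σ)
      have hd : addVal (integralClosure R L) (galRestrict R σ x.1 - x.1) =
          (p ^ (j + 1) * S j : ℕ) := by
        have h1 := congrArg Points.val (hκx σ)
        rw [Points.map_val] at h1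
        rw [h1, Points.addVal_val_add_sub, hjk]
        exact addVal_algebraMap_nsmul H hp hpm hS he hjn ((Nat.Prime.coprime_iff_not_dvd hp).2 hk)
      have hmd : m < p ^ (j + 1) * S j := by
        have h1 : (m : ℝ) < (p ^ (j + 1) * S j : ℕ) := by
          rcases Nat.eq_zero_or_pos j with rfl | h
          · exact hmS'
          · have := hmono 0 j h hjn
            linarith
        exact_mod_cast h1
      rw [forall_sub_mem_pow_iff hp hn hres hpmA hπe hxm hmp (galRestrict_mem σ) hd hmd,
        toNat_ceil_add_one_le_iff hmd]
      constructor
      · intro hs i hi his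
        have hij : i < j := by
          by_contra hij
          rcases (not_lt.1 hij).eq_or_lt with rfl | h
          · exact absurd his (not_lt.2 hs)
          · exact absurd (his.trans_le hs) (not_lt.2 (hmono j i h hi).le)
        rw [hjk]
        exact (pow_dvd_pow p hij).trans (dvd_mul_right _ _)
      · intro h
        by_contra hs
        have h1 := h j hjn (not_le.1 hs)
        rw [hjk, pow_succ, Nat.mul_dvd_mul_iff_left (pow_pos hp.pos j)] at h1
        exact hk h1

end LowerJumps

end FormalIsogeny

end

theorem proposition2p9
    {R : Type*} [CommRing R] [IsDomain R] [IsDiscreteValuationRing R]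
    [IsAdicComplete (IsLocalRing.maximalIdeal R) R]
    {p : ℕ} [Fact p.Prime] [CharP (IsLocalRing.ResidueField R) p]
    [PerfectField (IsLocalRing.ResidueField R)]
    {K : Type*} [Field K] [CharZero K] [Algebra R K] [IsFractionRing R K]
    {Kbar : Type*} [Field Kbar] [Algebra K Kbar] [Algebra R Kbar] [IsScalarTower R K Kbar]
    [IsAlgClosure K Kbar]
    {n : ℕ} (hn : 1 ≤ n)
    {F G : FormalGroup R} [F.IsComm] [G.IsComm] {φ : PowerSeries R}
    (hφ : FormalIsogeny.IsIsogeny p n F G φ)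
    (hker : FormalIsogeny.HasRationalCyclicKernel (integralClosure R Kbar) F φ)
    {Gs : ℕ → FormalGroup R} {φs : ℕ → PowerSeries R}
    (hfac : FormalIsogeny.IsFactorization (integralClosure R Kbar) p n F G φ Gs φs)
    {m : ℕ} (hm : 1 ≤ m) (hmc : (m : ℝ) < FormalIsogeny.c p φs 1) (hpm : ¬ p ∣ m)
    {y : R} (hy : y ∈ FormalIsogeny.cokernelFiltration G φ m)
    (hy' : y ∉ FormalIsogeny.cokernelFiltration G φ (m + 1))
    {x : integralClosure R Kbar} (hx : x ∈ Ring.jacobson (integralClosure R Kbar))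
    (hxy : FormalIsogeny.HasValue φ x (algebraMap R (integralClosure R Kbar) y)) :
    let L := IntermediateField.adjoin K {(x : Kbar)}
    Module.finrank K L = p ^ n ∧
    IsGalois K L ∧
    FormalIsogeny.IsTotallyRamified R K L ∧
    FormalIsogeny.upperJumps R K L =
      {v : ℝ | ∃ i : ℕ, 1 ≤ i ∧ i ≤ n ∧ v = FormalIsogeny.c p φs i - m} ∧
    FormalIsogeny.upperRamificationGroup R K L (FormalIsogeny.c p φs n - m) ≠ ⊥ := by
  intro L
  have hp : p.Prime := Fact.out
  have hn0 : n ≠ 0 := by omega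
  have hpR : (p : R) ∈ maximalIdeal R := by
    rw [← residue_eq_zero_iff, map_natCast, CharP.cast_eq_zero]
  obtain rfl := hfac.source
  obtain rfl := hfac.target
  obtain rfl := hfac.comp_eq
  obtain ⟨x₀, H⟩ := hfac.exists_isKernelGenerator (K := K) hp hpR hker
  obtain ⟨S, hS⟩ := H.exists_level
  have halg : Algebra.IsAlgebraic K Kbar := IsAlgClosure.isAlgebraic
  have hfd : FiniteDimensional K L :=
    IntermediateField.adjoin.finiteDimensional (Algebra.IsIntegral.isIntegral _)
  obtain ⟨hdvr, hcomp⟩ := FormalIsogeny.isDiscreteValuationRing_integralClosure R K L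
  have := FormalIsogeny.faithfulSMul_of_tower R K L
  have hinj := FormalIsogeny.integralClosure_algebraMap_injective R L
  obtain ⟨e, -, he0, -, he, -⟩ := FormalIsogeny.exists_ramification R K L
  have hθ : ∀ r ∈ maximalIdeal R, Algebra.ofId R (integralClosure R L) r ∈
      maximalIdeal (integralClosure R L) :=
    fun r hr => FormalIsogeny.algebraMap_mem_maximalIdeal he0 he hr
  obtain ⟨ξ, hξx⟩ := FormalIsogeny.exists_integralInclusion_eq (R := R) (x := x) L
    (IntermediateField.mem_adjoin_simple_self K _)
  have hξm := FormalIsogeny.mem_maximalIdeal_of_mem_jacobson (R := R) L (hξx ▸ hx)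
  have hξ : IntermediateField.adjoin K {(ξ : L)} = ⊤ := by
    apply IntermediateField.lift_injective
    rw [IntermediateField.lift_adjoin_simple, IntermediateField.lift_top,
      ← FormalIsogeny.coe_integralInclusion, hξx]
  have hξy : FormalIsogeny.ev (FormalIsogeny.comp φs 0 n) ξ = algebraMap R _ y := by
    apply FormalIsogeny.integralInclusion_injective L
    have h := (FormalIsogeny.hasValue_ev hinj (FormalIsogeny.comp φs 0 n) hξm).map
      (FormalIsogeny.integralInclusion R L)
    rw [hξx] at h
    rw [AlgHom.commutes]
    exact FormalIsogeny.ConvergesTo.unique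
      (FormalIsogeny.integralClosure_separated R K Kbar) h hxy
  have hc0 := FormalIsogeny.constantCoeff_comp H.constantCoeff (i := 0) (k := n) (by omega)
  obtain ⟨u, z, hum, hzm, hu, rfl⟩ :=
    FormalIsogeny.exists_eq_fadd_of_mem_cokernelFiltration hc0 (by omega) hy hy'
  obtain ⟨P, hP, hdeg, hroot⟩ := FormalIsogeny.exists_polynomial (K := K) (L := L) hp
    hφ.hasHeight hc0 hy.1
  have hle := FormalIsogeny.finrank_le_of_aeval_eq_zero hξ hP (hroot ξ hξm hξy)
  rw [hdeg] at hle
  let w : FormalIsogeny.Points (integralClosure R L) (Gs n) := ⟨ξ, hξm⟩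
  let z' : FormalIsogeny.Points R (Gs n) := ⟨z, hzm⟩
  -- From here on `w - z` plays the role of `x`; its image is `u`, of valuation exactly `m`, and
  -- adding `z` back recovers the generator of `L`.
  have hxu := H.chain_sub_map hθ hum (w := w) (z := z') hξy
  have hgen : IntermediateField.adjoin K
      {((w - FormalIsogeny.Points.map _ hθ z' + FormalIsogeny.Points.map _ hθ z').1 : L)} = ⊤ := by
    rwa [sub_add_cancel]
  have ht : ∀ j < n, FormalIsogeny.t φs (j + 1) = (p - 1) * S j := fun j hj =>
    H.t_eq hS hp hpR hj
  -- The bound `m < c₁` in integral form, as `c₁ = t₁ p / (p - 1)` and `t₁ = (p - 1) S₀`.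
  have hmS : m < p * S 0 := by
    have h1 : FormalIsogeny.c p φs 1 = (p * S 0 : ℕ) := by
      have hp1 : (p : ℝ) - 1 ≠ 0 := by
        have : (1 : ℝ) < p := by exact_mod_cast hp.one_lt
        linarith
      rw [FormalIsogeny.c, Finset.Icc_self, Finset.sum_singleton, ht 0 hn, Nat.cast_mul,
        Nat.cast_sub hp.one_lt.le, Nat.cast_one, Nat.cast_mul]
      field_simp
      ring
    rw [h1] at hmc
    exact_mod_cast hmc
  obtain ⟨hfin, hxm, he', hmap, hres⟩ := FormalIsogeny.ramification_of_chain H hp hpR hS hpm hmS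
    hu (FormalIsogeny.Points.mem _) hxu hle
  have hgal : IsGalois K L :=
    FormalIsogeny.isGalois_of_chain H hp hn0 hφ.hasHeight hθ hxu hgen hum
  obtain ⟨κ, hκ⟩ := FormalIsogeny.exists_hasLowerJumps H hp hpR hn0 hφ.hasHeight hθ hxu hgen hS
    hpm hmS hfin hxm he' hres
  have hjump : ∀ j < n, _ := fun j hj =>
    FormalIsogeny.primitive_lowerJump hp hκ.strictMono hκ.pos ht hj
  refine ⟨hfin, hgal, ⟨maximalIdeal _, inferInstance, hfin ▸ hmap⟩, ?_, ?_⟩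
  · rw [hκ.upperJumps_eq hp hn]
    ext v
    constructor
    · rintro ⟨j, hj, rfl⟩
      exact ⟨j + 1, by omega, hj, hjump j hj⟩
    · rintro ⟨i, hi, hin, rfl⟩
      obtain ⟨j, rfl⟩ := Nat.exists_eq_add_of_le' hi
      exact ⟨j, hin, (hjump j hin).symm⟩
  · obtain ⟨j, rfl⟩ := Nat.exists_eq_add_of_le' hn
    rw [← hjump j (by omega)]
    exact hκ.upperRamificationGroup_ne_bot hp (by omega)
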